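/- **Reduction of the gauged $N=2$ scalar potential to the $N=1$ scalar potential.** *$N=2$ data (in coordinate charts).* (a) Special Kähler geometry with $n_V$ complex coordinates $z^{I}$: a holomorphic section $(X^{\mathbf\Lambda},F_{\mathbf\Lambda})$, $\mathbf\Lambda=0,\dots,n_V$, with $X^{\mathbf\Lambda}\partial_I F_{\mathbf\Lambda}-F_{\mathbf\Lambda}\partial_I X^{\mathbf\Lambda}=0$, $e^{-K}=i(\bar X^{\mathbf\Lambda}F_{\mathbf\Lambda}-\bar F_{\mathbf\Lambda}X^{\mathbf\Lambda})>0$ and positive metric $g_{I\bar J}=\partial_I\partial_{\bar J}K$. Put $L^{\mathbf\Lambda}=e^{K/2}X^{\mathbf\Lambda}$, $M_{\mathbf\Lambda}=e^{K/2}F_{\mathbf\Lambda}$, $f_I^{\mathbf\Lambda}=(\partial_I+\tfrac12\partial_IK)L^{\mathbf\Lambda}$, $h_{I\mathbf\Lambda}=(\partial_I+\tfrac12\partial_IK)M_{\mathbf\Lambda}$, and let $\mathcal N$ be the matrix with $M=\mathcal N L$, $\bar h_{\bar I}=\mathcal N\bar f_{\bar I}$. (b) Quaternionic Kähler geometry with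 $4n_H$ real coordinates $q^u$ and scale $\lambda=-1$: a vielbein $U^{A\alpha}$ ($A=1,2$; $\alpha=(I,\dot I)$, $I,\dot I=1,\dots,n_H$) with $(U^{A\alpha})^*=\epsilon_{AB}C_{\alpha\beta}U^{B\beta}$, $C_{I\dot J}=\delta_{IJ}=-C_{\dot JI}$, $\epsilon_{12}=1$, metric $h_{uv}=U^{A\alpha}_uU^{B\beta}_vC_{\alpha\beta}\epsilon_{AB}$, an $SU(2)$ connection $\omega^x$ and a $USp(2n_H)$ connection $\Delta^\alpha{}_\beta$ with $$dU^{A\alpha}+\tfrac i2\omega^x(\sigma_x)_B{}^A\wedge U^{B\alpha}+\Delta^\alpha{}_\beta\wedge U^{A\beta}=0,\qquad \Omega^x:=d\omega^x+\tfrac12\epsilon^{xyz}\omega^y\wedge\omega^z=i\lambda\,C_{\alpha\beta}(\sigma^x)_{AB}U^{A\alpha}\wedge U^{B\beta},$$ $(\sigma^x)_A{}^B$ the Pauli matrices and $(\sigma^x)_{AB}=(\sigma^x)_A{}^C\epsilon_{BC}$. (c) A gauging by a real Lie algebra with structure constants $f_{\mathbf{\Lambda\Sigma}}{}^{\mathbf\Gamma}$.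 On the special Kähler side it acts by holomorphic vector fields $k^I_{\mathbf\Lambda}\partial_I$ with $k^I_{\mathbf\Lambda}\partial_IX^{\mathbf\Gamma}=-f_{\mathbf{\Lambda\Sigma}}{}^{\mathbf\Gamma}X^{\mathbf\Sigma}+r_{\mathbf\Lambda}X^{\mathbf\Gamma}$ and $k^I_{\mathbf\Lambda}\partial_IF_{\mathbf\Gamma}=f_{\mathbf{\Lambda\Gamma}}{}^{\mathbf\Sigma}F_{\mathbf\Sigma}+r_{\mathbf\Lambda}F_{\mathbf\Gamma}$, with real prepotential $P^0_{\mathbf\Lambda}$ given by $iP^0_{\mathbf\Lambda}=k^I_{\mathbf\Lambda}\partial_IK+r_{\mathbf\Lambda}$. On the quaternionic side it acts by vector fields $k^u_{\mathbf\Lambda}\partial_u$ with $[k_{\mathbf\Lambda},k_{\mathbf\Sigma}]=f_{\mathbf{\Lambda\Sigma}}{}^{\mathbf\Gamma}k_{\mathbf\Gamma}$ and prepotentials $P^x_{\mathbf\Lambda}$, $dP^x_{\mathbf\Lambda}+\epsilon^{xyz}\omega^yP^z_{\mathbf\Lambda}=\Omega^x(k_{\mathbf\Lambda},\cdot)$;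 if $n_H=0$ the constants $P^x_{\mathbf\Lambda}$ satisfy $\epsilon^{xyz}P^y_{\mathbf\Lambda}P^z_{\mathbf\Sigma}=f_{\mathbf{\Lambda\Sigma}}{}^{\mathbf\Gamma}P^x_{\mathbf\Gamma}$. The $N=2$ potential is $$\mathcal V^{N=2}=\big(g_{I\bar J}k^I_{\mathbf\Lambda}\bar k^{\bar J}_{\mathbf\Sigma}+4h_{uv}k^u_{\mathbf\Lambda}k^v_{\mathbf\Sigma}\big)\bar L^{\mathbf\Lambda}L^{\mathbf\Sigma}+\big(-\tfrac12(\mathrm{Im}\,\mathcal N)^{-1\,\mathbf{\Lambda\Sigma}}-\bar L^{\mathbf\Lambda}L^{\mathbf\Sigma}\big)P^x_{\mathbf\Lambda}P^x_{\mathbf\Sigma}-3P^x_{\mathbf\Lambda}P^x_{\mathbf\Sigma}\bar L^{\mathbf\Lambda}L^{\mathbf\Sigma}.$$ *Truncation.* Split $\mathbf\Lambda=(\Lambda,X)$ with $\Lambda=1,\dots,n_V'=n_V-n_C$ and $X=0,\dots,n_C$. Let $M_R$ be an (immersed) $n_C$-dimensional complex submanifold of the special Kähler manifold, with holomorphic coordinates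 $z^i$, on which $L^\Lambda=0$, $\mathcal N_{X\Lambda}=0$ and $k_X$ is orthogonal to $M_R$. Let $M^{KH}$ be an immersed submanifold of the quaternionic manifold parametrized by $n_H$ complex coordinates $w^s$, on which the restrictions of $U^{2I},\omega^1,\omega^2$ vanish, the restriction of $U^{1I}$ is of type $(0,1)$ in $w$, $P^1_\Lambda=P^2_\Lambda=0$, $P^3_X=0$, and $k_X$ is orthogonal to $M^{KH}$. On $M_R\times M^{KH}$ put $$L=\tfrac i2L^X(P^1_X-iP^2_X),\quad f_{\Lambda\Sigma}=2\bar{\mathcal N}_{\Lambda\Sigma},\quad P_\Lambda=P^0_\Lambda+P^3_\Lambda,\quad D^\Lambda=-2(\mathrm{Im}f)^{-1\,\Lambda\Sigma}(P^0_\Sigma+P^3_\Sigma),$$ let $g_{i\bar\jmath}$ be the metric induced on $M_R$ and $g_{s\bar s'}=2h(\partial_s,\partial_{\bar s'})$ the one induced on $M^{KH}$, and let $\nabla_i=\partial_i+\tfrac12\partial_iK$, $\nabla_s=\partial_s-i\omega^3_s$, $\nabla_{\bar\imath}=\partial_{\bar\imath}-\tfrac12\partial_{\bar\imath}K$, $\nabla_{\bar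 s}=\partial_{\bar s}-i\omega^3_{\bar s}$ on $L$. *Claim.* These are $N=1$ supergravity data: with $\ell=(i,s)$, the block diagonal metric $g_{\ell\bar m}$ is positive, the connection satisfies $[\nabla_\ell,\nabla_{\bar m}]=-g_{\ell\bar m}$ and $[\nabla_\ell,\nabla_m]=0$ (Kähler-Hodge), $\nabla_{\bar\ell}L=0$, and $f_{\Lambda\Sigma}$ is holomorphic and symmetric with positive definite imaginary part. At every point of $M_R\times M^{KH}$ the $N=2$ potential equals the standard $N=1$ potential $4\big(g^{\ell\bar m}\nabla_\ell L\nabla_{\bar m}\bar L-3|L|^2+\tfrac1{16}\mathrm{Im}f_{\Lambda\Sigma}D^\Lambda D^\Sigma\big)$ of these data, that is, $$\mathcal V^{N=2}\big|_{M_R\times M^{KH}}=4\Big[-3L\bar L+g^{i\bar\jmath}\nabla_iL\nabla_{\bar\jmath}\bar L+g^{s\bar s'}\nabla_sL\nabla_{\bar s'}\bar L+\tfrac1{16}\,\mathrm{Im}f_{\Lambda\Sigma}\,D^\Lambda D^\Sigma\Big].$$ -/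

import Mathlib

open scoped ComplexConjugate ComplexOrder ContDiff Matrix

noncomputable section

/-! ## Calculus in several complex variables -/

section Wirtinger

variable {n : Type*} [Fintype n] [DecidableEq n]

/-- The Wirtinger derivative `∂φ/∂zⁱ` of a (real differentiable) function on `ℂⁿ`. -/
def wd (i : n) (φ : (n → ℂ) → ℂ) (z : n → ℂ) : ℂ :=
  (fderiv ℝ φ z (Pi.single i 1) - Complex.I * fderiv ℝ φ z (Pi.single i Complex.I)) / 2

/-- The Wirtinger derivative `∂φ/∂z̄ⁱ`. -/
def wdBar (i : n) (φ : (n → ℂ) → ℂ) (z : n → ℂ) : ℂ :=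
  (fderiv ℝ φ z (Pi.single i 1) + Complex.I * fderiv ℝ φ z (Pi.single i Complex.I)) / 2

/-- The matrix `g_{i j̄} = ∂_i ∂_j̄ K` of a real function `K` (row `i`, column `j̄`). -/
def complexHessian (K : (n → ℂ) → ℝ) (z : n → ℂ) : Matrix n n ℂ :=
  Matrix.of fun i j => wd i (wdBar j (fun y => (K y : ℂ))) z

end Wirtinger

/-- The exterior derivative `dη(v, w)` of a 1-form `η` on an open set of a real vector space. -/
def dOneForm {E G : Type*} [NormedAddCommGroup E] [NormedSpace ℝ E] [NormedAddCommGroup G]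
    [NormedSpace ℝ G] (η : E → (E →L[ℝ] G)) (q v w : E) : G :=
  fderiv ℝ η q v w - fderiv ℝ η q w v

/-! ## Local special Kähler geometry

`I` labels the `n_V` complex coordinates, and `Option I` labels the `n_V + 1` vector fields
(`none` is the index `0`). -/

section Special

variable {I : Type*} [Fintype I] [DecidableEq I]

/-- `i (X̄^Λ F_Λ - F̄_Λ X^Λ)`, a real number, as the real part of that expression. -/
def sectionNorm (X F : Option I → (I → ℂ) → ℂ) (z : I → ℂ) : ℝ :=
  (Complex.I * ∑ Λ, (conj (X Λ z) * F Λ z - conj (F Λ z) * X Λ z)).re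

/-- The Kähler potential `K = - log i (X̄^Λ F_Λ - F̄_Λ X^Λ)`. -/
def kahlerPotential (X F : Option I → (I → ℂ) → ℂ) (z : I → ℂ) : ℝ :=
  - Real.log (sectionNorm X F z)

/-- Special Kähler geometry in a coordinate chart `dom ⊆ ℂ^I`: a holomorphic symplectic section
`(X^Λ, F_Λ)` (no prepotential is required to exist) whose Kähler metric is positive. -/
structure SpecialKahler (I : Type*) [Fintype I] [DecidableEq I] where
  dom : Set (I → ℂ)
  isOpen_dom : IsOpen dom
  X : Option I → (I → ℂ) → ℂ
  F : Option I → (I → ℂ) → ℂ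
  holomorphic_X : ∀ Λ, DifferentiableOn ℂ (X Λ) dom
  holomorphic_F : ∀ Λ, DifferentiableOn ℂ (F Λ) dom
  /-- `⟨(X, F), ∂_i (X, F)⟩ = 0` for the symplectic pairing -/
  symplectic : ∀ z ∈ dom, ∀ i : I, ∑ Λ, (X Λ z * wd i (F Λ) z - F Λ z * wd i (X Λ) z) = 0
  sectionNorm_pos : ∀ z ∈ dom, 0 < sectionNorm X F z
  metric_posDef : ∀ z ∈ dom, (complexHessian (kahlerPotential X F) z).PosDef

namespace SpecialKahler

variable (S : SpecialKahler I)

/-- The Kähler potential. -/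
def K (z : I → ℂ) : ℝ := kahlerPotential S.X S.F z

/-- The Kähler metric `g_{I J̄}`. -/
def g (z : I → ℂ) : Matrix I I ℂ := complexHessian S.K z

/-- The covariantly holomorphic section `L^Λ = e^{K/2} X^Λ`. -/
def L (Λ : Option I) (z : I → ℂ) : ℂ := (Real.exp (S.K z / 2) : ℂ) * S.X Λ z

/-- The covariantly holomorphic section `M_Λ = e^{K/2} F_Λ`. -/
def M (Λ : Option I) (z : I → ℂ) : ℂ := (Real.exp (S.K z / 2) : ℂ) * S.F Λ z

/-- `f_I^Λ = ∇_I L^Λ = (∂_I + ½ ∂_I K) L^Λ`. -/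
def f (i : I) (Λ : Option I) (z : I → ℂ) : ℂ :=
  wd i (S.L Λ) z + wd i (fun y => (S.K y : ℂ)) z / 2 * S.L Λ z

/-- `h_{I Λ} = ∇_I M_Λ = (∂_I + ½ ∂_I K) M_Λ`. -/
def h (i : I) (Λ : Option I) (z : I → ℂ) : ℂ :=
  wd i (S.M Λ) z + wd i (fun y => (S.K y : ℂ)) z / 2 * S.M Λ z

/-- The square matrix with columns `L^Λ` and `f̄_Ī^Λ`. -/
def upperFrame (z : I → ℂ) : Matrix (Option I) (Option I) ℂ :=
  Matrix.of fun Λ c => c.elim (S.L Λ z) fun i => conj (S.f i Λ z)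

/-- The square matrix with columns `M_Λ` and `h̄_{Ī Λ}`. -/
def lowerFrame (z : I → ℂ) : Matrix (Option I) (Option I) ℂ :=
  Matrix.of fun Λ c => c.elim (S.M Λ z) fun i => conj (S.h i Λ z)

/-- The vector kinetic matrix `𝒩_{ΛΣ}`, determined by
`M_Λ = 𝒩_{ΛΣ} L^Σ` and `h̄_{ĪΛ} = 𝒩_{ΛΣ} f̄_Ī^Σ`. -/
def N (z : I → ℂ) : Matrix (Option I) (Option I) ℂ := S.lowerFrame z * (S.upperFrame z)⁻¹

/-- `Im 𝒩_{ΛΣ}`. -/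
def ImN (z : I → ℂ) : Matrix (Option I) (Option I) ℝ := (S.N z).map Complex.im

end SpecialKahler

end Special

/-! ## Local quaternionic Kähler geometry

`H` labels the `n_H` hypermultiplets. The `4 n_H` real coordinates are `q : H × Fin 4 → ℝ`.
Indices: `A : Fin 2` of `SU(2)`, `α : H ⊕ H` of `Sp(2 n_H)` (`Sum.inl` is the undotted index `I`
and `Sum.inr` is the dotted index `İ`), `x : Fin 3` of the adjoint of `SU(2)`. -/

/-- The Pauli matrices `(σ^x)_A{}^B`. -/
def pauli (x : Fin 3) : Matrix (Fin 2) (Fin 2) ℂ :=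
  ![!![0, 1; 1, 0], !![0, -Complex.I; Complex.I, 0], !![1, 0; 0, -1]] x

/-- The antisymmetric symbol `ε_{AB}`, `ε_{12} = 1`. -/
def epsSU2 : Matrix (Fin 2) (Fin 2) ℂ := !![0, 1; -1, 0]

/-- `(σ^x)_{AB} = (σ^x)_A{}^C ε_{BC}`; it is symmetric, and
`P^x (σ^x)_{11} = P^1 - i P^2`, `P^x (σ^x)_{22} = - P^1 - i P^2`. -/
def pauliLow (x : Fin 3) : Matrix (Fin 2) (Fin 2) ℂ := pauli x * epsSU2ᵀ

section Hyper

variable {H : Type*} [Fintype H] [DecidableEq H]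

/-- The coordinate space of `n_H` hypermultiplets. -/
abbrev HyperSpace (H : Type*) : Type _ := H × Fin 4 → ℝ

/-- The symplectic form `ℂ_{αβ}` with `ℂ_{I J̇} = δ_{IJ} = - ℂ_{J̇ I}`. -/
def sympC (H : Type*) [DecidableEq H] : Matrix (H ⊕ H) (H ⊕ H) ℂ := Matrix.fromBlocks 0 1 (-1) 0

/-- The `SU(2)` curvature prescribed by the vielbein,
`i λ ℂ_{αβ} (σ^x)_{AB} U^{Aα} ∧ U^{Bβ}` with `λ = -1`, evaluated on `(v, w)`. -/
def hyperForm (U : Fin 2 → H ⊕ H → HyperSpace H → (HyperSpace H →L[ℝ] ℂ)) (x : Fin 3)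
    (q v w : HyperSpace H) : ℂ :=
  Complex.I * (-1) * ∑ A, ∑ B, ∑ α, ∑ β, sympC H α β * pauliLow x A B *
    (U A α q v * U B β q w - U A α q w * U B β q v)

/-- Quaternionic Kähler geometry in a coordinate chart `dom`, with scale `λ = -1`: a vielbein
`U^{Aα}` obeying the reality condition, an `SU(2)` connection `ω^x` and a `USp(2 n_H)` connection
`Δ^α{}_β` with respect to which the vielbein is covariantly closed, such that the `SU(2)` curvature
is the hyper-Kähler form of the vielbein. -/
structure QuaternionicKahler (H : Type*) [Fintype H] [DecidableEq H] where
  dom : Set (HyperSpace H)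
  isOpen_dom : IsOpen dom
  U : Fin 2 → H ⊕ H → HyperSpace H → (HyperSpace H →L[ℝ] ℂ)
  om : Fin 3 → HyperSpace H → (HyperSpace H →L[ℝ] ℝ)
  Δ : H ⊕ H → H ⊕ H → HyperSpace H → (HyperSpace H →L[ℝ] ℂ)
  smooth_U : ∀ A α, ContDiffOn ℝ ∞ (U A α) dom
  smooth_om : ∀ x, ContDiffOn ℝ ∞ (om x) dom
  smooth_Δ : ∀ α β, ContDiffOn ℝ ∞ (Δ α β) dom
  /-- `(U^{Aα})^* = ε_{AB} ℂ_{αβ} U^{Bβ}` -/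
  reality : ∀ q ∈ dom, ∀ A α v,
    conj (U A α q v) = ∑ B, ∑ β, epsSU2 A B * sympC H α β * U B β q v
  /-- the vielbein is a coframe -/
  nondegenerate : ∀ q ∈ dom, ∀ v, (∀ A α, U A α q v = 0) → v = 0
  /-- `Δ` takes values in `sp(2 n_H, ℂ)` … -/
  Δ_symplectic : ∀ q ∈ dom, ∀ α β v,
    ∑ γ, (sympC H α γ * Δ γ β q v + Δ γ α q v * sympC H γ β) = 0
  /-- … and in `u(2 n_H)` -/
  Δ_unitary : ∀ q ∈ dom, ∀ α β v, conj (Δ α β q v) = - Δ β α q v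
  /-- `d U^{Aα} + (i/2) ω^x (σ_x)_B{}^A ∧ U^{Bα} + Δ^α{}_β ∧ U^{Aβ} = 0` -/
  torsion_free : ∀ q ∈ dom, ∀ A α v w,
    dOneForm (U A α) q v w
      + Complex.I / 2 * ∑ x, ∑ B, pauli x B A * (om x q v * U B α q w - om x q w * U B α q v)
      + ∑ β, (Δ α β q v * U A β q w - Δ α β q w * U A β q v) = 0
  /-- `d ω^x + ½ ε^{xyz} ω^y ∧ ω^z = i λ ℂ_{αβ} (σ^x)_{AB} U^{Aα} ∧ U^{Bβ}` with `λ = -1` -/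
  curvature : ∀ q ∈ dom, ∀ x v w,
    ((dOneForm (om x) q v w
      + crossProduct (fun y => om y q v) (fun y => om y q w) x : ℝ) : ℂ) = hyperForm U x q v w

namespace QuaternionicKahler

variable (Q : QuaternionicKahler H)

/-- The metric `h_{uv} = U^{Aα}_u U^{Bβ}_v ℂ_{αβ} ε_{AB}` (its value is real). -/
def h (q v w : HyperSpace H) : ℂ :=
  ∑ A, ∑ B, ∑ α, ∑ β, Q.U A α q v * Q.U B β q w * sympC H α β * epsSU2 A B

/-- The `SU(2)` curvature 2-form `Ω^x(v, w)`; in components `Ω^x_{uv} = ½ Ω^x(∂_u, ∂_v)`. -/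
def Ω (x : Fin 3) (q v w : HyperSpace H) : ℝ :=
  dOneForm (Q.om x) q v w + crossProduct (fun y => Q.om y q v) (fun y => Q.om y q w) x

end QuaternionicKahler

end Hyper

/-! ## Gauging -/

/-- Structure constants `c Λ Σ Γ = f_{ΛΣ}{}^Γ` of a real Lie algebra. -/
structure StructureConstants (G : Type*) [Fintype G] where
  c : G → G → G → ℝ
  antisymm : ∀ Λ Ξ Γ, c Λ Ξ Γ = - c Ξ Λ Γ
  jacobi : ∀ Λ Ξ Γ Δ, ∑ Υ,
    (c Λ Ξ Υ * c Υ Γ Δ + c Ξ Γ Υ * c Υ Λ Δ + c Γ Λ Υ * c Υ Ξ Δ) = 0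

/-- The action of the gauge algebra on the special Kähler manifold: holomorphic vector fields
`k_Λ^I ∂_I` that act on the symplectic section in the (block diagonal) adjoint and coadjoint
representations, up to a rescaling `r_Λ` of the section (a Kähler transformation). Such fields are
automatically Killing. -/
structure VectorGauging {I : Type*} [Fintype I] [DecidableEq I] (S : SpecialKahler I)
    (𝔤 : StructureConstants (Option I)) where
  k : Option I → I → (I → ℂ) → ℂ
  r : Option I → (I → ℂ) → ℂ
  holomorphic_k : ∀ Λ i, DifferentiableOn ℂ (k Λ i) S.dom
  action_X : ∀ z ∈ S.dom, ∀ Λ Γ,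
    ∑ i, k Λ i z * wd i (S.X Γ) z = - ∑ Ξ, 𝔤.c Λ Ξ Γ * S.X Ξ z + r Λ z * S.X Γ z
  action_F : ∀ z ∈ S.dom, ∀ Λ Γ,
    ∑ i, k Λ i z * wd i (S.F Γ) z = ∑ Ξ, 𝔤.c Λ Γ Ξ * S.F Ξ z + r Λ z * S.F Γ z

/-- The prepotential `P^0_Λ`, given by `i P^0_Λ = k_Λ^I ∂_I K + r_Λ` (whose real part vanishes). It
is the moment map: `k_Λ^I = i g^{I J̄} ∂_J̄ P^0_Λ`. -/
def VectorGauging.P0 {I : Type*} [Fintype I] [DecidableEq I] {S : SpecialKahler I}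
    {𝔤 : StructureConstants (Option I)} (V : VectorGauging S 𝔤) (Λ : Option I) (z : I → ℂ) : ℝ :=
  (∑ i, V.k Λ i z * wd i (fun y => (S.K y : ℂ)) z + V.r Λ z).im

/-- The action of the gauge algebra on the quaternionic Kähler manifold: vector fields `k_Λ`
representing the algebra, with prepotentials (moment maps) `P^x_Λ`. In the absence of
hypermultiplets the prepotentials are Fayet-Iliopoulos constants, constrained by the algebra.
For `n_H ≥ 1` the vector fields are automatically Killing. -/
structure HyperGauging {H G : Type*} [Fintype H] [DecidableEq H] [Fintype G]
    (Q : QuaternionicKahler H) (𝔤 : StructureConstants G) where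
  k : G → HyperSpace H → HyperSpace H
  P : G → Fin 3 → HyperSpace H → ℝ
  smooth_k : ∀ Λ, ContDiffOn ℝ ∞ (k Λ) Q.dom
  smooth_P : ∀ Λ x, ContDiffOn ℝ ∞ (P Λ x) Q.dom
  /-- `[k_Λ, k_Σ] = f_{ΛΣ}{}^Γ k_Γ` -/
  lie : ∀ q ∈ Q.dom, ∀ Λ Ξ,
    VectorField.lieBracket ℝ (k Λ) (k Ξ) q = ∑ Γ, 𝔤.c Λ Ξ Γ • k Γ q
  /-- `∇_v P^x = d P^x(v) + ε^{xyz} ω^y(v) P^z = Ω^x(k, v)`,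
  in components `∇_u P^x = 2 k^v Ω^x_{vu}` -/
  moment : ∀ q ∈ Q.dom, ∀ Λ x v,
    fderiv ℝ (P Λ x) q v + crossProduct (fun y => Q.om y q v) (fun y => P Λ y q) x
      = Q.Ω x q (k Λ q) v
  fayetIliopoulos : IsEmpty H → ∀ q ∈ Q.dom, ∀ Λ Ξ x,
    crossProduct (fun y => P Λ y q) (fun y => P Ξ y q) x = ∑ Γ, 𝔤.c Λ Ξ Γ * P Γ x q

/-- The scalar potential of gauged `N = 2` supergravity,
`(g_{IJ̄} k_Λ^I k̄_Σ^J̄ + 4 h_{uv} k_Λ^u k_Σ^v) L̄^Λ L^Σ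
  + (-½ (Im 𝒩)^{-1 ΛΣ} - L̄^Λ L^Σ) P^x_Λ P^x_Σ - 3 P^x_Λ P^x_Σ L̄^Λ L^Σ`. -/
def potentialN2 {I H : Type*} [Fintype I] [DecidableEq I] [Fintype H] [DecidableEq H]
    (S : SpecialKahler I) (Q : QuaternionicKahler H) {𝔤 : StructureConstants (Option I)}
    (V : VectorGauging S 𝔤) (Y : HyperGauging Q 𝔤) (z : I → ℂ) (q : HyperSpace H) : ℂ :=
  ∑ Λ, ∑ Ξ,
    (((∑ i, ∑ j, S.g z i j * V.k Λ i z * conj (V.k Ξ j z)) + 4 * Q.h q (Y.k Λ q) (Y.k Ξ q))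
        * (conj (S.L Λ z) * S.L Ξ z)
      + (-(1 / 2) * (((S.ImN z)⁻¹ Λ Ξ : ℝ) : ℂ) - conj (S.L Λ z) * S.L Ξ z)
        * ∑ x, (Y.P Λ x q : ℂ) * Y.P Ξ x q
      - 3 * (∑ x, (Y.P Λ x q : ℂ) * Y.P Ξ x q) * (conj (S.L Λ z) * S.L Ξ z))

/-! ## `N = 1` supergravity data -/

/-- The bosonic data entering the scalar potential of `N = 1` supergravity in a chart: `ℓ` labels
the chiral multiplets, `v` the vector multiplets. -/
structure N1Data (ℓ v : Type*) where
  dom : Set (ℓ → ℂ)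
  /-- the metric `g_{ℓ m̄}` -/
  g : (ℓ → ℂ) → Matrix ℓ ℓ ℂ
  /-- the `(1,0)` part of the connection of the Hodge line bundle
  (`a_ℓ = ½ ∂_ℓ K` in a Kähler gauge) -/
  a : (ℓ → ℂ) → ℓ → ℂ
  /-- the superpotential section, of `U(1)` weight 1 (`L = e^{K/2} W` in a Kähler gauge) -/
  L : (ℓ → ℂ) → ℂ
  /-- the vector kinetic matrix `f_{ΛΣ}` -/
  f : (ℓ → ℂ) → Matrix v v ℂ
  /-- the Killing prepotentials `P_Λ` -/
  P : (ℓ → ℂ) → v → ℝ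

namespace N1Data

variable {ℓ v : Type*} [Fintype ℓ] [DecidableEq ℓ] [Fintype v] [DecidableEq v] (D : N1Data ℓ v)

/-- `∇_ℓ L = (∂_ℓ + a_ℓ) L`. -/
def covL (l : ℓ) (p : ℓ → ℂ) : ℂ := wd l D.L p + D.a p l * D.L p

/-- `∇_ℓ̄ L = (∂_ℓ̄ - ā_ℓ) L`. -/
def covBarL (l : ℓ) (p : ℓ → ℂ) : ℂ := wdBar l D.L p - conj (D.a p l) * D.L p

/-- `Im f_{ΛΣ}`. -/
def Imf (p : ℓ → ℂ) : Matrix v v ℝ := (D.f p).map Complex.im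

/-- `D^Λ = -2 (Im f)^{-1 ΛΣ} P_Σ`. -/
def Dterm (p : ℓ → ℂ) (Λ : v) : ℝ := -2 * ∑ Ξ, (D.Imf p)⁻¹ Λ Ξ * D.P p Ξ

/-- The standard scalar potential of `N = 1` supergravity,
`4 (g^{ℓ m̄} ∇_ℓ L ∇_m̄ L̄ - 3 |L|² + (1/16) Im f_{ΛΣ} D^Λ D^Σ)`. -/
def potential (p : ℓ → ℂ) : ℂ :=
  4 * ((∑ l, ∑ m, (D.g p)⁻¹ m l * D.covL l p * conj (D.covL m p))
    - 3 * (D.L p * conj (D.L p))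
    + 1 / 16 * ∑ Λ, ∑ Ξ, (D.Imf p Λ Ξ : ℂ) * D.Dterm p Λ * D.Dterm p Ξ)

/-- The requirements of `N = 1` supergravity on these data: the scalar manifold is Kähler-Hodge
(the curvature of the connection is minus the positive metric `g`, `[∇_ℓ, ∇_m̄] = - g_{ℓ m̄}`,
`[∇_ℓ, ∇_m] = 0`), `L` is covariantly holomorphic, and `f_{ΛΣ}` is holomorphic and symmetric with
positive imaginary part. -/
structure IsN1 : Prop where
  metric_posDef : ∀ p ∈ D.dom, (D.g p).PosDef
  differentiable_a : ∀ l, DifferentiableOn ℝ (fun p => D.a p l) D.dom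
  hodge : ∀ p ∈ D.dom, ∀ l m,
    wd l (fun y => - conj (D.a y m)) p - wdBar m (fun y => D.a y l) p = - D.g p l m
  hodge_two_zero : ∀ p ∈ D.dom, ∀ l m,
    wd l (fun y => D.a y m) p - wd m (fun y => D.a y l) p = 0
  differentiable_L : DifferentiableOn ℝ D.L D.dom
  covariantly_holomorphic : ∀ p ∈ D.dom, ∀ l, D.covBarL l p = 0
  f_holomorphic : ∀ Λ Ξ, DifferentiableOn ℂ (fun p => D.f p Λ Ξ) D.dom
  f_symm : ∀ p ∈ D.dom, (D.f p).IsSymm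
  Imf_posDef : ∀ p ∈ D.dom, (D.Imf p).PosDef

end N1Data

/-! ## The truncation

`C` labels the `n_C` retained scalars of the vector multiplets, `V` the `n_V' = n_V - n_C` retained
vectors. The vector index set `Option (C ⊕ V)` splits into the truncated vectors `X` (`n_C + 1`
values, containing `0`) and the retained vectors `Λ` (`n_V'` values). -/

/-- The indices `X = 0, 1, …, n_C`. -/
def ixX {C V : Type*} (x : Option C) : Option (C ⊕ V) := x.map Sum.inl

/-- The indices `Λ = 1, …, n_V'`. -/
def ixΛ {C V : Type*} (v : V) : Option (C ⊕ V) := some (Sum.inr v)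

section Truncation

variable {C V H : Type*} [Fintype C] [DecidableEq C] [Fintype V] [DecidableEq V]
  [Fintype H] [DecidableEq H]

/-- The constraints of the truncation: an `n_C`-dimensional complex submanifold `M_R` of the special
Kähler manifold, parametrized by the holomorphic immersion `ι : Z → dom`, and an `n_H`-dimensional
complex manifold `M^KH`, parametrized by the immersion `j : W → dom` into the quaternionic Kähler
manifold, on which the listed quantities vanish. -/
structure Truncation (S : SpecialKahler (C ⊕ V)) (Q : QuaternionicKahler H)
    {𝔤 : StructureConstants (Option (C ⊕ V))} (VG : VectorGauging S 𝔤)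
    (HG : HyperGauging Q 𝔤) where
  Z : Set (C → ℂ)
  isOpen_Z : IsOpen Z
  ι : (C → ℂ) → (C ⊕ V → ℂ)
  mapsTo_ι : Set.MapsTo ι Z S.dom
  holomorphic_ι : DifferentiableOn ℂ ι Z
  immersion_ι : ∀ z ∈ Z, Function.Injective (fderiv ℂ ι z)
  W : Set (H → ℂ)
  isOpen_W : IsOpen W
  j : (H → ℂ) → HyperSpace H
  mapsTo_j : Set.MapsTo j W Q.dom
  smooth_j : ContDiffOn ℝ ∞ j W
  immersion_j : ∀ w ∈ W, Function.Injective (fderiv ℝ j w)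
  /-- `L^Λ = 0` on `M_R` -/
  L_Λ : ∀ z ∈ Z, ∀ v : V, S.L (ixΛ v) (ι z) = 0
  /-- `𝒩_{XΛ} = 0` on `M_R` -/
  N_XΛ : ∀ z ∈ Z, ∀ (x : Option C) (v : V), S.N (ι z) (ixX x) (ixΛ v) = 0
  /-- `k^i_X = 0`: the fields `k_X` have no component tangent to `M_R` -/
  k_X_special : ∀ z ∈ Z, ∀ (x : Option C) (c : C),
    ∑ a, ∑ b, S.g (ι z) a b * VG.k (ixX x) a (ι z)
      * conj (fderiv ℂ ι z (Pi.single c 1) b) = 0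
  /-- `U^{2I} = 0` on `M^KH` -/
  U_two : ∀ w ∈ W, ∀ (I : H) (t : H → ℂ), Q.U 1 (Sum.inl I) (j w) (fderiv ℝ j w t) = 0
  /-- the coordinates `w` are holomorphic: `U^{1I}` restricts to a form `U^{1I}_s̄ dw̄^s̄` -/
  U_one : ∀ w ∈ W, ∀ (I : H) (t : H → ℂ), Q.U 0 (Sum.inl I) (j w) (fderiv ℝ j w (Complex.I • t))
    = - Complex.I * Q.U 0 (Sum.inl I) (j w) (fderiv ℝ j w t)
  /-- `ω^1 = 0` on `M^KH` -/
  om_one : ∀ w ∈ W, ∀ t : H → ℂ, Q.om 0 (j w) (fderiv ℝ j w t) = 0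
  /-- `ω^2 = 0` on `M^KH` -/
  om_two : ∀ w ∈ W, ∀ t : H → ℂ, Q.om 1 (j w) (fderiv ℝ j w t) = 0
  /-- `P^1_Λ = 0` on `M^KH` -/
  P_one_Λ : ∀ w ∈ W, ∀ v : V, HG.P (ixΛ v) 0 (j w) = 0
  /-- `P^2_Λ = 0` on `M^KH` -/
  P_two_Λ : ∀ w ∈ W, ∀ v : V, HG.P (ixΛ v) 1 (j w) = 0
  /-- `P^3_X = 0` on `M^KH` -/
  P_three_X : ∀ w ∈ W, ∀ x : Option C, HG.P (ixX x) 2 (j w) = 0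
  /-- `k^s_X = 0`: the fields `k_X` have no component tangent to `M^KH` -/
  k_X_hyper : ∀ w ∈ W, ∀ (x : Option C) (t : H → ℂ),
    Q.h (j w) (HG.k (ixX x) (j w)) (fderiv ℝ j w t) = 0

namespace Truncation

variable {S : SpecialKahler (C ⊕ V)} {Q : QuaternionicKahler H}
  {𝔤 : StructureConstants (Option (C ⊕ V))} {VG : VectorGauging S 𝔤} {HG : HyperGauging Q 𝔤}
  (T : Truncation S Q VG HG)

/-- The induced metric `g_{i j̄}` on `M_R`. -/
def gR (z : C → ℂ) : Matrix C C ℂ :=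
  Matrix.of fun c d => ∑ a, ∑ b, S.g (T.ι z) a b * fderiv ℂ T.ι z (Pi.single c 1) a
    * conj (fderiv ℂ T.ι z (Pi.single d 1) b)

/-- The real tangent vectors `∂/∂ Re w^s` (`u = 1`) and `∂/∂ Im w^s` (`u = i`) to `M^KH`. -/
def tang (w : H → ℂ) (s : H) (u : ℂ) : HyperSpace H := fderiv ℝ T.j w (Pi.single s u)

/-- The induced metric on `M^KH`, normalized by `h_{uv} dq^u dq^v = g_{s s̄'} dw^s dw̄^s̄'`, that is
`g_{s s̄'} = 2 h(∂_s, ∂_s̄')`. -/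
def gKH (w : H → ℂ) : Matrix H H ℂ :=
  Matrix.of fun s t =>
    (Q.h (T.j w) (T.tang w s 1) (T.tang w t 1)
      + Q.h (T.j w) (T.tang w s Complex.I) (T.tang w t Complex.I)
      + Complex.I * (Q.h (T.j w) (T.tang w s 1) (T.tang w t Complex.I)
        - Q.h (T.j w) (T.tang w s Complex.I) (T.tang w t 1))) / 2

/-- The component `ω^3_s` of the restriction of `ω^3` to `M^KH`. -/
def om3 (w : H → ℂ) (s : H) : ℂ :=
  ((Q.om 2 (T.j w) (T.tang w s 1) : ℂ) - Complex.I * Q.om 2 (T.j w) (T.tang w s Complex.I)) / 2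

/-- The `N = 1` data on `M_R × M^KH` produced by the truncation: superpotential
`L = (i/2) L^X (P^1_X - i P^2_X)`, kinetic matrix `f_{ΛΣ} = 2 𝒩̄_{ΛΣ}`, prepotentials
`P^0_Λ + P^3_Λ`, and the Hodge connection `½ ∂_i K` on `M_R` and `- i ω^3_s` on `M^KH` (the one that
`P^1 - i P^2` inherits from the `SU(2)` connection). -/
def reduced : N1Data (C ⊕ H) V where
  dom := {p | p ∘ Sum.inl ∈ T.Z ∧ p ∘ Sum.inr ∈ T.W}
  g p := Matrix.fromBlocks (T.gR (p ∘ Sum.inl)) 0 0 (T.gKH (p ∘ Sum.inr))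
  a p l := l.elim (fun c => wd c (fun y => (S.K (T.ι y) : ℂ)) (p ∘ Sum.inl) / 2)
    (fun s => - Complex.I * T.om3 (p ∘ Sum.inr) s)
  L p := Complex.I / 2 * ∑ x : Option C, S.L (ixX x) (T.ι (p ∘ Sum.inl))
    * (HG.P (ixX x) 0 (T.j (p ∘ Sum.inr)) - Complex.I * HG.P (ixX x) 1 (T.j (p ∘ Sum.inr)))
  f p := Matrix.of fun Λ Ξ => 2 * conj (S.N (T.ι (p ∘ Sum.inl)) (ixΛ Λ) (ixΛ Ξ))
  P p Λ := VG.P0 (ixΛ Λ) (T.ι (p ∘ Sum.inl)) + HG.P (ixΛ Λ) 2 (T.j (p ∘ Sum.inr))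

end Truncation

end Truncation

end

/-! Special geometry. Among (L, M), the covariant derivatives (f_I, h_I) and their conjugates, the
only nonzero symplectic pairings are the normalization of (L, M) with its conjugate and the metric
between f and f̄. Hence the frame (L, f̄) is invertible, 𝒩 is symmetric, and (Im 𝒩)⁻¹ = -2 (L L̄ +
f̄ g⁻¹ f) (`upperFrame_ImN`, `ImN_inv`). Pairing the gauge action with the same frame gives L^Λ P⁰_Λ
= 0 and f̄_J̄^Λ P⁰_Λ = i g_{IJ̄} k^I_Λ L̄^Λ. Two consequences carry the vector multiplet sector: g k
k̄ L̄ L = -½ (Im 𝒩)⁻¹ P⁰ P⁰ (`sum_g_k_k`), and (Im 𝒩)⁻¹ P⁰ β = 2i f_{ΛΣ}^Γ L̄^Λ L^Σ β_Γ for every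
covector β (`sum_ImN_inv_P0_mul`).

Quaternionic geometry. The essential input is the equivariance ε^{xyz} P^y_Λ P^z_Σ = f_{ΛΣ}^Γ P^x_Γ
+ Ω^x(k_Λ, k_Σ). It is not an axiom when n_H ≥ 1: the defect is covariantly constant, so the
curvature annihilates it, and the curvature spans su(2) (`HyperGauging.equivariance`).

Truncation. On M_R, Im 𝒩 is block diagonal, its X block is inverted by the tangential frame of M_R,
and P⁰_X = 0. On M^KH only ω³ survives; the moment map equation makes P¹_X - i P²_X covariantly
holomorphic, with gradient the normal component U^{2I}(k_X). This gives ∇_ℓ̄ L = 0 and both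
gradients of L. The Hodge condition is the Kähler potential on M_R and dω³ = Ω³ on M^KH, while
𝒩̄_{ΛΣ} is holomorphic as a quotient of ∂F_Λ by ∂X^Λ.

Comparison. Put a = L^X P¹_X, b = L^X P²_X, let u be the sum over I of |L^X U^{2I}(k_X)|², and let v
be the same with L̄^X. The superpotential term gives -3|a - ib|², the special gradient -½ (Im
𝒩)⁻¹(P¹P¹ + P²P²) - |a + ib|², the hyper gradient 8u. The D-term gives the squares of P⁰ and P³ and
the cross term -(Im 𝒩)⁻¹ P⁰ P³. By the two inputs above, (Im 𝒩)⁻¹ P⁰ P³ = 2i(āb - b̄a) + 4(u - v).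
This cancels the cross terms of the squares and turns 8u into 4(u + v), which is the hypermultiplet
term of the N = 2 potential. -/

open scoped ComplexConjugate ComplexOrder ContDiff Matrix

noncomputable section

set_option linter.unusedSectionVars false


/-! ### Smoothness of holomorphic functions of several variables -/

section SeveralComplexVariables

open Metric Set Filter MeasureTheory
open scoped Topology Real

variable {E : Type*} [NormedAddCommGroup E] [NormedSpace ℂ E]

/-- Cauchy's integral formula for a directional derivative. -/
theorem fderiv_apply_eq_circleIntegral {f : E → ℂ} {z v : E} {r : ℝ} (hr : 0 < r)
    (hf : ∀ ζ ∈ closedBall (0 : ℂ) r, DifferentiableAt ℂ f (z + ζ • v)) :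
    fderiv ℂ f z v =
      (2 * π * Complex.I)⁻¹ • ∮ ζ in C(0, r), (ζ - 0)⁻¹ ^ 2 • f (z + ζ • v) := by
  have hline : ∀ ζ : ℂ, HasDerivAt (fun ζ : ℂ => z + ζ • v) v ζ := fun ζ => by
    simpa using ((hasDerivAt_id ζ).smul_const v).const_add z
  have hd : ∀ ζ ∈ closedBall (0 : ℂ) r, DifferentiableAt ℂ (fun ζ : ℂ => f (z + ζ • v)) ζ :=
    fun ζ hζ => (hf ζ hζ).comp ζ (hline ζ).differentiableAt
  have hdc : DiffContOnCl ℂ (fun ζ : ℂ => f (z + ζ • v)) (ball 0 r) :=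
    DifferentiableOn.diffContOnCl fun ζ hζ =>
      (hd ζ (closure_ball_subset_closedBall hζ)).differentiableWithinAt
  have h0 : deriv (fun ζ : ℂ => f (z + ζ • v)) 0 = fderiv ℂ f z v := by
    have h := hf 0 (mem_closedBall_self hr.le)
    have h1 : HasFDerivAt f (fderiv ℂ f (z + (0 : ℂ) • v)) (z + (0 : ℂ) • v) := h.hasFDerivAt
    have := h1.comp_hasDerivAt (0 : ℂ) (hline 0)
    simpa [Function.comp_def] using this.deriv
  rw [← h0, ← iteratedDeriv_one]
  have h := DiffContOnCl.circleIntegral_one_div_sub_center_pow_smul hr 1 hdc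
  have hpi : (2 * π * Complex.I : ℂ) ≠ 0 := Complex.two_pi_I_ne_zero
  simp only [Nat.factorial_one, Nat.cast_one, div_one] at h
  simp only [sub_zero, one_div, Nat.reduceAdd, inv_pow] at h ⊢
  rw [h, inv_smul_smul₀ hpi]

variable [FiniteDimensional ℂ E]

/-- Directional derivatives of a holomorphic function of several variables are holomorphic. -/
theorem differentiableOn_fderiv_apply_of_isOpen {f : E → ℂ} {s : Set E} (hs : IsOpen s)
    (hf : DifferentiableOn ℂ f s) (v : E) : DifferentiableOn ℂ (fun z => fderiv ℂ f z v) s := by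
  intro z₀ hz₀
  have : ProperSpace E := FiniteDimensional.proper ℂ E
  borelize E
  have hcont := (hf.continuousOn z₀ hz₀).continuousAt (hs.mem_nhds hz₀)
  -- Three nested radii: base points within ε, circles within 2ε, and balls of radius ε about points
  -- of the latter within 3ε, where f varies by less than 2. Cauchy's estimate then bounds the
  -- derivative by 2/ε.
  obtain ⟨ε, hε, hball⟩ : ∃ ε > 0, ∀ y ∈ ball z₀ (3 * ε), y ∈ s ∧ dist (f y) (f z₀) < 1 := by
    have := inter_mem (hs.mem_nhds hz₀) (hcont (ball_mem_nhds (f z₀) one_pos))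
    obtain ⟨ε, hε, h⟩ := Metric.mem_nhds_iff.1 this
    refine ⟨ε / 3, by positivity, fun y hy => ?_⟩
    have : y ∈ ball z₀ ε := by convert hy using 2; ring
    exact ⟨(h this).1, (h this).2⟩
  have hderiv : ∀ y ∈ ball z₀ (2 * ε), ‖fderiv ℂ f y‖ ≤ 2 / ε := by
    intro y hy
    have hsub : ball y ε ⊆ ball z₀ (3 * ε) := ball_subset_ball' (by
      rw [mem_ball] at hy; linarith)
    refine Complex.norm_fderiv_le_div_of_mapsTo_ball
      (hf.mono fun x hx => (hball x (hsub hx)).1) (fun x hx => ?_) hε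
    have h1 := (hball x (hsub hx)).2
    have h2 := (hball y (hsub (mem_ball_self hε))).2
    rw [mem_closedBall]
    linarith [dist_triangle_right (f x) (f y) (f z₀)]
  obtain ⟨r, hr, hrv⟩ : ∃ r > 0, r * ‖v‖ < ε := by
    refine ⟨ε / (‖v‖ + 1), by positivity, ?_⟩
    rw [div_mul_eq_mul_div, div_lt_iff₀ (by positivity)]
    nlinarith [norm_nonneg v]
  have hmem : ∀ y ∈ ball z₀ ε, ∀ ζ ∈ closedBall (0 : ℂ) r, y + ζ • v ∈ ball z₀ (2 * ε) := by
    intro y hy ζ hζ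
    rw [mem_ball, dist_eq_norm] at hy ⊢
    rw [mem_closedBall, dist_zero_right] at hζ
    calc ‖y + ζ • v - z₀‖ = ‖(y - z₀) + ζ • v‖ := by congr 1; abel
      _ ≤ ‖y - z₀‖ + ‖ζ‖ * ‖v‖ := (norm_add_le _ _).trans (by rw [norm_smul])
      _ < 2 * ε := by nlinarith [mul_le_mul_of_nonneg_right hζ (norm_nonneg v)]
  have hsub : ball z₀ (2 * ε) ⊆ ball z₀ (3 * ε) := ball_subset_ball (by linarith)
  have hdiff : ∀ y ∈ ball z₀ (2 * ε), DifferentiableAt ℂ f y := fun y hy =>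
    (hf y (hball y (hsub hy)).1).differentiableAt (hs.mem_nhds (hball y (hsub hy)).1)
  have hcircle : ∀ θ : ℝ, circleMap 0 r θ ∈ closedBall (0 : ℂ) r := fun θ =>
    sphere_subset_closedBall (circleMap_mem_sphere 0 hr.le θ)
  let c : ℝ → ℂ := fun θ => deriv (circleMap 0 r) θ * (circleMap 0 r θ - 0)⁻¹ ^ 2
  have hc : Continuous c := by
    have hne : ∀ θ : ℝ, circleMap 0 r θ - 0 ≠ 0 := fun θ => by simp [hr.ne']
    have h1 : Continuous (deriv (circleMap 0 r)) := by
      simp only [funext (deriv_circleMap 0 r)]; fun_prop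
    exact h1.mul (((by fun_prop : Continuous fun θ => circleMap 0 r θ - 0).inv₀ hne).pow 2)
  have hpath : ∀ y : E, Continuous fun θ : ℝ => y + circleMap 0 r θ • v := fun y => by fun_prop
  have hF : ∀ y ∈ ball z₀ ε, Continuous fun θ : ℝ => c θ • f (y + circleMap 0 r θ • v) :=
    fun y hy => hc.smul (continuous_iff_continuousAt.2 fun θ =>
      ContinuousAt.comp (f := fun θ : ℝ => y + circleMap 0 r θ • v)
        (hdiff _ (hmem y hy _ (hcircle θ))).continuousAt (hpath y).continuousAt)
  -- Differentiation under the integral in Cauchy's formula. Continuity of the derivative is not yet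
  -- available; measurability and the Cauchy bound replace it.
  have key := intervalIntegral.hasFDerivAt_integral_of_dominated_of_fderiv_le (𝕜 := ℂ)
    (μ := volume) (a := 0) (b := 2 * π) (s := ball z₀ ε) (x₀ := z₀)
    (F := fun y θ => c θ • f (y + circleMap 0 r θ • v))
    (F' := fun y θ => c θ • fderiv ℂ f (y + circleMap 0 r θ • v))
    (bound := fun θ => ‖c θ‖ * (2 / ε)) (ball_mem_nhds z₀ hε)
    (by filter_upwards [ball_mem_nhds z₀ hε] with y hy using (hF y hy).aestronglyMeasurable)
    ((hF z₀ (mem_ball_self hε)).intervalIntegrable _ _)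
    (hc.aestronglyMeasurable.smul
      (((measurable_fderiv ℂ f).comp (hpath z₀).measurable).aestronglyMeasurable))
    (Eventually.of_forall fun θ _ y hy => by
      rw [norm_smul]
      exact mul_le_mul_of_nonneg_left (hderiv _ (hmem y hy _ (hcircle θ))) (norm_nonneg _))
    ((hc.norm.mul continuous_const).intervalIntegrable _ _)
    (Eventually.of_forall fun θ _ y hy => by
      have h1 := (hdiff _ (hmem y hy _ (hcircle θ))).hasFDerivAt
      exact ((hasFDerivAt_comp_add_right _).2 h1).const_smul (c θ))
  have heq : (fun z => fderiv ℂ f z v) =ᶠ[𝓝 z₀] fun z => (2 * π * Complex.I)⁻¹ •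
      ∫ θ in (0 : ℝ)..2 * π, c θ • f (z + circleMap 0 r θ • v) := by
    filter_upwards [ball_mem_nhds z₀ hε] with z hz
    rw [fderiv_apply_eq_circleIntegral hr fun ζ hζ => hdiff _ (hmem z hz ζ hζ)]
    simp only [circleIntegral, c, smul_smul]
  exact (DifferentiableAt.congr_of_eventuallyEq (key.differentiableAt.fun_const_smul _)
    heq).differentiableWithinAt

/-- Induction on the order: in finite dimension the derivative is controlled by its values on fixed
vectors, and these are again holomorphic. -/
theorem contDiffOn_of_differentiableOn_several {f : E → ℂ} {s : Set E} (hs : IsOpen s)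
    (hf : DifferentiableOn ℂ f s) : ContDiffOn ℂ ∞ f s := by
  rw [contDiffOn_infty]
  intro n
  induction n generalizing f with
  | zero => exact contDiffOn_zero.2 hf.continuousOn
  | succ n ih =>
    rw [Nat.cast_succ, contDiffOn_succ_iff_fderiv_of_isOpen hs]
    exact ⟨hf, by simp, contDiffOn_clm_apply.2 fun v =>
      ih (differentiableOn_fderiv_apply_of_isOpen hs hf v)⟩

end SeveralComplexVariables


/-! ### Wirtinger calculus -/

section WirtingerCalculus

open Filter
open scoped Topology

variable {m n : Type*} [Fintype m] [DecidableEq m] [Fintype n] [DecidableEq n]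
  {φ ψ : (n → ℂ) → ℂ} {z : n → ℂ}

theorem HasFDerivAt.wd_eq {φ' : (n → ℂ) →L[ℝ] ℂ} (h : HasFDerivAt φ φ' z) (i : n) :
    wd i φ z = (φ' (Pi.single i 1) - Complex.I * φ' (Pi.single i Complex.I)) / 2 := by
  rw [wd, h.fderiv]

theorem HasFDerivAt.wdBar_eq {φ' : (n → ℂ) →L[ℝ] ℂ} (h : HasFDerivAt φ φ' z) (i : n) :
    wdBar i φ z = (φ' (Pi.single i 1) + Complex.I * φ' (Pi.single i Complex.I)) / 2 := by
  rw [wdBar, h.fderiv]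

theorem wd_congr (h : φ =ᶠ[𝓝 z] ψ) (i : n) : wd i φ z = wd i ψ z := by
  rw [wd, wd, h.fderiv_eq]

theorem wd_const (c : ℂ) (i : n) : wd i (fun _ => c) z = 0 := by simp [wd]

theorem wdBar_const (c : ℂ) (i : n) : wdBar i (fun _ => c) z = 0 := by simp [wdBar]

theorem wd_add (hφ : DifferentiableAt ℝ φ z) (hψ : DifferentiableAt ℝ ψ z) (i : n) :
    wd i (fun y => φ y + ψ y) z = wd i φ z + wd i ψ z := by
  rw [(hφ.hasFDerivAt.fun_add hψ.hasFDerivAt).wd_eq, wd, wd]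
  simp only [add_apply]; ring

theorem wd_mul (hφ : DifferentiableAt ℝ φ z) (hψ : DifferentiableAt ℝ ψ z) (i : n) :
    wd i (fun y => φ y * ψ y) z = φ z * wd i ψ z + wd i φ z * ψ z := by
  rw [(hφ.hasFDerivAt.fun_mul hψ.hasFDerivAt).wd_eq, wd, wd]
  simp only [add_apply, smul_apply, smul_eq_mul]; ring

theorem wdBar_mul (hφ : DifferentiableAt ℝ φ z) (hψ : DifferentiableAt ℝ ψ z) (i : n) :
    wdBar i (fun y => φ y * ψ y) z = φ z * wdBar i ψ z + wdBar i φ z * ψ z := by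
  rw [(hφ.hasFDerivAt.fun_mul hψ.hasFDerivAt).wdBar_eq, wdBar, wdBar]
  simp only [add_apply, smul_apply, smul_eq_mul]; ring

theorem wd_const_mul (c : ℂ) (hφ : DifferentiableAt ℝ φ z) (i : n) :
    wd i (fun y => c * φ y) z = c * wd i φ z := by
  rw [wd_mul (differentiableAt_const c) hφ, wd_const]; ring

theorem wdBar_const_mul (c : ℂ) (hφ : DifferentiableAt ℝ φ z) (i : n) :
    wdBar i (fun y => c * φ y) z = c * wdBar i φ z := by
  rw [wdBar_mul (differentiableAt_const c) hφ, wdBar_const]; ring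

theorem wd_neg (i : n) : wd i (fun y => -φ y) z = -wd i φ z := by
  simp only [wd, fderiv_fun_neg, neg_apply]; ring

theorem wd_sub (hφ : DifferentiableAt ℝ φ z) (hψ : DifferentiableAt ℝ ψ z) (i : n) :
    wd i (fun y => φ y - ψ y) z = wd i φ z - wd i ψ z := by
  simp only [sub_eq_add_neg]; rw [wd_add hφ hψ.fun_neg, wd_neg]

theorem wd_sum {α : Type*} (s : Finset α) {Φ : α → (n → ℂ) → ℂ}
    (h : ∀ a ∈ s, DifferentiableAt ℝ (Φ a) z) (i : n) :
    wd i (fun y => ∑ a ∈ s, Φ a y) z = ∑ a ∈ s, wd i (Φ a) z := by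
  rw [(HasFDerivAt.fun_sum fun a ha => (h a ha).hasFDerivAt).wd_eq]
  simp only [sum_apply, wd, Finset.mul_sum, ← Finset.sum_sub_distrib,
    ← Finset.sum_div]

theorem wdBar_sum {α : Type*} (s : Finset α) {Φ : α → (n → ℂ) → ℂ}
    (h : ∀ a ∈ s, DifferentiableAt ℝ (Φ a) z) (i : n) :
    wdBar i (fun y => ∑ a ∈ s, Φ a y) z = ∑ a ∈ s, wdBar i (Φ a) z := by
  rw [(HasFDerivAt.fun_sum fun a ha => (h a ha).hasFDerivAt).wdBar_eq]
  simp only [sum_apply, wdBar, Finset.mul_sum, ← Finset.sum_add_distrib,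
    ← Finset.sum_div]

theorem hasFDerivAt_conj (hφ : DifferentiableAt ℝ φ z) :
    HasFDerivAt (fun y => conj (φ y))
      ((Complex.conjCLE : ℂ →L[ℝ] ℂ).comp (fderiv ℝ φ z)) z :=
  (Complex.conjCLE : ℂ →L[ℝ] ℂ).hasFDerivAt.comp z hφ.hasFDerivAt

theorem DifferentiableAt.conj_fun (hφ : DifferentiableAt ℝ φ z) :
    DifferentiableAt ℝ (fun y => conj (φ y)) z := (hasFDerivAt_conj hφ).differentiableAt

theorem wd_conj (hφ : DifferentiableAt ℝ φ z) (i : n) :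
    wd i (fun y => conj (φ y)) z = conj (wdBar i φ z) := by
  rw [(hasFDerivAt_conj hφ).wd_eq, wdBar]
  simp [sub_eq_add_neg, Complex.conj_ofNat]

theorem wdBar_conj (hφ : DifferentiableAt ℝ φ z) (i : n) :
    wdBar i (fun y => conj (φ y)) z = conj (wd i φ z) := by
  rw [(hasFDerivAt_conj hφ).wdBar_eq, wd]
  simp [sub_eq_add_neg, Complex.conj_ofNat]

theorem single_I (i : n) : (Pi.single i Complex.I : n → ℂ) = Complex.I • Pi.single i 1 := by
  rw [← Pi.single_smul]; simp

theorem wd_eq_of_holomorphic (hφ : DifferentiableAt ℂ φ z) (i : n) :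
    wd i φ z = fderiv ℂ φ z (Pi.single i 1) := by
  rw [(hφ.hasFDerivAt.restrictScalars ℝ).wd_eq]
  simp only [ContinuousLinearMap.coe_restrictScalars', single_I, map_smul, smul_eq_mul]
  linear_combination (-(1 / 2) * fderiv ℂ φ z (Pi.single i 1)) * Complex.I_mul_I

theorem wdBar_eq_zero_of_holomorphic (hφ : DifferentiableAt ℂ φ z) (i : n) :
    wdBar i φ z = 0 := by
  rw [(hφ.hasFDerivAt.restrictScalars ℝ).wdBar_eq]
  simp only [ContinuousLinearMap.coe_restrictScalars', single_I, map_smul, smul_eq_mul]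
  linear_combination ((1 / 2) * fderiv ℂ φ z (Pi.single i 1)) * Complex.I_mul_I

/-- A real linear form on `ℂⁿ` in terms of its Wirtinger components. -/
theorem clm_apply_eq_sum (A : (n → ℂ) →L[ℝ] ℂ) (v : n → ℂ) :
    A v = ∑ i, ((A (Pi.single i 1) - Complex.I * A (Pi.single i Complex.I)) / 2 * v i
      + (A (Pi.single i 1) + Complex.I * A (Pi.single i Complex.I)) / 2 * conj (v i)) := by
  have hv : v = ∑ i, ((v i).re • (Pi.single i 1 : n → ℂ)
      + (v i).im • (Pi.single i Complex.I : n → ℂ)) := by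
    rw [← Finset.univ_sum_single v]
    refine Finset.sum_congr rfl fun i _ => ?_
    rw [Finset.univ_sum_single, ← Pi.single_smul, ← Pi.single_smul, ← Pi.single_add]
    congr 1
    apply Complex.ext <;> simp
  conv_lhs => rw [hv]
  rw [map_sum]
  refine Finset.sum_congr rfl fun i _ => ?_
  have h1 : v i = (v i).re + (v i).im * Complex.I := (Complex.re_add_im _).symm
  have h2 : conj (v i) = (v i).re - (v i).im * Complex.I := by
    apply Complex.ext <;> simp
  rw [map_add, map_smul, map_smul, h2]
  simp only [Complex.real_smul]
  linear_combination ((v i).im * A (Pi.single i Complex.I)) * Complex.I_mul_I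
    - (A (Pi.single i 1) - Complex.I * A (Pi.single i Complex.I)) / 2 * h1

theorem fderiv_comp_holomorphic {ι : (m → ℂ) → n → ℂ} {x : m → ℂ}
    (hφ : DifferentiableAt ℝ φ (ι x)) (hι : DifferentiableAt ℂ ι x) (v : m → ℂ) :
    fderiv ℝ (fun y => φ (ι y)) x v = ∑ a, (wd a φ (ι x) * fderiv ℂ ι x v a
      + wdBar a φ (ι x) * conj (fderiv ℂ ι x v a)) := by
  have h : HasFDerivAt (fun y => φ (ι y)) _ x :=
    hφ.hasFDerivAt.comp x (hι.hasFDerivAt.restrictScalars ℝ)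
  rw [h.fderiv]
  exact clm_apply_eq_sum (fderiv ℝ φ (ι x)) (fderiv ℂ ι x v)

/-- The derivative of `ι` is complex linear, so the conjugate terms cancel in the combination of the
directions 1 and i. -/
theorem wd_comp_holomorphic {ι : (m → ℂ) → n → ℂ} {x : m → ℂ}
    (hφ : DifferentiableAt ℝ φ (ι x)) (hι : DifferentiableAt ℂ ι x) (c : m) :
    wd c (fun y => φ (ι y)) x = ∑ a, wd a φ (ι x) * fderiv ℂ ι x (Pi.single c 1) a := by
  rw [wd, fderiv_comp_holomorphic hφ hι, fderiv_comp_holomorphic hφ hι, Finset.mul_sum,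
    ← Finset.sum_sub_distrib, Finset.sum_div]
  refine Finset.sum_congr rfl fun a _ => ?_
  simp only [single_I, map_smul, Pi.smul_apply, smul_eq_mul, map_mul, Complex.conj_I]
  linear_combination (-(1 / 2) * wd a φ (ι x) * fderiv ℂ ι x (Pi.single c 1) a
    + (1 / 2) * wdBar a φ (ι x) * conj (fderiv ℂ ι x (Pi.single c 1) a)) * Complex.I_mul_I

theorem wdBar_comp_holomorphic {ι : (m → ℂ) → n → ℂ} {x : m → ℂ}
    (hφ : DifferentiableAt ℝ φ (ι x)) (hι : DifferentiableAt ℂ ι x) (c : m) :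
    wdBar c (fun y => φ (ι y)) x
      = ∑ a, wdBar a φ (ι x) * conj (fderiv ℂ ι x (Pi.single c 1) a) := by
  rw [wdBar, fderiv_comp_holomorphic hφ hι, fderiv_comp_holomorphic hφ hι, Finset.mul_sum,
    ← Finset.sum_add_distrib, Finset.sum_div]
  refine Finset.sum_congr rfl fun a _ => ?_
  simp only [single_I, map_smul, Pi.smul_apply, smul_eq_mul, map_mul, Complex.conj_I]
  linear_combination ((1 / 2) * wd a φ (ι x) * fderiv ℂ ι x (Pi.single c 1) a
    - (1 / 2) * wdBar a φ (ι x) * conj (fderiv ℂ ι x (Pi.single c 1) a)) * Complex.I_mul_I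

/-- The Wirtinger chain rule for a function of one real variable. -/
theorem wd_real_comp {K : (n → ℂ) → ℝ} {g : ℝ → ℝ} {g' : ℝ} (hg : HasDerivAt g g' (K z))
    (hK : DifferentiableAt ℝ K z) (i : n) :
    wd i (fun y => (g (K y) : ℂ)) z = g' * wd i (fun y => (K y : ℂ)) z := by
  have h1 : HasFDerivAt (fun y => (K y : ℂ)) (Complex.ofRealCLM.comp (fderiv ℝ K z)) z :=
    Complex.ofRealCLM.hasFDerivAt.comp z hK.hasFDerivAt
  have h2 : HasFDerivAt (fun y => (g (K y) : ℂ))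
      (Complex.ofRealCLM.comp (g' • fderiv ℝ K z)) z :=
    Complex.ofRealCLM.hasFDerivAt.comp z (hg.comp_hasFDerivAt z hK.hasFDerivAt)
  rw [h1.wd_eq, h2.wd_eq]
  simp only [ContinuousLinearMap.comp_apply, Complex.ofRealCLM_apply,
    smul_apply, smul_eq_mul, Complex.ofReal_mul]
  ring

theorem wdBar_ofReal (K : (n → ℂ) → ℝ) (hK : DifferentiableAt ℝ K z) (i : n) :
    wdBar i (fun y => (K y : ℂ)) z = conj (wd i (fun y => (K y : ℂ)) z) := by
  rw [← wdBar_conj (φ := fun y => (K y : ℂ)) (Complex.ofRealCLM.differentiableAt.comp z hK)]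
  simp only [Complex.conj_ofReal]

theorem ContDiffAt.fderiv_apply_const {E F : Type*} [NormedAddCommGroup E] [NormedSpace ℝ E]
    [NormedAddCommGroup F] [NormedSpace ℝ F] {φ : E → F} {x : E} (h : ContDiffAt ℝ 2 φ x) (v : E) :
    HasFDerivAt (fun y => fderiv ℝ φ y v) ((fderiv ℝ (fderiv ℝ φ) x).flip v) x := by
  have h1 : DifferentiableAt ℝ (fderiv ℝ φ) x :=
    (h.fderiv_right (m := 1) (by norm_num)).differentiableAt one_ne_zero
  simpa using h1.hasFDerivAt.clm_apply (hasFDerivAt_const v x)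

/-- Expressing the derivative through the second Fréchet derivative reduces the commutation of
Wirtinger derivatives to the symmetry of the latter. -/
theorem hasFDerivAt_wd (h : ContDiffAt ℝ 2 φ z) (i : n) :
    HasFDerivAt (wd i φ) ((2⁻¹ : ℂ) • ((fderiv ℝ (fderiv ℝ φ) z).flip (Pi.single i 1)
      - Complex.I • (fderiv ℝ (fderiv ℝ φ) z).flip (Pi.single i Complex.I))) z := by
  have h' := ((h.fderiv_apply_const (Pi.single i 1)).fun_sub
    ((h.fderiv_apply_const (Pi.single i Complex.I)).fun_const_smul Complex.I)).fun_const_smul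
    (2⁻¹ : ℂ)
  refine h'.congr_of_eventuallyEq (Eventually.of_forall fun y => ?_)
  simp [wd, div_eq_inv_mul]

theorem hasFDerivAt_wdBar (h : ContDiffAt ℝ 2 φ z) (i : n) :
    HasFDerivAt (wdBar i φ) ((2⁻¹ : ℂ) • ((fderiv ℝ (fderiv ℝ φ) z).flip (Pi.single i 1)
      + Complex.I • (fderiv ℝ (fderiv ℝ φ) z).flip (Pi.single i Complex.I))) z := by
  have h' := ((h.fderiv_apply_const (Pi.single i 1)).fun_add
    ((h.fderiv_apply_const (Pi.single i Complex.I)).fun_const_smul Complex.I)).fun_const_smul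
    (2⁻¹ : ℂ)
  refine h'.congr_of_eventuallyEq (Eventually.of_forall fun y => ?_)
  simp [wdBar, div_eq_inv_mul]

theorem wd_wdBar_comm (h : ContDiffAt ℝ 2 φ z) (i j : n) :
    wd i (wdBar j φ) z = wdBar j (wd i φ) z := by
  have hs : ∀ v w, fderiv ℝ (fderiv ℝ φ) z v w = fderiv ℝ (fderiv ℝ φ) z w v := fun v w =>
    h.isSymmSndFDerivAt (by simp) v w
  rw [(hasFDerivAt_wdBar h j).wd_eq, (hasFDerivAt_wd h i).wdBar_eq]
  simp only [smul_apply, add_apply,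
    sub_apply, ContinuousLinearMap.flip_apply, smul_eq_mul]
  rw [hs (Pi.single i 1), hs (Pi.single i 1), hs (Pi.single i Complex.I),
    hs (Pi.single i Complex.I)]
  ring

theorem wd_wd_comm (h : ContDiffAt ℝ 2 φ z) (i j : n) :
    wd i (wd j φ) z = wd j (wd i φ) z := by
  have hs : ∀ v w, fderiv ℝ (fderiv ℝ φ) z v w = fderiv ℝ (fderiv ℝ φ) z w v := fun v w =>
    h.isSymmSndFDerivAt (by simp) v w
  rw [(hasFDerivAt_wd h j).wd_eq, (hasFDerivAt_wd h i).wd_eq]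
  simp only [smul_apply,
    sub_apply, ContinuousLinearMap.flip_apply, smul_eq_mul]
  rw [hs (Pi.single i 1), hs (Pi.single i 1), hs (Pi.single i Complex.I),
    hs (Pi.single i Complex.I)]
  ring

theorem ContDiffAt.differentiableAt_wd (h : ContDiffAt ℝ 2 φ z) (i : n) :
    DifferentiableAt ℝ (wd i φ) z := (hasFDerivAt_wd h i).differentiableAt

theorem ContDiffAt.differentiableAt_wdBar (h : ContDiffAt ℝ 2 φ z) (i : n) :
    DifferentiableAt ℝ (wdBar i φ) z := (hasFDerivAt_wdBar h i).differentiableAt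

theorem contDiffAt_of_holomorphic {f : (n → ℂ) → ℂ} {s : Set (n → ℂ)} (hs : IsOpen s)
    (hf : DifferentiableOn ℂ f s) (hz : z ∈ s) : ContDiffAt ℝ ∞ f z :=
  ((contDiffOn_of_differentiableOn_several hs hf).contDiffAt (hs.mem_nhds hz)).restrict_scalars ℝ

theorem differentiableOn_wd_of_holomorphic {f : (n → ℂ) → ℂ} {s : Set (n → ℂ)} (hs : IsOpen s)
    (hf : DifferentiableOn ℂ f s) (i : n) : DifferentiableOn ℂ (wd i f) s :=
  (differentiableOn_fderiv_apply_of_isOpen hs hf (Pi.single i 1)).congr fun z hz =>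
    wd_eq_of_holomorphic ((hf z hz).differentiableAt (hs.mem_nhds hz)) i

end WirtingerCalculus


/-! ### Special Kähler geometry: derivatives of K and of the section -/

namespace SpecialKahler

open Filter
open scoped Topology

variable {I : Type*} [Fintype I] [DecidableEq I] (S : SpecialKahler I) {z : I → ℂ}

theorem differentiableAt_X (hz : z ∈ S.dom) (Λ : Option I) : DifferentiableAt ℂ (S.X Λ) z :=
  (S.holomorphic_X Λ z hz).differentiableAt (S.isOpen_dom.mem_nhds hz)

theorem differentiableAt_F (hz : z ∈ S.dom) (Λ : Option I) : DifferentiableAt ℂ (S.F Λ) z :=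
  (S.holomorphic_F Λ z hz).differentiableAt (S.isOpen_dom.mem_nhds hz)

theorem differentiableAt_wd_X (hz : z ∈ S.dom) (Λ : Option I) (i : I) :
    DifferentiableAt ℂ (wd i (S.X Λ)) z :=
  (differentiableOn_wd_of_holomorphic S.isOpen_dom (S.holomorphic_X Λ) i z hz).differentiableAt
    (S.isOpen_dom.mem_nhds hz)

theorem differentiableAt_wd_F (hz : z ∈ S.dom) (Λ : Option I) (i : I) :
    DifferentiableAt ℂ (wd i (S.F Λ)) z :=
  (differentiableOn_wd_of_holomorphic S.isOpen_dom (S.holomorphic_F Λ) i z hz).differentiableAt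
    (S.isOpen_dom.mem_nhds hz)

theorem contDiffAt_X (hz : z ∈ S.dom) (Λ : Option I) : ContDiffAt ℝ ∞ (S.X Λ) z :=
  contDiffAt_of_holomorphic S.isOpen_dom (S.holomorphic_X Λ) hz

theorem contDiffAt_F (hz : z ∈ S.dom) (Λ : Option I) : ContDiffAt ℝ ∞ (S.F Λ) z :=
  contDiffAt_of_holomorphic S.isOpen_dom (S.holomorphic_F Λ) hz

/-- The expression is its own conjugate, so taking the real part in `sectionNorm` loses nothing. -/
theorem ofReal_sectionNorm (z : I → ℂ) : (sectionNorm S.X S.F z : ℂ)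
    = Complex.I * ∑ Λ, (conj (S.X Λ z) * S.F Λ z - conj (S.F Λ z) * S.X Λ z) := by
  refine Complex.conj_eq_iff_re.1 ?_
  simp only [map_mul, map_sum, map_sub, Complex.conj_conj, Complex.conj_I, neg_mul,
    ← mul_neg, ← Finset.sum_neg_distrib]
  congr 1
  refine Finset.sum_congr rfl fun Λ _ => ?_
  ring

theorem contDiffAt_sectionNorm (hz : z ∈ S.dom) :
    ContDiffAt ℝ ∞ (fun y => sectionNorm S.X S.F y) z := by
  have hc : ∀ {φ : (I → ℂ) → ℂ}, ContDiffAt ℝ ∞ φ z → ContDiffAt ℝ ∞ (fun y => conj (φ y)) z :=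
    fun h => (Complex.conjCLE : ℂ →L[ℝ] ℂ).contDiff.contDiffAt.comp z h
  refine Complex.reCLM.contDiff.contDiffAt.comp z (contDiffAt_const.mul
    (ContDiffAt.sum fun Λ _ => ?_))
  exact ((hc (S.contDiffAt_X hz Λ)).mul (S.contDiffAt_F hz Λ)).sub
    ((hc (S.contDiffAt_F hz Λ)).mul (S.contDiffAt_X hz Λ))

theorem contDiffAt_K (hz : z ∈ S.dom) : ContDiffAt ℝ ∞ S.K z :=
  ((S.contDiffAt_sectionNorm hz).log (S.sectionNorm_pos z hz).ne').neg

theorem contDiffAt_ofReal_K (hz : z ∈ S.dom) : ContDiffAt ℝ ∞ (fun y => (S.K y : ℂ)) z :=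
  Complex.ofRealCLM.contDiff.contDiffAt.comp z (S.contDiffAt_K hz)

theorem differentiableAt_K (hz : z ∈ S.dom) : DifferentiableAt ℝ S.K z :=
  (S.contDiffAt_K hz).differentiableAt (by simp)

theorem exp_half_K_sq_mul_sectionNorm (hz : z ∈ S.dom) :
    (Real.exp (S.K z / 2) : ℂ) * Real.exp (S.K z / 2) * sectionNorm S.X S.F z = 1 := by
  rw [← Complex.ofReal_mul, ← Real.exp_add, add_halves, K, kahlerPotential, Real.exp_neg,
    Real.exp_log (S.sectionNorm_pos z hz), ← Complex.ofReal_mul,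
    inv_mul_cancel₀ (S.sectionNorm_pos z hz).ne', Complex.ofReal_one]

theorem wd_sectionNorm (hz : z ∈ S.dom) (i : I) :
    wd i (fun y => (sectionNorm S.X S.F y : ℂ)) z = Complex.I *
      ∑ Λ, (conj (S.X Λ z) * wd i (S.F Λ) z - conj (S.F Λ z) * wd i (S.X Λ) z) := by
  have hX := fun Λ => (S.differentiableAt_X hz Λ).restrictScalars ℝ
  have hF := fun Λ => (S.differentiableAt_F hz Λ).restrictScalars ℝ
  have hterm : ∀ Λ ∈ Finset.univ, DifferentiableAt ℝ
      (fun y => conj (S.X Λ y) * S.F Λ y - conj (S.F Λ y) * S.X Λ y) z := fun Λ _ =>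
    ((hX Λ).conj_fun.fun_mul (hF Λ)).fun_sub ((hF Λ).conj_fun.fun_mul (hX Λ))
  simp only [ofReal_sectionNorm]
  rw [wd_const_mul _ (DifferentiableAt.fun_sum hterm), wd_sum _ hterm]
  congr 1
  refine Finset.sum_congr rfl fun Λ _ => ?_
  rw [wd_sub ((hX Λ).conj_fun.fun_mul (hF Λ)) ((hF Λ).conj_fun.fun_mul (hX Λ)),
    wd_mul (hX Λ).conj_fun (hF Λ), wd_mul (hF Λ).conj_fun (hX Λ), wd_conj (hX Λ), wd_conj (hF Λ),
    wdBar_eq_zero_of_holomorphic (S.differentiableAt_X hz Λ),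
    wdBar_eq_zero_of_holomorphic (S.differentiableAt_F hz Λ)]
  simp

/-- `∂_i K`. -/
abbrev dK (i : I) (z : I → ℂ) : ℂ := wd i (fun y => (S.K y : ℂ)) z

theorem dK_eq (hz : z ∈ S.dom) (i : I) :
    S.dK i z = -(sectionNorm S.X S.F z : ℂ)⁻¹ * (Complex.I *
      ∑ Λ, (conj (S.X Λ z) * wd i (S.F Λ) z - conj (S.F Λ z) * wd i (S.X Λ) z)) := by
  have h := wd_real_comp (K := fun y => sectionNorm S.X S.F y) (z := z)
    ((Real.hasDerivAt_log (S.sectionNorm_pos z hz).ne').neg)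
    ((S.contDiffAt_sectionNorm hz).differentiableAt (by simp)) i
  rw [← S.wd_sectionNorm hz]
  simpa [dK, K, kahlerPotential] using h

/-- The factor e^{K/2} contributes ½ ∂K and the connection another ½ ∂K, leaving e^{K/2} times the
derivative ∂ + ∂K of the holomorphic section. -/
theorem f_eq (hz : z ∈ S.dom) (i : I) (Λ : Option I) :
    S.f i Λ z = Real.exp (S.K z / 2) * (wd i (S.X Λ) z + S.dK i z * S.X Λ z) := by
  have hg : HasDerivAt (fun t : ℝ => Real.exp (t / 2)) (Real.exp (S.K z / 2) * (1 / 2)) (S.K z) :=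
    ((hasDerivAt_id (S.K z)).div_const 2).exp
  have hd : DifferentiableAt ℝ (fun y => ((Real.exp (S.K y / 2) : ℝ) : ℂ)) z :=
    Complex.ofRealCLM.differentiableAt.comp z
      (hg.differentiableAt.comp z (S.differentiableAt_K hz))
  have h : wd i (S.L Λ) z = _ := wd_mul hd ((S.differentiableAt_X hz Λ).restrictScalars ℝ) i
  rw [f, h, wd_real_comp hg (S.differentiableAt_K hz), L, dK]
  push_cast
  ring

theorem h_eq (hz : z ∈ S.dom) (i : I) (Λ : Option I) :
    S.h i Λ z = Real.exp (S.K z / 2) * (wd i (S.F Λ) z + S.dK i z * S.F Λ z) := by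
  have hg : HasDerivAt (fun t : ℝ => Real.exp (t / 2)) (Real.exp (S.K z / 2) * (1 / 2)) (S.K z) :=
    ((hasDerivAt_id (S.K z)).div_const 2).exp
  have hd : DifferentiableAt ℝ (fun y => ((Real.exp (S.K y / 2) : ℝ) : ℂ)) z :=
    Complex.ofRealCLM.differentiableAt.comp z
      (hg.differentiableAt.comp z (S.differentiableAt_K hz))
  have h : wd i (S.M Λ) z = _ := wd_mul hd ((S.differentiableAt_F hz Λ).restrictScalars ℝ) i
  rw [SpecialKahler.h, h, wd_real_comp hg (S.differentiableAt_K hz), M, dK]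
  push_cast
  ring

/-- `⟨∂_i (X, F), ∂_j (X, F)⟩ = 0`. -/
theorem symplectic_wd_wd (hz : z ∈ S.dom) (i j : I) :
    ∑ Λ, (wd i (S.X Λ) z * wd j (S.F Λ) z - wd i (S.F Λ) z * wd j (S.X Λ) z) = 0 := by
  have hX := fun Λ => (S.differentiableAt_X hz Λ).restrictScalars ℝ
  have hF := fun Λ => (S.differentiableAt_F hz Λ).restrictScalars ℝ
  have hdX := fun Λ i => (S.differentiableAt_wd_X hz Λ i).restrictScalars ℝ
  have hdF := fun Λ i => (S.differentiableAt_wd_F hz Λ i).restrictScalars ℝ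
  -- The derivative of the constraint ⟨V, ∂_j V⟩ = 0 along i, with V = (X, F). Its second-derivative
  -- terms are symmetric in i and j, so antisymmetrizing leaves twice the wanted pairing.
  have key : ∀ i j : I, ∑ Λ, (S.X Λ z * wd i (wd j (S.F Λ)) z + wd i (S.X Λ) z * wd j (S.F Λ) z
      - (S.F Λ z * wd i (wd j (S.X Λ)) z + wd i (S.F Λ) z * wd j (S.X Λ) z)) = 0 := by
    intro i j
    have h0 : wd i (fun y => ∑ Λ, (S.X Λ y * wd j (S.F Λ) y - S.F Λ y * wd j (S.X Λ) y)) z = 0 := by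
      rw [wd_congr (ψ := fun _ => 0), wd_const]
      filter_upwards [S.isOpen_dom.mem_nhds hz] with y hy using S.symplectic y hy j
    rw [wd_sum _ fun Λ _ => ((hX Λ).fun_mul (hdF Λ j)).fun_sub ((hF Λ).fun_mul (hdX Λ j))] at h0
    rw [← h0]
    refine Finset.sum_congr rfl fun Λ _ => ?_
    rw [wd_sub ((hX Λ).fun_mul (hdF Λ j)) ((hF Λ).fun_mul (hdX Λ j)), wd_mul (hX Λ) (hdF Λ j),
      wd_mul (hF Λ) (hdX Λ j)]
  have h1 := key i j
  have h2 := key j i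
  have hc : ∀ Λ, wd i (wd j (S.X Λ)) z = wd j (wd i (S.X Λ)) z ∧
      wd i (wd j (S.F Λ)) z = wd j (wd i (S.F Λ)) z := fun Λ =>
    ⟨wd_wd_comm ((S.contDiffAt_X hz Λ).of_le (by norm_cast)) i j,
      wd_wd_comm ((S.contDiffAt_F hz Λ).of_le (by norm_cast)) i j⟩
  have h3 : (2 : ℂ) * ∑ Λ, (wd i (S.X Λ) z * wd j (S.F Λ) z - wd i (S.F Λ) z * wd j (S.X Λ) z)
      = 0 := by
    have h12 := congrArg₂ (· - ·) h1 h2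
    simp only [← Finset.sum_sub_distrib, sub_zero] at h12
    rw [← h12, Finset.mul_sum]
    refine Finset.sum_congr rfl fun Λ _ => ?_
    rw [(hc Λ).1, (hc Λ).2]
    ring
  simpa using h3

/-- With G = e^{-K}, ∂_j̄ K = -G⁻¹ ∂_j̄ G. Differentiating ∂_j̄ G gives the first term;
differentiating -G⁻¹ gives ∂_i K ∂_j̄ K. -/
theorem g_eq (hz : z ∈ S.dom) (i j : I) :
    S.g z i j = -(sectionNorm S.X S.F z : ℂ)⁻¹ * (-Complex.I *
        ∑ Λ, (wd i (S.X Λ) z * conj (wd j (S.F Λ) z) - wd i (S.F Λ) z * conj (wd j (S.X Λ) z)))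
      + S.dK i z * conj (S.dK j z) := by
  have hX := fun Λ => (S.differentiableAt_X hz Λ).restrictScalars ℝ
  have hF := fun Λ => (S.differentiableAt_F hz Λ).restrictScalars ℝ
  have hdX := fun Λ i => (S.differentiableAt_wd_X hz Λ i).restrictScalars ℝ
  have hdF := fun Λ i => (S.differentiableAt_wd_F hz Λ i).restrictScalars ℝ
  have hG := (S.sectionNorm_pos z hz).ne'
  have hGd : DifferentiableAt ℝ (fun y => sectionNorm S.X S.F y) z :=
    (S.contDiffAt_sectionNorm hz).differentiableAt (by simp)
  let A : (I → ℂ) → ℂ := fun y => -Complex.I *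
    ∑ Λ, (S.X Λ y * conj (wd j (S.F Λ) y) - S.F Λ y * conj (wd j (S.X Λ) y))
  have hterm : ∀ Λ ∈ Finset.univ, DifferentiableAt ℝ (fun y =>
      S.X Λ y * conj (wd j (S.F Λ) y) - S.F Λ y * conj (wd j (S.X Λ) y)) z := fun Λ _ =>
    ((hX Λ).fun_mul (hdF Λ j).conj_fun).fun_sub ((hF Λ).fun_mul (hdX Λ j).conj_fun)
  have hA : DifferentiableAt ℝ A z := (DifferentiableAt.fun_sum hterm).const_mul _
  have hinv : HasDerivAt (fun t : ℝ => -t⁻¹) (- -(sectionNorm S.X S.F z ^ 2)⁻¹)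
    (sectionNorm S.X S.F z) := (hasDerivAt_inv hG).neg
  have hinvd : DifferentiableAt ℝ (fun y => ((-(sectionNorm S.X S.F y)⁻¹ : ℝ) : ℂ)) z :=
    Complex.ofRealCLM.differentiableAt.comp z (hinv.differentiableAt.comp z hGd)
  have hbar : ∀ y ∈ S.dom, wdBar j (fun y => (S.K y : ℂ)) y
      = ((-(sectionNorm S.X S.F y)⁻¹ : ℝ) : ℂ) * A y := by
    intro y hy
    rw [wdBar_ofReal _ (S.differentiableAt_K hy)]
    change conj (S.dK j y) = _
    rw [S.dK_eq hy]
    simp only [A, map_mul, map_neg, map_inv₀, Complex.conj_ofReal, map_sum, map_sub,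
      Complex.conj_conj, Complex.conj_I, Complex.ofReal_neg, Complex.ofReal_inv]
  have h1 : S.g z i j = wd i (fun y => ((-(sectionNorm S.X S.F y)⁻¹ : ℝ) : ℂ) * A y) z :=
    wd_congr (by filter_upwards [S.isOpen_dom.mem_nhds hz] with y hy using hbar y hy) i
  have hdA : wd i A z = -Complex.I *
      ∑ Λ, (wd i (S.X Λ) z * conj (wd j (S.F Λ) z) - wd i (S.F Λ) z * conj (wd j (S.X Λ) z)) := by
    rw [wd_const_mul _ (DifferentiableAt.fun_sum hterm), wd_sum _ hterm]
    congr 1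
    refine Finset.sum_congr rfl fun Λ _ => ?_
    rw [wd_sub ((hX Λ).fun_mul (hdF Λ j).conj_fun) ((hF Λ).fun_mul (hdX Λ j).conj_fun),
      wd_mul (hX Λ) (hdF Λ j).conj_fun, wd_mul (hF Λ) (hdX Λ j).conj_fun, wd_conj (hdX Λ j),
      wd_conj (hdF Λ j), wdBar_eq_zero_of_holomorphic (S.differentiableAt_wd_X hz Λ j),
      wdBar_eq_zero_of_holomorphic (S.differentiableAt_wd_F hz Λ j)]
    simp
  have hKj : conj (S.dK j z) = -(sectionNorm S.X S.F z : ℂ)⁻¹ * A z := by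
    rw [← wdBar_ofReal _ (S.differentiableAt_K hz), hbar z hz]; push_cast; ring
  have hKi : S.dK i z
      = -(sectionNorm S.X S.F z : ℂ)⁻¹ * wd i (fun y => (sectionNorm S.X S.F y : ℂ)) z := by
    rw [S.dK_eq hz, S.wd_sectionNorm hz]
  rw [h1, wd_mul hinvd hA, hdA, wd_real_comp hinv hGd, hKj, hKi]
  push_cast
  field_simp

end SpecialKahler


/-! ### Block matrices 1 ⊕ g, and inverses from congruences -/

section OneOplus

variable {n : Type*} [Fintype n] [DecidableEq n]

/-- The block diagonal matrix `1 ⊕ A`. -/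
def oneOplus (A : Matrix n n ℂ) : Matrix (Option n) (Option n) ℂ :=
  Matrix.of fun c d => c.elim (d.elim 1 fun _ => 0) fun i => d.elim 0 (A i)

theorem oneOplus_mul (A B : Matrix n n ℂ) : oneOplus A * oneOplus B = oneOplus (A * B) := by
  ext c d
  rw [Matrix.mul_apply, Fintype.sum_option]
  rcases c with _ | i <;> rcases d with _ | j <;> simp [oneOplus, Matrix.mul_apply]

theorem oneOplus_one : oneOplus (1 : Matrix n n ℂ) = 1 := by
  ext c d
  rcases c with _ | i <;> rcases d with _ | j <;> simp [oneOplus, Matrix.one_apply]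

theorem oneOplus_inv {A : Matrix n n ℂ} (hA : IsUnit A) : (oneOplus A)⁻¹ = oneOplus A⁻¹ :=
  Matrix.inv_eq_right_inv (by
    rw [oneOplus_mul, Matrix.mul_nonsing_inv _ ((Matrix.isUnit_iff_isUnit_det _).1 hA),
      oneOplus_one])

theorem Matrix.PosDef.oneOplus {A : Matrix n n ℂ} (hA : A.PosDef) : (oneOplus A).PosDef := by
  refine .of_dotProduct_mulVec_pos ?_ fun x hx => ?_
  · ext c d
    rcases c with _ | i <;> rcases d with _ | j <;> simp [_root_.oneOplus]
    exact hA.isHermitian.apply i j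
  · have h : star x ⬝ᵥ (_root_.oneOplus A *ᵥ x)
        = star (x none) * x none + star (fun i => x (some i)) ⬝ᵥ (A *ᵥ fun i => x (some i)) := by
      simp [dotProduct, Matrix.mulVec, Fintype.sum_option, _root_.oneOplus]
    rw [h]
    by_cases h0 : (fun i => x (some i)) = 0
    · have hn : x none ≠ 0 := fun hn => hx (by
        ext c
        rcases c with _ | i
        · exact hn
        · exact congrFun h0 i)
      have hp : (0 : ℂ) < star (x none) * x none := star_mul_self_pos (IsRegular.of_ne_zero hn)
      rw [h0]
      simpa using hp
    · exact add_pos_of_nonneg_of_pos (star_mul_self_nonneg _) (hA.dotProduct_mulVec_pos h0)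

end OneOplus

section Congruence

variable {n : Type*} [Fintype n] [DecidableEq n]

/-- On a kernel vector of A both terms of the Hermitian form vanish, contrary to positivity. -/
theorem Matrix.isUnit_of_posDef_commutator {A B : Matrix n n ℂ}
    (h : (Complex.I • (Aᴴ * B - Bᴴ * A)).PosDef) : IsUnit A := by
  refine Matrix.mulVec_injective_iff_isUnit.1 ((injective_iff_map_eq_zero A.mulVecLin).2 ?_)
  intro v hv
  by_contra hne
  have hv' : A *ᵥ v = 0 := hv
  have := h.dotProduct_mulVec_pos hne
  rw [Matrix.smul_mulVec, Matrix.sub_mulVec, ← Matrix.mulVec_mulVec, ← Matrix.mulVec_mulVec, hv',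
    Matrix.mulVec_zero, sub_zero, dotProduct_smul, Matrix.dotProduct_mulVec,
    ← Matrix.star_mulVec, hv'] at this
  simp at this

theorem Matrix.isUnit_of_congruence {A Y D : Matrix n n ℂ} (h : Aᴴ * Y * A = (-(1 / 2) : ℂ) • D)
    (hD : IsUnit D) : IsUnit A := by
  rw [Matrix.isUnit_iff_isUnit_det, isUnit_iff_ne_zero] at hD ⊢
  intro h0
  have := congrArg Matrix.det h
  rw [Matrix.det_mul, h0, mul_zero, Matrix.det_smul] at this
  exact mul_ne_zero (pow_ne_zero _ (by norm_num)) hD this.symm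

/-- The hypothesis exhibits a right inverse of Aᴴ; for square matrices it is also a left inverse,
and regrouping the product exhibits the inverse of Y. -/
theorem Matrix.inv_of_congruence {A Y D : Matrix n n ℂ} (h : Aᴴ * Y * A = (-(1 / 2) : ℂ) • D)
    (hD : IsUnit D) : Y⁻¹ = (-2 : ℂ) • (A * D⁻¹ * Aᴴ) := by
  refine Matrix.inv_eq_right_inv ?_
  have h1 : Aᴴ * (Y * A * ((-2 : ℂ) • D⁻¹)) = 1 := by
    rw [← Matrix.mul_assoc, ← Matrix.mul_assoc, h, Matrix.smul_mul, Matrix.mul_smul, smul_smul,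
      Matrix.mul_nonsing_inv _ ((Matrix.isUnit_iff_isUnit_det _).1 hD)]
    norm_num
  rw [← mul_eq_one_comm.1 h1]
  simp only [Matrix.mul_smul, Matrix.smul_mul, Matrix.mul_assoc]

theorem Matrix.map_ofReal_inv (A : Matrix n n ℝ) :
    (A.map Complex.ofReal)⁻¹ = A⁻¹.map Complex.ofReal := by
  have hdet : (A.map Complex.ofReal).det = (A.det : ℂ) := (Complex.ofRealHom.map_det A).symm
  have hadj : (A.map Complex.ofReal).adjugate = A.adjugate.map Complex.ofReal :=
    (Complex.ofRealHom.map_adjugate A).symm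
  rw [Matrix.inv_def, Matrix.inv_def, hdet, hadj]
  ext i j
  simp

theorem Matrix.PosDef.of_map_ofReal {A : Matrix n n ℝ} (h : (A.map Complex.ofReal).PosDef) :
    A.PosDef := by
  refine .of_dotProduct_mulVec_pos ?_ fun x hx => ?_
  · ext i j
    have := h.isHermitian.apply i j
    simpa using this
  · have hx' : (fun i => (x i : ℂ)) ≠ 0 := fun h0 => hx (funext fun i => by
      simpa using congrFun h0 i)
    have := h.dotProduct_mulVec_pos hx'
    have he : star (fun i => (x i : ℂ)) ⬝ᵥ (A.map Complex.ofReal *ᵥ fun i => (x i : ℂ))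
        = ((star x ⬝ᵥ (A *ᵥ x) : ℝ) : ℂ) := by
      simp [dotProduct, Matrix.mulVec]
    rw [he] at this
    exact_mod_cast this

end Congruence

/-! ### The symplectic frame and the matrix 𝒩 -/

namespace SpecialKahler

variable {I : Type*} [Fintype I] [DecidableEq I] (S : SpecialKahler I) {z : I → ℂ}

/-- The square of e^{K/2} cancels e^{-K}. This pairing and the four below are the orthogonality
relations of the symplectic frame; only this one and `sum_conj_f_h` do not vanish. -/
theorem sum_conj_L_M (hz : z ∈ S.dom) :
    ∑ Λ, (conj (S.L Λ z) * S.M Λ z - conj (S.M Λ z) * S.L Λ z) = -Complex.I := by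
  have hE := S.exp_half_K_sq_mul_sectionNorm hz
  rw [ofReal_sectionNorm] at hE
  have : ∑ Λ, (conj (S.L Λ z) * S.M Λ z - conj (S.M Λ z) * S.L Λ z)
      = Real.exp (S.K z / 2) * Real.exp (S.K z / 2)
        * ∑ Λ, (conj (S.X Λ z) * S.F Λ z - conj (S.F Λ z) * S.X Λ z) := by
    rw [Finset.mul_sum]
    refine Finset.sum_congr rfl fun Λ _ => ?_
    simp only [L, M, map_mul, Complex.conj_ofReal]
    ring
  rw [this]
  linear_combination (-Complex.I) * hE + (Real.exp (S.K z / 2) : ℂ) * Real.exp (S.K z / 2)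
    * (∑ Λ, (conj (S.X Λ z) * S.F Λ z - conj (S.F Λ z) * S.X Λ z)) * Complex.I_mul_I

theorem sum_L_h (hz : z ∈ S.dom) (i : I) :
    ∑ Λ, (S.L Λ z * S.h i Λ z - S.M Λ z * S.f i Λ z) = 0 := by
  have := congrArg (fun t => (Real.exp (S.K z / 2) : ℂ) * Real.exp (S.K z / 2) * t)
    (S.symplectic z hz i)
  simp only [mul_zero, Finset.mul_sum] at this
  rw [← this]
  refine Finset.sum_congr rfl fun Λ _ => ?_
  rw [S.h_eq hz, S.f_eq hz, L, M]
  ring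

theorem sum_X_wd (hz : z ∈ S.dom) (i : I) :
    ∑ Λ, (conj (S.X Λ z) * wd i (S.F Λ) z - conj (S.F Λ z) * wd i (S.X Λ) z)
      = Complex.I * sectionNorm S.X S.F z * S.dK i z := by
  have hG : (sectionNorm S.X S.F z : ℂ) ≠ 0 := by exact_mod_cast (S.sectionNorm_pos z hz).ne'
  rw [S.dK_eq hz]
  field_simp
  linear_combination (∑ Λ, (conj (S.X Λ z) * wd i (S.F Λ) z - conj (S.F Λ z) * wd i (S.X Λ) z))
    * Complex.I_mul_I

theorem sum_X_F : ∑ Λ, (conj (S.X Λ z) * S.F Λ z - conj (S.F Λ z) * S.X Λ z)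
    = -Complex.I * sectionNorm S.X S.F z := by
  rw [ofReal_sectionNorm]
  linear_combination (∑ Λ, (conj (S.X Λ z) * S.F Λ z - conj (S.F Λ z) * S.X Λ z))
    * Complex.I_mul_I

/-- With G = e^{-K}, this is ∂G + ∂K G = 0 times a scalar: the connection is the one that makes the
covariant derivative orthogonal to the section. -/
theorem sum_conj_L_h (hz : z ∈ S.dom) (i : I) :
    ∑ Λ, (conj (S.L Λ z) * S.h i Λ z - conj (S.M Λ z) * S.f i Λ z) = 0 := by
  have h1 : ∑ Λ, (conj (S.L Λ z) * S.h i Λ z - conj (S.M Λ z) * S.f i Λ z)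
      = Real.exp (S.K z / 2) * Real.exp (S.K z / 2)
        * (∑ Λ, (conj (S.X Λ z) * wd i (S.F Λ) z - conj (S.F Λ z) * wd i (S.X Λ) z)
          + S.dK i z * ∑ Λ, (conj (S.X Λ z) * S.F Λ z - conj (S.F Λ z) * S.X Λ z)) := by
    rw [Finset.mul_sum, ← Finset.sum_add_distrib, Finset.mul_sum]
    refine Finset.sum_congr rfl fun Λ _ => ?_
    rw [S.h_eq hz, S.f_eq hz, L, M]
    simp only [map_mul, Complex.conj_ofReal]
    ring
  rw [h1, S.sum_X_wd hz, S.sum_X_F]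
  ring

theorem sum_f_h (hz : z ∈ S.dom) (i j : I) :
    ∑ Λ, (S.f i Λ z * S.h j Λ z - S.h i Λ z * S.f j Λ z) = 0 := by
  have h1 : ∑ Λ, (S.f i Λ z * S.h j Λ z - S.h i Λ z * S.f j Λ z)
      = Real.exp (S.K z / 2) * Real.exp (S.K z / 2)
        * (∑ Λ, (wd i (S.X Λ) z * wd j (S.F Λ) z - wd i (S.F Λ) z * wd j (S.X Λ) z)
          + S.dK i z * ∑ Λ, (S.X Λ z * wd j (S.F Λ) z - S.F Λ z * wd j (S.X Λ) z)
          - S.dK j z * ∑ Λ, (S.X Λ z * wd i (S.F Λ) z - S.F Λ z * wd i (S.X Λ) z)) := by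
    rw [Finset.mul_sum, Finset.mul_sum, ← Finset.sum_add_distrib, ← Finset.sum_sub_distrib,
      Finset.mul_sum]
    refine Finset.sum_congr rfl fun Λ _ => ?_
    rw [S.h_eq hz, S.f_eq hz, S.h_eq hz, S.f_eq hz]
    ring
  rw [h1, S.symplectic_wd_wd hz, S.symplectic z hz, S.symplectic z hz]
  ring

/-- Three terms proportional to ∂_i K ∂_j̄ K arise, with signs +, + and -; the survivor matches the
one in `g_eq`. -/
theorem sum_conj_f_h (hz : z ∈ S.dom) (i j : I) :
    Complex.I * ∑ Λ, (conj (S.f j Λ z) * S.h i Λ z - conj (S.h j Λ z) * S.f i Λ z)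
      = -S.g z i j := by
  have hE := S.exp_half_K_sq_mul_sectionNorm hz
  have hG : (sectionNorm S.X S.F z : ℂ) ≠ 0 := by exact_mod_cast (S.sectionNorm_pos z hz).ne'
  have hj := congrArg conj (S.sum_X_wd hz j)
  simp only [map_sum, map_mul, map_sub, Complex.conj_conj, Complex.conj_I,
    Complex.conj_ofReal] at hj
  have h1 : ∑ Λ, (conj (S.f j Λ z) * S.h i Λ z - conj (S.h j Λ z) * S.f i Λ z)
      = Real.exp (S.K z / 2) * Real.exp (S.K z / 2)
        * (-(∑ Λ, (wd i (S.X Λ) z * conj (wd j (S.F Λ) z)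
            - wd i (S.F Λ) z * conj (wd j (S.X Λ) z)))
          - S.dK i z * ∑ Λ, (S.X Λ z * conj (wd j (S.F Λ) z) - S.F Λ z * conj (wd j (S.X Λ) z))
          + conj (S.dK j z)
            * ∑ Λ, (conj (S.X Λ z) * wd i (S.F Λ) z - conj (S.F Λ z) * wd i (S.X Λ) z)
          + S.dK i z * conj (S.dK j z)
            * ∑ Λ, (conj (S.X Λ z) * S.F Λ z - conj (S.F Λ z) * S.X Λ z)) := by
    rw [Finset.mul_sum, Finset.mul_sum, Finset.mul_sum, ← Finset.sum_neg_distrib,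
      ← Finset.sum_sub_distrib, ← Finset.sum_add_distrib, ← Finset.sum_add_distrib, Finset.mul_sum]
    refine Finset.sum_congr rfl fun Λ _ => ?_
    rw [S.h_eq hz, S.f_eq hz, S.h_eq hz, S.f_eq hz]
    simp only [map_mul, map_add, Complex.conj_ofReal]
    ring
  rw [h1, hj, S.sum_X_wd hz, S.sum_X_F, S.g_eq hz]
  have hE' : (Real.exp (S.K z / 2) : ℂ) * Real.exp (S.K z / 2)
      = (sectionNorm S.X S.F z : ℂ)⁻¹ := eq_inv_of_mul_eq_one_left hE
  rw [hE']
  field_simp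
  linear_combination (S.dK i z * conj (S.dK j z) * sectionNorm S.X S.F z) * Complex.I_mul_I

theorem g_isHermitian (hz : z ∈ S.dom) (i j : I) : conj (S.g z j i) = S.g z i j :=
  (S.metric_posDef z hz).isHermitian.apply i j

/-- The Hermitian Gram matrix of the frame (L, f̄): the normalization and the metric on the
diagonal, vanishing mixed pairings elsewhere. Its positivity makes the upper frame invertible, which
gives 𝒩 its defining relations. -/
theorem upperFrame_commutator (hz : z ∈ S.dom) :
    Complex.I • ((S.upperFrame z)ᴴ * S.lowerFrame z - (S.lowerFrame z)ᴴ * S.upperFrame z)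
      = oneOplus (S.g z) := by
  ext c d
  simp only [Matrix.smul_apply, Matrix.sub_apply, Matrix.mul_apply, ← Finset.sum_sub_distrib,
    Matrix.conjTranspose_apply, smul_eq_mul]
  rcases c with _ | i <;> rcases d with _ | j <;>
    simp only [upperFrame, lowerFrame, oneOplus, Matrix.of_apply, Option.elim,
      RCLike.star_def, Complex.conj_conj]
  · rw [S.sum_conj_L_M hz]; simp
  · have := congrArg conj (S.sum_L_h hz j)
    simp only [map_sum, map_sub, map_mul, map_zero] at this
    rw [this, mul_zero]
  · have := S.sum_L_h hz i
    rw [← neg_eq_zero, ← Finset.sum_neg_distrib] at this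
    rw [Finset.sum_congr rfl (fun Λ _ => (by ring : S.f i Λ z * S.M Λ z - S.h i Λ z * S.L Λ z
      = -(S.L Λ z * S.h i Λ z - S.M Λ z * S.f i Λ z))), this, mul_zero]
  · have := congrArg conj (S.sum_conj_f_h hz j i)
    rw [map_neg, S.g_isHermitian hz, map_mul, Complex.conj_I] at this
    rw [← neg_neg (S.g z i j), ← this]
    simp only [map_sum, map_sub, map_mul, Complex.conj_conj, neg_mul, neg_neg]

theorem isUnit_upperFrame (hz : z ∈ S.dom) : IsUnit (S.upperFrame z) :=
  Matrix.isUnit_of_posDef_commutator (B := S.lowerFrame z) (by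
    rw [S.upperFrame_commutator hz]
    exact (S.metric_posDef z hz).oneOplus)

theorem N_mul_upperFrame (hz : z ∈ S.dom) : S.N z * S.upperFrame z = S.lowerFrame z := by
  rw [N, Matrix.mul_assoc, Matrix.nonsing_inv_mul _
    ((Matrix.isUnit_iff_isUnit_det _).1 (S.isUnit_upperFrame hz)), Matrix.mul_one]

/-- The frame spans an isotropic subspace of the symplectic form. Since 𝒩 describes this subspace as
a graph, 𝒩 is symmetric. -/
theorem upperFrame_transpose_mul (hz : z ∈ S.dom) :
    (S.upperFrame z)ᵀ * S.lowerFrame z = (S.lowerFrame z)ᵀ * S.upperFrame z := by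
  rw [← sub_eq_zero]
  ext c d
  simp only [Matrix.sub_apply, Matrix.mul_apply, ← Finset.sum_sub_distrib,
    Matrix.transpose_apply, Matrix.zero_apply]
  rcases c with _ | i <;> rcases d with _ | j <;>
    simp only [upperFrame, lowerFrame, Matrix.of_apply, Option.elim]
  · exact Finset.sum_eq_zero fun Λ _ => by ring
  · have := congrArg conj (S.sum_conj_L_h hz j)
    simpa only [map_sum, map_sub, map_mul, map_zero, Complex.conj_conj] using this
  · have := congrArg (fun t => -conj t) (S.sum_conj_L_h hz i)
    simp only [map_sum, map_sub, map_mul, map_zero, Complex.conj_conj, neg_zero,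
      ← Finset.sum_neg_distrib] at this
    rw [← this]
    exact Finset.sum_congr rfl fun Λ _ => by ring
  · have := congrArg conj (S.sum_f_h hz i j)
    simpa only [map_sum, map_sub, map_mul, map_zero, Complex.conj_conj] using this

theorem N_isSymm (hz : z ∈ S.dom) : (S.N z).IsSymm := by
  have hu := (Matrix.isUnit_iff_isUnit_det _).1 (S.isUnit_upperFrame hz)
  have h := S.upperFrame_transpose_mul hz
  rw [← S.N_mul_upperFrame hz, Matrix.transpose_mul, Matrix.mul_assoc] at h
  have hut : IsUnit (S.upperFrame z)ᵀ.det := by rwa [Matrix.det_transpose]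
  have h2 := congrArg (fun A => ((S.upperFrame z)ᵀ)⁻¹ * (A * (S.upperFrame z)⁻¹)) h
  simp only [Matrix.mul_assoc, Matrix.mul_nonsing_inv _ hu, Matrix.mul_one] at h2
  rw [Matrix.nonsing_inv_mul_cancel_left _ _ hut, Matrix.nonsing_inv_mul_cancel_left _ _ hut] at h2
  exact h2.symm

theorem N_sub_conjTranspose (hz : z ∈ S.dom) :
    S.N z - (S.N z)ᴴ = (2 * Complex.I) • (S.ImN z).map Complex.ofReal := by
  ext Λ Ξ
  have hs := (S.N_isSymm hz).apply Ξ Λ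
  simp only [Matrix.sub_apply, Matrix.conjTranspose_apply, Matrix.smul_apply, Matrix.map_apply,
    ImN, smul_eq_mul, hs.symm, RCLike.star_def]
  rw [Complex.sub_conj]
  push_cast
  ring

/-- `Im 𝒩` in the frame `(L, f̄)`. -/
theorem upperFrame_ImN (hz : z ∈ S.dom) :
    (S.upperFrame z)ᴴ * (S.ImN z).map Complex.ofReal * S.upperFrame z
      = (-(1 / 2) : ℂ) • oneOplus (S.g z) := by
  have h1 : (S.ImN z).map Complex.ofReal = (-(Complex.I / 2)) • (S.N z - (S.N z)ᴴ) := by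
    rw [S.N_sub_conjTranspose hz, smul_smul]
    have : -(Complex.I / 2) * (2 * Complex.I) = 1 := by
      linear_combination -Complex.I_mul_I
    rw [this, one_smul]
  rw [h1, ← S.upperFrame_commutator hz, ← S.N_mul_upperFrame hz, Matrix.conjTranspose_mul,
    smul_smul]
  simp only [Matrix.mul_smul, Matrix.smul_mul, Matrix.mul_sub, Matrix.sub_mul, Matrix.mul_assoc]
  congr 1
  ring

/-- Conjugation by the invertible upper frame turns -2 Im 𝒩 into 1 ⊕ g, which is positive. -/
theorem neg_two_ImN_posDef (hz : z ∈ S.dom) : ((-2 : ℝ) • S.ImN z).PosDef := by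
  refine .of_map_ofReal ?_
  rw [← Matrix.IsUnit.posDef_star_left_conjugate_iff (S.isUnit_upperFrame hz)]
  have h : ((-2 : ℝ) • S.ImN z).map Complex.ofReal
      = (-2 : ℂ) • (S.ImN z).map Complex.ofReal := by
    ext; simp
  rw [h, Matrix.star_eq_conjTranspose, Matrix.mul_smul, Matrix.smul_mul, S.upperFrame_ImN hz,
    smul_smul]
  norm_num
  exact (S.metric_posDef z hz).oneOplus

/-- `(Im 𝒩)⁻¹ = -2 (L L̄ + f̄ g⁻¹ f)`. -/
theorem ImN_inv (hz : z ∈ S.dom) : (S.ImN z)⁻¹.map Complex.ofReal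
    = (-2 : ℂ) • (S.upperFrame z * oneOplus (S.g z)⁻¹ * (S.upperFrame z)ᴴ) := by
  rw [← Matrix.map_ofReal_inv, Matrix.inv_of_congruence (S.upperFrame_ImN hz)
    (S.metric_posDef z hz).oneOplus.isUnit, oneOplus_inv (A := S.g z) (S.metric_posDef z hz).isUnit]

end SpecialKahler


/-! ### Gauge action on the symplectic section and the prepotential P⁰ -/

namespace StructureConstants

variable {G : Type*} [Fintype G] (𝔤 : StructureConstants G)

/-- `f_{ΛΣ}{}^Γ a^Λ b^Σ m_Γ`. -/
def tri (a b m : G → ℂ) : ℂ := ∑ Λ, a Λ * ∑ Ξ, ∑ Γ, (𝔤.c Λ Ξ Γ : ℂ) * b Ξ * m Γ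

theorem tri_eq (a b m : G → ℂ) :
    𝔤.tri a b m = ∑ Λ, ∑ Ξ, ∑ Γ, (𝔤.c Λ Ξ Γ : ℂ) * a Λ * b Ξ * m Γ := by
  refine Finset.sum_congr rfl fun Λ _ => ?_
  simp only [Finset.mul_sum]
  exact Finset.sum_congr rfl fun Ξ _ => Finset.sum_congr rfl fun Γ _ => by ring

theorem tri_swap (a b m : G → ℂ) : 𝔤.tri a b m = -𝔤.tri b a m := by
  rw [tri_eq, tri_eq, Finset.sum_comm, ← Finset.sum_neg_distrib]
  refine Finset.sum_congr rfl fun Λ _ => ?_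
  rw [← Finset.sum_neg_distrib]
  refine Finset.sum_congr rfl fun Ξ _ => ?_
  rw [← Finset.sum_neg_distrib]
  refine Finset.sum_congr rfl fun Γ _ => ?_
  rw [𝔤.antisymm Ξ Λ Γ]
  push_cast
  ring

theorem tri_self (a m : G → ℂ) : 𝔤.tri a a m = 0 := by
  have := 𝔤.tri_swap a a m
  linear_combination this / 2

theorem conj_tri (a b m : G → ℂ) : conj (𝔤.tri a b m)
    = 𝔤.tri (fun Λ => conj (a Λ)) (fun Λ => conj (b Λ)) (fun Λ => conj (m Λ)) := by
  simp [tri]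

end StructureConstants

namespace VectorGauging

variable {I : Type*} [Fintype I] [DecidableEq I] {S : SpecialKahler I}
  {𝔤 : StructureConstants (Option I)} (V : VectorGauging S 𝔤) {z : I → ℂ}

/-- `k_Λ^I ∂_I K + r_Λ`, which is `i P^0_Λ`. -/
def complexP0 (Λ : Option I) (z : I → ℂ) : ℂ := ∑ i, V.k Λ i z * S.dK i z + V.r Λ z

/-- The term k ∂K from the covariant derivative joins the compensator r, so the rescaling of L is by
`complexP0`. -/
theorem sum_k_f (hz : z ∈ S.dom) (Λ Γ : Option I) : ∑ i, V.k Λ i z * S.f i Γ z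
    = -∑ Ξ, 𝔤.c Λ Ξ Γ * S.L Ξ z + V.complexP0 Λ z * S.L Γ z := by
  have h1 : ∑ i, V.k Λ i z * S.f i Γ z = Real.exp (S.K z / 2)
      * (∑ i, V.k Λ i z * wd i (S.X Γ) z + (∑ i, V.k Λ i z * S.dK i z) * S.X Γ z) := by
    rw [Finset.sum_mul, ← Finset.sum_add_distrib, Finset.mul_sum]
    refine Finset.sum_congr rfl fun i _ => ?_
    rw [S.f_eq hz]; ring
  have h2 : ∑ Ξ, (𝔤.c Λ Ξ Γ : ℂ) * S.L Ξ z
      = Real.exp (S.K z / 2) * ∑ Ξ, 𝔤.c Λ Ξ Γ * S.X Ξ z := by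
    rw [Finset.mul_sum]
    refine Finset.sum_congr rfl fun Ξ _ => ?_
    rw [SpecialKahler.L]; ring
  rw [h1, h2, V.action_X z hz, complexP0, SpecialKahler.L]
  ring

theorem sum_k_h (hz : z ∈ S.dom) (Λ Γ : Option I) : ∑ i, V.k Λ i z * S.h i Γ z
    = ∑ Ξ, 𝔤.c Λ Γ Ξ * S.M Ξ z + V.complexP0 Λ z * S.M Γ z := by
  have h1 : ∑ i, V.k Λ i z * S.h i Γ z = Real.exp (S.K z / 2)
      * (∑ i, V.k Λ i z * wd i (S.F Γ) z + (∑ i, V.k Λ i z * S.dK i z) * S.F Γ z) := by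
    rw [Finset.sum_mul, ← Finset.sum_add_distrib, Finset.mul_sum]
    refine Finset.sum_congr rfl fun i _ => ?_
    rw [S.h_eq hz]; ring
  have h2 : ∑ Ξ, (𝔤.c Λ Γ Ξ : ℂ) * S.M Ξ z
      = Real.exp (S.K z / 2) * ∑ Ξ, 𝔤.c Λ Γ Ξ * S.F Ξ z := by
    rw [Finset.mul_sum]
    refine Finset.sum_congr rfl fun Ξ _ => ?_
    rw [SpecialKahler.M]; ring
  rw [h1, h2, V.action_F z hz, complexP0, SpecialKahler.M]
  ring

/-- The symplectic pairing of `(a, b)` with `k_Λ^I (f_I, h_I)`. -/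
theorem sum_pairing_k (hz : z ∈ S.dom) (Λ : Option I) (a b : Option I → ℂ) :
    ∑ i, V.k Λ i z * ∑ Γ, (a Γ * S.h i Γ z - b Γ * S.f i Γ z)
      = ∑ Ξ, ∑ Γ, (𝔤.c Λ Ξ Γ : ℂ) * a Ξ * S.M Γ z + ∑ Ξ, ∑ Γ, (𝔤.c Λ Ξ Γ : ℂ) * S.L Ξ z * b Γ
        + V.complexP0 Λ z * ∑ Γ, (a Γ * S.M Γ z - b Γ * S.L Γ z) := by
  have h1 : ∑ i, V.k Λ i z * ∑ Γ, (a Γ * S.h i Γ z - b Γ * S.f i Γ z)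
      = ∑ Γ, (a Γ * ∑ i, V.k Λ i z * S.h i Γ z - b Γ * ∑ i, V.k Λ i z * S.f i Γ z) := by
    simp only [Finset.mul_sum, ← Finset.sum_sub_distrib]
    rw [Finset.sum_comm]
    exact Finset.sum_congr rfl fun Γ _ => Finset.sum_congr rfl fun i _ => by ring
  have h2 : ∑ Ξ, ∑ Γ, (𝔤.c Λ Ξ Γ : ℂ) * a Ξ * S.M Γ z = ∑ Γ, a Γ * ∑ Ξ, 𝔤.c Λ Γ Ξ * S.M Ξ z := by
    simp only [Finset.mul_sum]
    exact Finset.sum_congr rfl fun Γ _ => Finset.sum_congr rfl fun i _ => by ring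
  have h3 : ∑ Ξ, ∑ Γ, (𝔤.c Λ Ξ Γ : ℂ) * S.L Ξ z * b Γ
      = ∑ Γ, b Γ * ∑ Ξ, 𝔤.c Λ Ξ Γ * S.L Ξ z := by
    rw [Finset.sum_comm]
    simp only [Finset.mul_sum]
    exact Finset.sum_congr rfl fun Γ _ => Finset.sum_congr rfl fun i _ => by ring
  rw [h1, h2, h3, Finset.mul_sum, ← Finset.sum_add_distrib, ← Finset.sum_add_distrib]
  refine Finset.sum_congr rfl fun Γ _ => ?_
  rw [V.sum_k_f hz, V.sum_k_h hz]
  ring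

/-- Pair the gauge variation with the conjugate section: the left side vanishes by `sum_conj_L_h`,
and the normalization -i solves for `complexP0`. The remaining expression is self-conjugate, so
`complexP0` is imaginary and its imaginary part `P0` determines it. -/
theorem I_mul_P0 (hz : z ∈ S.dom) (Λ : Option I) :
    Complex.I * V.P0 Λ z = V.complexP0 Λ z ∧ (V.P0 Λ z : ℂ)
      = -(∑ Ξ, ∑ Γ, (𝔤.c Λ Ξ Γ : ℂ) * conj (S.L Ξ z) * S.M Γ z
        + ∑ Ξ, ∑ Γ, (𝔤.c Λ Ξ Γ : ℂ) * S.L Ξ z * conj (S.M Γ z)) := by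
  have h := V.sum_pairing_k hz Λ (fun Γ => conj (S.L Γ z)) (fun Γ => conj (S.M Γ z))
  simp only [S.sum_conj_L_h hz, mul_zero, Finset.sum_const_zero, S.sum_conj_L_M hz] at h
  set Q := ∑ Ξ, ∑ Γ, (𝔤.c Λ Ξ Γ : ℂ) * conj (S.L Ξ z) * S.M Γ z
    + ∑ Ξ, ∑ Γ, (𝔤.c Λ Ξ Γ : ℂ) * S.L Ξ z * conj (S.M Γ z) with hQ
  have hQr : conj Q = Q := by
    simp only [hQ, map_add, map_sum, map_mul, Complex.conj_conj, Complex.conj_ofReal]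
    rw [add_comm]
  have hp : V.complexP0 Λ z = -Complex.I * Q := by
    linear_combination -Complex.I * h + V.complexP0 Λ z * Complex.I_mul_I
  have hre : (Q.re : ℂ) = Q := Complex.conj_eq_iff_re.1 hQr
  have hP : V.P0 Λ z = -Q.re := by
    change (V.complexP0 Λ z).im = _
    rw [hp]; simp
  have hP' : (V.P0 Λ z : ℂ) = -Q := by rw [hP]; push_cast; rw [hre]
  exact ⟨by rw [hP', hp]; ring, hP'⟩

theorem sum_P0 (hz : z ∈ S.dom) (a : Option I → ℂ) : ∑ Λ, a Λ * V.P0 Λ z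
    = -(𝔤.tri a (fun Λ => conj (S.L Λ z)) (fun Λ => S.M Λ z)
      + 𝔤.tri a (fun Λ => S.L Λ z) (fun Λ => conj (S.M Λ z))) := by
  simp only [StructureConstants.tri]
  rw [← Finset.sum_add_distrib, ← Finset.sum_neg_distrib]
  refine Finset.sum_congr rfl fun Λ _ => ?_
  rw [(V.I_mul_P0 hz Λ).2]
  ring

/-- Pairing the gauge variation of the section with the section itself gives this expression twice,
while the pairings ⟨V, ∇_I V⟩ and ⟨V, V⟩ vanish for V = (L, M). -/
theorem tri_L_M (V : VectorGauging S 𝔤) (hz : z ∈ S.dom) (a : Option I → ℂ) :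
    𝔤.tri a (fun Λ => S.L Λ z) (fun Λ => S.M Λ z) = 0 := by
  refine Finset.sum_eq_zero fun Λ _ => ?_
  have h := V.sum_pairing_k hz Λ (fun Γ => S.L Γ z) (fun Γ => S.M Γ z)
  simp only [S.sum_L_h hz, mul_zero, Finset.sum_const_zero] at h
  have h0 : ∑ Γ, (S.L Γ z * S.M Γ z - S.M Γ z * S.L Γ z) = 0 :=
    Finset.sum_eq_zero fun Γ _ => by ring
  rw [h0] at h
  linear_combination -a Λ / 2 * h

/-- `P^0_Λ L^Λ = 0`. -/
theorem sum_L_P0 (hz : z ∈ S.dom) : ∑ Λ, S.L Λ z * V.P0 Λ z = 0 := by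
  rw [V.sum_P0 hz, 𝔤.tri_self, 𝔤.tri_swap, V.tri_L_M hz]
  simp

theorem sum_conj_L_P0 (hz : z ∈ S.dom) : ∑ Λ, conj (S.L Λ z) * V.P0 Λ z = 0 := by
  simpa using congrArg conj (V.sum_L_P0 hz)

/-- The argument of `tri_L_M`, with the gauge variation paired against (f_j, h_j). -/
theorem tri_f_M (V : VectorGauging S 𝔤) (hz : z ∈ S.dom) (j : I) (a : Option I → ℂ) :
    𝔤.tri a (fun Λ => S.f j Λ z) (fun Λ => S.M Λ z)
      + 𝔤.tri a (fun Λ => S.L Λ z) (fun Λ => S.h j Λ z) = 0 := by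
  simp only [StructureConstants.tri]
  rw [← Finset.sum_add_distrib]
  refine Finset.sum_eq_zero fun Λ _ => ?_
  have h := V.sum_pairing_k hz Λ (fun Γ => S.f j Γ z) (fun Γ => S.h j Γ z)
  simp only [S.sum_f_h hz, mul_zero, Finset.sum_const_zero] at h
  have h0 : ∑ Γ, (S.f j Γ z * S.M Γ z - S.h j Γ z * S.L Γ z) = 0 := by
    rw [← neg_eq_zero, ← S.sum_L_h hz j, ← Finset.sum_neg_distrib]
    exact Finset.sum_congr rfl fun Γ _ => by ring
  rw [h0] at h
  linear_combination -a Λ * h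

/-- `k_Λ^I L̄^Λ`. -/
def contracted (z : I → ℂ) (i : I) : ℂ := ∑ Λ, conj (S.L Λ z) * V.k Λ i z

theorem sum_contracted_mul (φ : I → ℂ) : ∑ i, V.contracted z i * φ i
    = ∑ Λ, conj (S.L Λ z) * ∑ i, V.k Λ i z * φ i := by
  simp only [contracted, Finset.sum_mul, Finset.mul_sum]
  rw [Finset.sum_comm]
  exact Finset.sum_congr rfl fun Γ _ => Finset.sum_congr rfl fun i _ => by ring

/-- `f̄_J̄^Λ P^0_Λ = i g_{IJ̄} k_Λ^I L̄^Λ`. -/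
theorem sum_conj_f_P0 (hz : z ∈ S.dom) (j : I) : ∑ Λ, conj (S.f j Λ z) * V.P0 Λ z
    = Complex.I * ∑ i, V.contracted z i * S.g z i j := by
  have h4 := congrArg conj (V.tri_f_M hz j (fun Λ => conj (S.L Λ z)))
  simp only [map_add, 𝔤.conj_tri, Complex.conj_conj, map_zero] at h4
  -- The gauge variation is paired with (f̄_j, h̄_j): the frame relation yields the metric, and the
  -- compensator drops out because (f̄_j, h̄_j) is orthogonal to (L, M).
  have h3 : -(∑ i, V.contracted z i * S.g z i j) = Complex.I *
      (𝔤.tri (fun Λ => conj (S.L Λ z)) (fun Λ => conj (S.f j Λ z)) (fun Λ => S.M Λ z)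
      + 𝔤.tri (fun Λ => conj (S.L Λ z)) (fun Λ => S.L Λ z) (fun Λ => conj (S.h j Λ z))) := by
    rw [V.sum_contracted_mul, ← Finset.sum_neg_distrib]
    simp only [StructureConstants.tri]
    rw [← Finset.sum_add_distrib, Finset.mul_sum]
    refine Finset.sum_congr rfl fun Λ _ => ?_
    have h := V.sum_pairing_k hz Λ (fun Γ => conj (S.f j Γ z)) (fun Γ => conj (S.h j Γ z))
    have h0 : ∑ Γ, (conj (S.f j Γ z) * S.M Γ z - conj (S.h j Γ z) * S.L Γ z) = 0 := by
      have := congrArg (fun t => -conj t) (S.sum_conj_L_h hz j)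
      simp only [map_sum, map_sub, map_mul, map_zero, Complex.conj_conj, neg_zero,
        ← Finset.sum_neg_distrib] at this
      rw [← this]
      exact Finset.sum_congr rfl fun Γ _ => by ring
    rw [h0, mul_zero, add_zero] at h
    rw [← mul_add, ← h]
    have h5 : ∑ i, V.k Λ i z * S.g z i j = -(Complex.I * ∑ i, V.k Λ i z *
        ∑ Γ, (conj (S.f j Γ z) * S.h i Γ z - conj (S.h j Γ z) * S.f i Γ z)) := by
      rw [Finset.mul_sum, ← Finset.sum_neg_distrib]
      refine Finset.sum_congr rfl fun i _ => ?_
      linear_combination V.k Λ i z * S.sum_conj_f_h hz i j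
    rw [h5]
    ring
  rw [V.sum_P0 hz, 𝔤.tri_swap (fun Λ => conj (S.f j Λ z)), 𝔤.tri_swap (fun Λ => conj (S.f j Λ z))]
  have h6 := 𝔤.tri_swap (fun Λ => S.L Λ z) (fun Λ => conj (S.L Λ z)) (fun Λ => conj (S.h j Λ z))
  linear_combination Complex.I * h3 + h4 - h6 +
    (𝔤.tri (fun Λ => conj (S.L Λ z)) (fun Λ => conj (S.f j Λ z)) (fun Λ => S.M Λ z)
      + 𝔤.tri (fun Λ => conj (S.L Λ z)) (fun Λ => S.L Λ z) (fun Λ => conj (S.h j Λ z)))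
      * Complex.I_mul_I

/-- `k_Λ^I L̄^Λ f_I^Γ = - f_{ΛΣ}{}^Γ L̄^Λ L^Σ`. -/
theorem sum_contracted_f (hz : z ∈ S.dom) (P : Option I → ℂ) :
    ∑ i, V.contracted z i * ∑ Γ, S.f i Γ z * P Γ
      = -𝔤.tri (fun Λ => conj (S.L Λ z)) (fun Λ => S.L Λ z) P := by
  have h1 : ∀ Λ, ∑ i, V.k Λ i z * ∑ Γ, S.f i Γ z * P Γ
      = -∑ Ξ, ∑ Γ, (𝔤.c Λ Ξ Γ : ℂ) * S.L Ξ z * P Γ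
        + Complex.I * V.P0 Λ z * ∑ Γ, S.L Γ z * P Γ := by
    intro Λ
    have h2 : ∑ i, V.k Λ i z * ∑ Γ, S.f i Γ z * P Γ
        = ∑ Γ, (∑ i, V.k Λ i z * S.f i Γ z) * P Γ := by
      simp only [Finset.mul_sum, Finset.sum_mul]
      rw [Finset.sum_comm]
      exact Finset.sum_congr rfl fun Γ _ => Finset.sum_congr rfl fun i _ => by ring
    rw [h2, Finset.sum_comm, ← Finset.sum_neg_distrib, Finset.mul_sum, ← Finset.sum_add_distrib]
    refine Finset.sum_congr rfl fun Γ _ => ?_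
    rw [V.sum_k_f hz, (V.I_mul_P0 hz Λ).1, ← Finset.sum_mul]
    ring
  rw [V.sum_contracted_mul]
  simp only [h1, mul_add, Finset.sum_add_distrib, StructureConstants.tri, mul_neg,
    Finset.sum_neg_distrib]
  -- The compensator contributes a multiple of L̄^Λ P⁰_Λ = 0.
  have h3 : ∑ Λ, conj (S.L Λ z) * (Complex.I * V.P0 Λ z * ∑ Γ, S.L Γ z * P Γ)
      = Complex.I * (∑ Λ, conj (S.L Λ z) * V.P0 Λ z) * ∑ Γ, S.L Γ z * P Γ := by
    rw [mul_assoc, Finset.sum_mul, Finset.mul_sum]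
    exact Finset.sum_congr rfl fun Λ _ => by ring
  rw [h3, V.sum_conj_L_P0 hz]
  ring

end VectorGauging


/-! ### Contractions with (Im 𝒩)⁻¹ -/

namespace SpecialKahler

variable {I : Type*} [Fintype I] [DecidableEq I] (S : SpecialKahler I) {z : I → ℂ}

theorem g_posDef (hz : z ∈ S.dom) : (S.g z).PosDef := S.metric_posDef z hz

/-- The quadratic form `(Im 𝒩)⁻¹` evaluated on the covectors `α`, `β`. -/
theorem sum_ImN_inv (hz : z ∈ S.dom) (α β : Option I → ℂ) :
    ∑ Λ, ∑ Ξ, (((S.ImN z)⁻¹ Λ Ξ : ℝ) : ℂ) * α Λ * β Ξ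
      = -2 * ((∑ Λ, S.L Λ z * α Λ) * (∑ Ξ, conj (S.L Ξ z) * β Ξ)
        + ∑ j, (∑ i, (∑ Λ, conj (S.f i Λ z) * α Λ) * (S.g z)⁻¹ i j) * ∑ Ξ, S.f j Ξ z * β Ξ) := by
  have h1 : ∀ Λ Ξ, (((S.ImN z)⁻¹ Λ Ξ : ℝ) : ℂ) = -2 * (S.L Λ z * conj (S.L Ξ z)
      + ∑ j, (∑ i, conj (S.f i Λ z) * (S.g z)⁻¹ i j) * S.f j Ξ z) := by
    intro Λ Ξ
    have := congrFun (congrFun (S.ImN_inv hz) Λ) Ξ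
    simp only [Matrix.map_apply, Matrix.smul_apply, Matrix.mul_apply, Fintype.sum_option,
      Matrix.conjTranspose_apply, upperFrame, oneOplus, Matrix.of_apply, Option.elim,
      smul_eq_mul, RCLike.star_def, Complex.conj_conj] at this
    rw [this]
    simp
  have h2 : ∀ Λ Ξ, (((S.ImN z)⁻¹ Λ Ξ : ℝ) : ℂ) * α Λ * β Ξ = -2 * ((S.L Λ z * α Λ)
      * (conj (S.L Ξ z) * β Ξ)
      + ∑ j, (∑ i, conj (S.f i Λ z) * α Λ * (S.g z)⁻¹ i j) * (S.f j Ξ z * β Ξ)) := by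
    intro Λ Ξ
    rw [h1, mul_assoc, mul_assoc, add_mul, Finset.sum_mul]
    congr 2
    · ring
    · refine Finset.sum_congr rfl fun j _ => ?_
      simp only [mul_right_comm _ (α Λ), ← Finset.sum_mul]
      ring
  simp only [h2, ← Finset.mul_sum, Finset.sum_add_distrib, ← Finset.sum_mul]
  congr 2
  have h3 : ∀ Λ, ∑ Ξ, ∑ j, (∑ i, conj (S.f i Λ z) * α Λ * (S.g z)⁻¹ i j) * (S.f j Ξ z * β Ξ)
      = ∑ j, (∑ i, conj (S.f i Λ z) * α Λ * (S.g z)⁻¹ i j) * ∑ Ξ, S.f j Ξ z * β Ξ := by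
    intro Λ
    rw [Finset.sum_comm]
    simp only [Finset.mul_sum]
  simp only [h3]
  rw [Finset.sum_comm]
  refine Finset.sum_congr rfl fun j _ => ?_
  rw [← Finset.sum_mul]
  congr 1
  rw [Finset.sum_comm]
  simp only [Finset.sum_mul]

end SpecialKahler

namespace VectorGauging

variable {I : Type*} [Fintype I] [DecidableEq I] {S : SpecialKahler I}
  {𝔤 : StructureConstants (Option I)} (V : VectorGauging S 𝔤) {z : I → ℂ}

/-- The L L̄ part of (Im 𝒩)⁻¹ annihilates P⁰; in the other part f̄ P⁰ = i g k L̄ cancels g⁻¹. -/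
theorem sum_ImN_inv_P0 (hz : z ∈ S.dom) (β : Option I → ℂ) :
    ∑ Λ, ∑ Ξ, (((S.ImN z)⁻¹ Λ Ξ : ℝ) : ℂ) * V.P0 Λ z * β Ξ
      = -2 * Complex.I * ∑ j, V.contracted z j * ∑ Ξ, S.f j Ξ z * β Ξ := by
  have hg := (Matrix.isUnit_iff_isUnit_det _).1 (S.g_posDef hz).isUnit
  rw [S.sum_ImN_inv hz (fun Λ => (V.P0 Λ z : ℂ)), V.sum_L_P0 hz, zero_mul, zero_add, mul_assoc]
  congr 1
  rw [Finset.mul_sum]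
  refine Finset.sum_congr rfl fun j _ => ?_
  rw [← mul_assoc]
  congr 1
  have h1 := congrFun (Matrix.vecMul_vecMul (V.contracted z) (S.g z) (S.g z)⁻¹) j
  rw [Matrix.mul_nonsing_inv _ hg, Matrix.vecMul_one] at h1
  rw [← h1]
  simp only [V.sum_conj_f_P0 hz, Matrix.vecMul, dotProduct]
  rw [Finset.mul_sum]
  exact Finset.sum_congr rfl fun i _ => by ring

/-- `g_{IJ̄} k_Λ^I k̄_Σ^J̄ L̄^Λ L^Σ = -½ (Im 𝒩)^{-1 ΛΣ} P^0_Λ P^0_Σ`. -/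
theorem sum_g_k_k (hz : z ∈ S.dom) :
    ∑ Λ, ∑ Ξ, (∑ i, ∑ j, S.g z i j * V.k Λ i z * conj (V.k Ξ j z)) * (conj (S.L Λ z) * S.L Ξ z)
      = -(1 / 2) * ∑ Λ, ∑ Ξ, (((S.ImN z)⁻¹ Λ Ξ : ℝ) : ℂ) * V.P0 Λ z * V.P0 Ξ z := by
  have h1 : ∑ Λ, ∑ Ξ, (∑ i, ∑ j, S.g z i j * V.k Λ i z * conj (V.k Ξ j z))
      * (conj (S.L Λ z) * S.L Ξ z)
      = ∑ i, ∑ j, S.g z i j * V.contracted z i * conj (V.contracted z j) := by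
    have h2 : ∀ i j, S.g z i j * V.contracted z i * conj (V.contracted z j) = ∑ Λ, ∑ Ξ,
        (S.g z i j * V.k Λ i z * conj (V.k Ξ j z)) * (conj (S.L Λ z) * S.L Ξ z) := by
      intro i j
      simp only [contracted, map_sum, map_mul, Complex.conj_conj]
      rw [mul_assoc, Finset.sum_mul_sum, Finset.mul_sum]
      refine Finset.sum_congr rfl fun Λ _ => ?_
      rw [Finset.mul_sum]
      exact Finset.sum_congr rfl fun Ξ _ => by ring
    simp only [h2, Finset.sum_mul]
    simp only [Finset.sum_comm (γ := Option I) (α := I)]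
  rw [h1, V.sum_ImN_inv_P0 hz, Finset.mul_sum, Finset.mul_sum]
  refine Finset.sum_congr rfl fun i _ => ?_
  have h3 := congrArg conj (V.sum_conj_f_P0 hz i)
  simp only [map_sum, map_mul, Complex.conj_conj, Complex.conj_ofReal, Complex.conj_I,
    S.g_isHermitian hz] at h3
  rw [h3]
  have h4 : ∑ j, S.g z i j * V.contracted z i * conj (V.contracted z j)
      = V.contracted z i * ∑ j, conj (V.contracted z j) * S.g z i j := by
    rw [Finset.mul_sum]
    exact Finset.sum_congr rfl fun j _ => by ring
  rw [h4]
  linear_combination (V.contracted z i * ∑ j, conj (V.contracted z j) * S.g z i j)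
    * Complex.I_mul_I

/-- Rewrites a contraction with P⁰ through the structure constants alone, the form to which
equivariance on the quaternionic side applies. -/
theorem sum_ImN_inv_P0_mul (hz : z ∈ S.dom) (β : Option I → ℂ) :
    ∑ Λ, ∑ Ξ, (((S.ImN z)⁻¹ Λ Ξ : ℝ) : ℂ) * V.P0 Λ z * β Ξ
      = 2 * Complex.I * 𝔤.tri (fun Λ => conj (S.L Λ z)) (fun Λ => S.L Λ z) β := by
  rw [V.sum_ImN_inv_P0 hz, V.sum_contracted_f hz]
  ring

end VectorGauging

/-! ### Splitting of the vector index -/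

section IndexSplitting

variable {C V : Type*} [Fintype C] [DecidableEq C] [Fintype V] [DecidableEq V]

theorem sum_ixX_add_sum_ixΛ {M : Type*} [AddCommMonoid M] (φ : Option (C ⊕ V) → M) :
    ∑ Λ, φ Λ = ∑ x : Option C, φ (ixX x) + ∑ v : V, φ (ixΛ v) := by
  simp [Fintype.sum_option, ixX, ixΛ, add_assoc]

/-- The splitting of the vector index into the truncated and the retained vectors. -/
def vectorIndexEquiv (C V : Type*) : Option C ⊕ V ≃ Option (C ⊕ V) where
  toFun := Sum.elim ixX ixΛ
  invFun := fun o => o.elim (Sum.inl none) (Sum.elim (fun c => Sum.inl (some c)) Sum.inr)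
  left_inv := by rintro ((_ | c) | v) <;> rfl
  right_inv := by rintro (_ | c | v) <;> rfl

theorem ixX_injective : Function.Injective (ixX : Option C → Option (C ⊕ V)) :=
  (vectorIndexEquiv C V).injective.comp Sum.inl_injective

theorem ixΛ_injective : Function.Injective (ixΛ : V → Option (C ⊕ V)) :=
  (vectorIndexEquiv C V).injective.comp Sum.inr_injective

end IndexSplitting


/-! ### Geometry of M_R: tangential frame, block structure of Im 𝒩, vanishing of P⁰_X -/

namespace Truncation

open Filter
open scoped Topology

variable {C V H : Type*} [Fintype C] [DecidableEq C] [Fintype V] [DecidableEq V]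
  [Fintype H] [DecidableEq H]
  {S : SpecialKahler (C ⊕ V)} {Q : QuaternionicKahler H}
  {𝔤 : StructureConstants (Option (C ⊕ V))} {VG : VectorGauging S 𝔤} {HG : HyperGauging Q 𝔤}
  (T : Truncation S Q VG HG) {z : C → ℂ}

theorem mem_dom (hz : z ∈ T.Z) : T.ι z ∈ S.dom := T.mapsTo_ι hz

theorem differentiableAt_ι (hz : z ∈ T.Z) : DifferentiableAt ℂ T.ι z :=
  (T.holomorphic_ι z hz).differentiableAt (T.isOpen_Z.mem_nhds hz)

/-- The holomorphic tangent vectors `∂ι/∂z^c` of `M_R`. -/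
def tangent (z : C → ℂ) (c : C) (a : C ⊕ V) : ℂ := fderiv ℂ T.ι z (Pi.single c 1) a

theorem X_ixΛ (hz : z ∈ T.Z) (v : V) : S.X (ixΛ v) (T.ι z) = 0 := by
  have h := T.L_Λ z hz v
  rw [SpecialKahler.L, mul_eq_zero] at h
  exact h.resolve_left (by exact_mod_cast (Real.exp_pos _).ne')

theorem sum_tangent_wd (hz : z ∈ T.Z) {φ : (C ⊕ V → ℂ) → ℂ}
    (hφ : DifferentiableAt ℂ φ (T.ι z)) (c : C) :
    ∑ a, T.tangent z c a * wd a φ (T.ι z) = wd c (fun y => φ (T.ι y)) z := by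
  rw [wd_comp_holomorphic (hφ.restrictScalars ℝ) (T.differentiableAt_ι hz)]
  exact Finset.sum_congr rfl fun a _ => mul_comm _ _

/-- `f_c^Λ`, the derivative of `L^Λ` along `M_R`. -/
def fR (z : C → ℂ) (c : C) (Λ : Option (C ⊕ V)) : ℂ :=
  ∑ a, T.tangent z c a * S.f a Λ (T.ι z)

/-- X^Λ vanishes identically along M_R, hence so do its tangential derivatives; the connection term
is proportional to X^Λ. -/
theorem fR_ixΛ (hz : z ∈ T.Z) (c : C) (v : V) : T.fR z c (ixΛ v) = 0 := by
  have h1 : wd c (fun y => S.X (ixΛ v) (T.ι y)) z = 0 := by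
    rw [wd_congr (ψ := fun _ => 0), wd_const]
    filter_upwards [T.isOpen_Z.mem_nhds hz] with y hy using T.X_ixΛ hy v
  rw [← T.sum_tangent_wd hz (S.differentiableAt_X (T.mem_dom hz) _)] at h1
  rw [← mul_zero (Real.exp (S.K (T.ι z) / 2) : ℂ), ← h1, Finset.mul_sum]
  refine Finset.sum_congr rfl fun a _ => ?_
  rw [S.f_eq (T.mem_dom hz), T.X_ixΛ hz]
  ring

/-- The matrix `(L^X, f̄_c^X)` on `M_R`. -/
def frame (z : C → ℂ) : Matrix (Option C) (Option C) ℂ :=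
  Matrix.of fun x c => c.elim (S.L (ixX x) (T.ι z)) fun c => conj (T.fR z c (ixX x))

/-- The inclusion of `1 ⊕ conj T M_R` into `1 ⊕ conj T M`. -/
def tangentMatrix (z : C → ℂ) : Matrix (Option (C ⊕ V)) (Option C) ℂ :=
  Matrix.of fun a c => a.elim (c.elim 1 fun _ => 0) fun a =>
    c.elim 0 fun c => conj (T.tangent z c a)

theorem upperFrame_mul_tangentMatrix (z : C → ℂ) (Λ : Option (C ⊕ V)) (c : Option C) :
    (S.upperFrame (T.ι z) * T.tangentMatrix z) Λ c
      = c.elim (S.L Λ (T.ι z)) fun c => conj (T.fR z c Λ) := by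
  rw [Matrix.mul_apply, Fintype.sum_option]
  rcases c with _ | c <;>
    simp [SpecialKahler.upperFrame, tangentMatrix, fR, mul_comm]

theorem upperFrame_mul_tangentMatrix_ixΛ (hz : z ∈ T.Z) (v : V) (c : Option C) :
    (S.upperFrame (T.ι z) * T.tangentMatrix z) (ixΛ v) c = 0 := by
  rw [upperFrame_mul_tangentMatrix]
  rcases c with _ | c
  · exact T.L_Λ z hz v
  · simp [T.fR_ixΛ hz]

theorem upperFrame_mul_tangentMatrix_ixX (z : C → ℂ) (x : Option C) (c : Option C) :
    (S.upperFrame (T.ι z) * T.tangentMatrix z) (ixX x) c = T.frame z x c := by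
  rw [upperFrame_mul_tangentMatrix, frame, Matrix.of_apply]

theorem tangentMatrix_oneOplus (z : C → ℂ) :
    (T.tangentMatrix z)ᴴ * oneOplus (S.g (T.ι z)) * T.tangentMatrix z = oneOplus (T.gR z) := by
  ext c d
  simp only [Matrix.mul_apply, Fintype.sum_option, Matrix.conjTranspose_apply]
  rcases c with _ | c <;> rcases d with _ | d
  · simp [oneOplus, tangentMatrix]
  · simp [oneOplus, tangentMatrix]
  · simp [oneOplus, tangentMatrix]
  · simp only [oneOplus, tangentMatrix, Matrix.of_apply, Option.elim, star_zero, zero_mul,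
      zero_add, mul_zero, RCLike.star_def, Complex.conj_conj, gR]
    simp only [Finset.sum_mul]
    rw [Finset.sum_comm]
    refine Finset.sum_congr rfl fun a _ => Finset.sum_congr rfl fun b _ => ?_
    simp only [tangent]
    ring

/-- A pullback of the positive metric by an injective differential. -/
theorem gR_posDef (hz : z ∈ T.Z) : (T.gR z).PosDef := by
  let A : Matrix (C ⊕ V) C ℂ := Matrix.of fun a c => conj (T.tangent z c a)
  have hA : T.gR z = Aᴴ * S.g (T.ι z) * A := by
    ext c d
    simp only [gR, A, Matrix.mul_apply, Matrix.of_apply, Matrix.conjTranspose_apply,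
      RCLike.star_def, Complex.conj_conj, Finset.sum_mul, tangent]
    rw [Finset.sum_comm]
    exact Finset.sum_congr rfl fun a _ => Finset.sum_congr rfl fun b _ => by ring
  rw [hA]
  refine (S.g_posDef (T.mem_dom hz)).conjTranspose_mul_mul_same ?_
  refine (injective_iff_map_eq_zero A.mulVecLin).2 fun x hx => ?_
  have hx' : ∀ a, ∑ c, conj (T.tangent z c a) * x c = 0 := fun a => congrFun hx a
  -- The columns of A are conjugated tangent vectors, so a kernel vector of A must be conjugated
  -- before the immersion hypothesis applies.
  have h1 : fderiv ℂ T.ι z (fun c => conj (x c)) = 0 := by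
    ext a
    have h2 : (fun c => conj (x c)) = ∑ c, conj (x c) • (Pi.single c 1 : C → ℂ) := by
      ext d; simp [Pi.single_apply]
    have h3 := congrArg conj (hx' a)
    rw [h2, map_sum]
    simp only [map_smul, Finset.sum_apply, Pi.smul_apply, smul_eq_mul]
    simpa [tangent, mul_comm] using h3
  have h4 := T.immersion_ι z hz (h1.trans (map_zero _).symm)
  ext c
  simpa using congrFun h4 c

theorem ImN_ixX_ixΛ (hz : z ∈ T.Z) (x : Option C) (v : V) :
    S.ImN (T.ι z) (ixX x) (ixΛ v) = 0 := by
  simp [SpecialKahler.ImN, T.N_XΛ z hz]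

theorem N_ixΛ_ixX (hz : z ∈ T.Z) (x : Option C) (v : V) :
    S.N (T.ι z) (ixΛ v) (ixX x) = 0 := by
  rw [(S.N_isSymm (T.mem_dom hz)).apply, T.N_XΛ z hz]

theorem ImN_ixΛ_ixX (hz : z ∈ T.Z) (x : Option C) (v : V) :
    S.ImN (T.ι z) (ixΛ v) (ixX x) = 0 := by
  simp [SpecialKahler.ImN, T.N_ixΛ_ixX hz]

/-- `Im 𝒩_{XY}`. -/
def ImNX (z : C → ℂ) : Matrix (Option C) (Option C) ℝ := (S.ImN (T.ι z)).submatrix ixX ixX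

/-- `Im 𝒩_{ΛΣ}`. -/
def ImNΛ (z : C → ℂ) : Matrix V V ℝ := (S.ImN (T.ι z)).submatrix ixΛ ixΛ

theorem ImN_submatrix (hz : z ∈ T.Z) :
    (S.ImN (T.ι z)).submatrix (vectorIndexEquiv C V) (vectorIndexEquiv C V)
      = Matrix.fromBlocks (T.ImNX z) 0 0 (T.ImNΛ z) := by
  ext (x | v) (y | w)
  · rfl
  · exact T.ImN_ixX_ixΛ hz x w
  · exact T.ImN_ixΛ_ixX hz y v
  · rfl

theorem neg_two_ImNX_posDef (hz : z ∈ T.Z) : ((-2 : ℝ) • T.ImNX z).PosDef :=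
  (S.neg_two_ImN_posDef (T.mem_dom hz)).submatrix ixX_injective

theorem neg_two_ImNΛ_posDef (hz : z ∈ T.Z) : ((-2 : ℝ) • T.ImNΛ z).PosDef :=
  (S.neg_two_ImN_posDef (T.mem_dom hz)).submatrix ixΛ_injective

theorem isUnit_of_smul {n : Type*} [Fintype n] [DecidableEq n] {A : Matrix n n ℝ} {c : ℝ}
    (h : IsUnit (c • A)) : IsUnit A := by
  rw [Matrix.isUnit_iff_isUnit_det, Matrix.det_smul] at h
  exact (Matrix.isUnit_iff_isUnit_det _).2 (isUnit_of_mul_isUnit_right h)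

theorem ImN_inv_submatrix (hz : z ∈ T.Z) :
    (S.ImN (T.ι z))⁻¹.submatrix (vectorIndexEquiv C V) (vectorIndexEquiv C V)
      = Matrix.fromBlocks (T.ImNX z)⁻¹ 0 0 (T.ImNΛ z)⁻¹ := by
  have h1 := isUnit_of_smul (T.neg_two_ImNX_posDef hz).isUnit
  have h2 := isUnit_of_smul (T.neg_two_ImNΛ_posDef hz).isUnit
  rw [← Matrix.inv_submatrix_equiv, T.ImN_submatrix hz,
    Matrix.inv_fromBlocks_zero₂₁_of_isUnit_iff _ _ _ ⟨fun _ => h2, fun _ => h1⟩]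
  simp

theorem ImN_inv_ixX_ixX (hz : z ∈ T.Z) (x y : Option C) :
    (S.ImN (T.ι z))⁻¹ (ixX x) (ixX y) = (T.ImNX z)⁻¹ x y :=
  congrFun (congrFun (T.ImN_inv_submatrix hz) (Sum.inl x)) (Sum.inl y)

theorem ImN_inv_ixX_ixΛ (hz : z ∈ T.Z) (x : Option C) (v : V) :
    (S.ImN (T.ι z))⁻¹ (ixX x) (ixΛ v) = 0 :=
  congrFun (congrFun (T.ImN_inv_submatrix hz) (Sum.inl x)) (Sum.inr v)

theorem ImN_inv_ixΛ_ixX (hz : z ∈ T.Z) (x : Option C) (v : V) :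
    (S.ImN (T.ι z))⁻¹ (ixΛ v) (ixX x) = 0 :=
  congrFun (congrFun (T.ImN_inv_submatrix hz) (Sum.inr v)) (Sum.inl x)

theorem ImN_inv_ixΛ_ixΛ (hz : z ∈ T.Z) (v w : V) :
    (S.ImN (T.ι z))⁻¹ (ixΛ v) (ixΛ w) = (T.ImNΛ z)⁻¹ v w :=
  congrFun (congrFun (T.ImN_inv_submatrix hz) (Sum.inr v)) (Sum.inr w)

theorem sum_ImN_inv_split (hz : z ∈ T.Z) (α β : Option (C ⊕ V) → ℂ) :
    ∑ Λ, ∑ Ξ, (((S.ImN (T.ι z))⁻¹ Λ Ξ : ℝ) : ℂ) * α Λ * β Ξ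
      = ∑ x, ∑ y, (((T.ImNX z)⁻¹ x y : ℝ) : ℂ) * α (ixX x) * β (ixX y)
        + ∑ v, ∑ w, (((T.ImNΛ z)⁻¹ v w : ℝ) : ℂ) * α (ixΛ v) * β (ixΛ w) := by
  simp [-Fintype.sum_option, -Fintype.sum_sum_type, sum_ixX_add_sum_ixΛ,
    T.ImN_inv_ixX_ixX hz, T.ImN_inv_ixX_ixΛ hz, T.ImN_inv_ixΛ_ixX hz,
    T.ImN_inv_ixΛ_ixΛ hz]

/-- Restrict the congruence `upperFrame_ImN` to 1 ⊕ conj T M_R. The metric becomes the induced one,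
and the Λ rows of the restricted frame vanish, so only Im 𝒩_{XY} remains. The restricted frame is
square, hence invertible. -/
theorem frame_ImNX (hz : z ∈ T.Z) :
    (T.frame z)ᴴ * (T.ImNX z).map Complex.ofReal * T.frame z
      = (-(1 / 2) : ℂ) • oneOplus (T.gR z) := by
  rw [← T.tangentMatrix_oneOplus, ← Matrix.smul_mul, ← Matrix.mul_smul,
    ← S.upperFrame_ImN (T.mem_dom hz)]
  have h : (T.tangentMatrix z)ᴴ * ((S.upperFrame (T.ι z))ᴴ
        * (S.ImN (T.ι z)).map Complex.ofReal * S.upperFrame (T.ι z)) * T.tangentMatrix z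
      = (S.upperFrame (T.ι z) * T.tangentMatrix z)ᴴ * (S.ImN (T.ι z)).map Complex.ofReal
        * (S.upperFrame (T.ι z) * T.tangentMatrix z) := by
    rw [Matrix.conjTranspose_mul]
    simp only [Matrix.mul_assoc]
  rw [h]
  generalize hB : S.upperFrame (T.ι z) * T.tangentMatrix z = B
  have hΛ : ∀ v c, B (ixΛ v) c = 0 := fun v c => by
    rw [← hB]; exact T.upperFrame_mul_tangentMatrix_ixΛ hz v c
  have hX : ∀ x c, B (ixX x) c = T.frame z x c := fun x c => by
    rw [← hB]; exact T.upperFrame_mul_tangentMatrix_ixX z x c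
  ext c d
  simp [-Fintype.sum_option, -Fintype.sum_sum_type, Matrix.mul_apply, sum_ixX_add_sum_ixΛ,
    hΛ, hX, ImNX]

theorem isUnit_frame (hz : z ∈ T.Z) : IsUnit (T.frame z) :=
  Matrix.isUnit_of_congruence (T.frame_ImNX hz) (T.gR_posDef hz).oneOplus.isUnit

/-- `-½ (Im 𝒩)^{-1 XY} = L^X L̄^Y + f̄_c^X g^{c̄ d} f_d^Y` on `M_R`. -/
theorem ImNX_inv (hz : z ∈ T.Z) (x y : Option C) : (((T.ImNX z)⁻¹ x y : ℝ) : ℂ)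
    = -2 * (S.L (ixX x) (T.ι z) * conj (S.L (ixX y) (T.ι z))
      + ∑ d, (∑ c, conj (T.fR z c (ixX x)) * (T.gR z)⁻¹ c d) * T.fR z d (ixX y)) := by
  have h := Matrix.inv_of_congruence (T.frame_ImNX hz) (T.gR_posDef hz).oneOplus.isUnit
  rw [Matrix.map_ofReal_inv, oneOplus_inv (T.gR_posDef hz).isUnit] at h
  have := congrFun (congrFun h x) y
  simp only [Matrix.map_apply, Matrix.smul_apply, Matrix.mul_apply, Fintype.sum_option,
    Matrix.conjTranspose_apply, frame, oneOplus, Matrix.of_apply, Option.elim,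
    smul_eq_mul, RCLike.star_def, Complex.conj_conj] at this
  rw [this]
  simp

/-- `P^0_X = 0` on `M_R`. -/
theorem P0_ixX (hz : z ∈ T.Z) (x : Option C) : VG.P0 (ixX x) (T.ι z) = 0 := by
  have hd := T.mem_dom hz
  have hL := VG.sum_L_P0 hd
  simp only [sum_ixX_add_sum_ixΛ, T.L_Λ z hz, zero_mul, Finset.sum_const_zero, add_zero] at hL
  -- The tangential part of f̄ P⁰ = i g k L̄. On the right only the k_X appear, because L^Λ = 0, and
  -- they are orthogonal to M_R.
  have hf : ∀ c, ∑ x : Option C, conj (T.fR z c (ixX x)) * VG.P0 (ixX x) (T.ι z) = 0 := by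
    intro c
    have h1 : ∑ Λ, conj (T.fR z c Λ) * VG.P0 Λ (T.ι z)
        = ∑ a, conj (T.tangent z c a) * ∑ Λ, conj (S.f a Λ (T.ι z)) * VG.P0 Λ (T.ι z) := by
      simp only [fR, map_sum, map_mul, Finset.sum_mul, Finset.mul_sum]
      rw [Finset.sum_comm]
      exact Finset.sum_congr rfl fun Γ _ => Finset.sum_congr rfl fun i _ => by ring
    have h2 : ∑ a, conj (T.tangent z c a)
          * (Complex.I * ∑ i, VG.contracted (T.ι z) i * S.g (T.ι z) i a)
        = Complex.I * ∑ Λ, conj (S.L Λ (T.ι z)) *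
          ∑ i, ∑ a, S.g (T.ι z) i a * VG.k Λ i (T.ι z) * conj (T.tangent z c a) := by
      have h5 := VG.sum_contracted_mul (z := T.ι z)
        fun i => ∑ a, S.g (T.ι z) i a * conj (T.tangent z c a)
      simp only [mul_assoc, mul_left_comm _ (VG.k _ _ _), ← Finset.mul_sum] at h5 ⊢
      rw [← h5, Finset.mul_sum]
      simp only [Finset.mul_sum]
      rw [Finset.sum_comm]
      exact Finset.sum_congr rfl fun Γ _ => Finset.sum_congr rfl fun i _ => by ring
    have h3 : ∑ Λ, conj (T.fR z c Λ) * VG.P0 Λ (T.ι z) = 0 := by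
      rw [h1]
      simp only [VG.sum_conj_f_P0 hd]
      rw [h2, sum_ixX_add_sum_ixΛ]
      have h4 : ∀ x : Option C, ∑ i, ∑ a, S.g (T.ι z) i a * VG.k (ixX x) i (T.ι z)
          * conj (T.tangent z c a) = 0 := fun x => T.k_X_special z hz x c
      simp [-Fintype.sum_option, -Fintype.sum_sum_type, h4, T.L_Λ z hz]
    simpa [-Fintype.sum_option, -Fintype.sum_sum_type, sum_ixX_add_sum_ixΛ, T.fR_ixΛ hz] using h3
  -- P⁰_X is annihilated by every column of an invertible frame.
  have hv : (fun x : Option C => (VG.P0 (ixX x) (T.ι z) : ℂ)) ᵥ* T.frame z = 0 := by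
    ext c
    rcases c with _ | c
    · simpa [-Fintype.sum_option, Matrix.vecMul, dotProduct, frame, mul_comm] using hL
    · simpa [-Fintype.sum_option, Matrix.vecMul, dotProduct, frame, mul_comm] using hf c
  have h0 := Matrix.vecMul_injective_iff_isUnit.2 (T.isUnit_frame hz)
    (hv.trans (Matrix.zero_vecMul _).symm)
  have hx := congrFun h0 x
  exact Complex.ofReal_eq_zero.1 hx

end Truncation


/-! ### Holomorphy of 𝒩̄_{ΛΣ} on M_R -/

section MatrixDifferentiability

variable {E n : Type*} [NormedAddCommGroup E] [NormedSpace ℂ E] [Fintype n] [DecidableEq n]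

theorem DifferentiableAt.matrix_det {A : E → Matrix n n ℂ} {x : E}
    (hA : ∀ i j, DifferentiableAt ℂ (fun y => A y i j) x) :
    DifferentiableAt ℂ (fun y => (A y).det) x := by
  simp only [Matrix.det_apply']
  exact DifferentiableAt.fun_sum fun σ _ => (differentiableAt_const _).fun_mul
    (HasFDerivAt.finsetProd fun i _ => (hA (σ i) i).hasFDerivAt).differentiableAt

theorem DifferentiableAt.matrix_inv {A : E → Matrix n n ℂ} {x : E}
    (hA : ∀ i j, DifferentiableAt ℂ (fun y => A y i j) x) (h0 : (A x).det ≠ 0) (i j : n) :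
    DifferentiableAt ℂ (fun y => (A y)⁻¹ i j) x := by
  simp only [Matrix.inv_def, Matrix.smul_apply, Ring.inverse_eq_inv', smul_eq_mul,
    Matrix.adjugate_apply]
  refine ((DifferentiableAt.matrix_det hA).fun_inv h0).fun_mul (DifferentiableAt.matrix_det ?_)
  intro k l
  by_cases hk : k = j
  · subst hk
    simp
  · simpa [Matrix.updateRow_apply, hk] using hA k l

end MatrixDifferentiability

namespace Truncation

open Filter
open scoped Topology

variable {C V H : Type*} [Fintype C] [DecidableEq C] [Fintype V] [DecidableEq V]
  [Fintype H] [DecidableEq H]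
  {S : SpecialKahler (C ⊕ V)} {Q : QuaternionicKahler H}
  {𝔤 : StructureConstants (Option (C ⊕ V))} {VG : VectorGauging S 𝔤} {HG : HyperGauging Q 𝔤}
  (T : Truncation S Q VG HG) {z : C → ℂ}

theorem exp_ne_zero (z : C → ℂ) : (Real.exp (S.K (T.ι z) / 2) : ℂ) ≠ 0 := by
  exact_mod_cast (Real.exp_pos _).ne'

/-- `F_Λ = 0` on `M_R`. -/
theorem F_ixΛ (hz : z ∈ T.Z) (v : V) : S.F (ixΛ v) (T.ι z) = 0 := by
  have h := congrFun (congrFun (S.N_mul_upperFrame (T.mem_dom hz)) (ixΛ v)) none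
  rw [Matrix.mul_apply, sum_ixX_add_sum_ixΛ] at h
  simp only [SpecialKahler.upperFrame, SpecialKahler.lowerFrame, Matrix.of_apply, Option.elim,
    T.N_ixΛ_ixX hz, T.L_Λ z hz, zero_mul, mul_zero, Finset.sum_const_zero, add_zero] at h
  exact (mul_eq_zero.1 h.symm).resolve_left (T.exp_ne_zero z)

/-- `∂_I X^Λ` on `M_R`. -/
def dX (z : C → ℂ) : Matrix V (C ⊕ V) ℂ := Matrix.of fun v a => wd a (S.X (ixΛ v)) (T.ι z)

/-- `∂_I F_Λ` on `M_R`. -/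
def dF (z : C → ℂ) : Matrix V (C ⊕ V) ℂ := Matrix.of fun v a => wd a (S.F (ixΛ v)) (T.ι z)

/-- `𝒩̄_{ΛΣ}` on `M_R`. -/
def conjN (z : C → ℂ) : Matrix V V ℂ :=
  Matrix.of fun v w => conj (S.N (T.ι z) (ixΛ v) (ixΛ w))

theorem f_ixΛ (hz : z ∈ T.Z) (a : C ⊕ V) (v : V) :
    S.f a (ixΛ v) (T.ι z) = Real.exp (S.K (T.ι z) / 2) * T.dX z v a := by
  rw [S.f_eq (T.mem_dom hz), T.X_ixΛ hz, mul_zero, add_zero, dX, Matrix.of_apply]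

/-- Conjugate h̄ = 𝒩 f̄ on the Λ rows. As X^Λ = F_Λ = 0 the connection terms disappear, and the
common factor e^{K/2} cancels, leaving holomorphic matrices. -/
theorem conjN_mul_dX (hz : z ∈ T.Z) : T.conjN z * T.dX z = T.dF z := by
  ext v a
  have h := congrArg conj
    (congrFun (congrFun (S.N_mul_upperFrame (T.mem_dom hz)) (ixΛ v)) (some a))
  rw [Matrix.mul_apply, sum_ixX_add_sum_ixΛ] at h
  simp only [SpecialKahler.upperFrame, SpecialKahler.lowerFrame, Matrix.of_apply, Option.elim,
    T.N_ixΛ_ixX hz, zero_mul, Finset.sum_const_zero, zero_add, map_sum, map_mul,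
    Complex.conj_conj, T.f_ixΛ hz, S.h_eq (T.mem_dom hz), T.F_ixΛ hz, mul_zero, add_zero] at h
  refine mul_left_cancel₀ (T.exp_ne_zero z) ?_
  rw [dF, Matrix.of_apply, ← h, Matrix.mul_apply, Finset.mul_sum]
  refine Finset.sum_congr rfl fun w _ => ?_
  rw [conjN, Matrix.of_apply]
  ring

/-- The Λ rows of the invertible frame (L, f̄) have zero first entry, so f̄^Λ alone has full row
rank. -/
theorem exists_dX_mul_eq_one (hz : z ∈ T.Z) : ∃ R : Matrix (C ⊕ V) V ℂ, T.dX z * R = 1 := by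
  obtain ⟨G, hG⟩ := (S.isUnit_upperFrame (T.mem_dom hz)).exists_right_inv
  refine ⟨Matrix.of fun a w => Real.exp (S.K (T.ι z) / 2) * conj (G (some a) (ixΛ w)), ?_⟩
  ext v w
  have h := congrArg conj (congrFun (congrFun hG (ixΛ v)) (ixΛ w))
  rw [Matrix.mul_apply, Fintype.sum_option] at h
  simp only [SpecialKahler.upperFrame, Matrix.of_apply, Option.elim, T.L_Λ z hz, zero_mul,
    zero_add, map_sum, map_mul, Complex.conj_conj, T.f_ixΛ hz] at h
  have h1 : conj ((1 : Matrix (Option (C ⊕ V)) (Option (C ⊕ V)) ℂ) (ixΛ v) (ixΛ w))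
      = (1 : Matrix V V ℂ) v w := by
    simp [Matrix.one_apply, ixΛ_injective.eq_iff, apply_ite conj]
  rw [← h1, ← h, Matrix.mul_apply]
  refine Finset.sum_congr rfl fun a _ => ?_
  rw [Matrix.of_apply]
  ring

theorem differentiableAt_conjN (hz : z ∈ T.Z) (v w : V) :
    DifferentiableAt ℂ (fun y => T.conjN y v w) z := by
  -- R is frozen at z. Nearby ∂X R stays invertible, and 𝒩̄ = (∂F R)(∂X R)⁻¹ is a quotient of
  -- holomorphic matrices.
  obtain ⟨R, hR⟩ := T.exists_dX_mul_eq_one hz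
  have hX : ∀ v a, DifferentiableAt ℂ (fun y => T.dX y v a) z := fun v a =>
    (S.differentiableAt_wd_X (T.mem_dom hz) _ _).comp z (T.differentiableAt_ι hz)
  have hF : ∀ v a, DifferentiableAt ℂ (fun y => T.dF y v a) z := fun v a =>
    (S.differentiableAt_wd_F (T.mem_dom hz) _ _).comp z (T.differentiableAt_ι hz)
  have hXR : ∀ v w, DifferentiableAt ℂ (fun y => (T.dX y * R) v w) z := fun v w => by
    simp only [Matrix.mul_apply]
    exact DifferentiableAt.fun_sum fun a _ => (hX v a).mul_const _
  have hFR : ∀ v w, DifferentiableAt ℂ (fun y => (T.dF y * R) v w) z := fun v w => by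
    simp only [Matrix.mul_apply]
    exact DifferentiableAt.fun_sum fun a _ => (hF v a).mul_const _
  have hdet : (T.dX z * R).det ≠ 0 := by rw [hR, Matrix.det_one]; exact one_ne_zero
  have hev : ∀ᶠ y in 𝓝 z, (T.dX y * R).det ≠ 0 :=
    (DifferentiableAt.matrix_det hXR).continuousAt.eventually_ne hdet
  have heq : (fun y => T.conjN y v w) =ᶠ[𝓝 z] fun y => ((T.dF y * R) * (T.dX y * R)⁻¹) v w := by
    filter_upwards [hev, T.isOpen_Z.mem_nhds hz] with y hy hyZ
    rw [← T.conjN_mul_dX hyZ, Matrix.mul_assoc (T.conjN y), Matrix.mul_nonsing_inv_cancel_right _ _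
      (isUnit_iff_ne_zero.2 hy)]
  refine DifferentiableAt.congr_of_eventuallyEq ?_ heq
  simp only [Matrix.mul_apply (M := T.dF _ * R)]
  exact DifferentiableAt.fun_sum fun k _ => (hFR v k).fun_mul (.matrix_inv hXR hdet k w)

end Truncation


/-! ### Quaternionic vielbein: independent components and the span of the curvature -/

theorem crossProduct_apply_add (a b : Fin 3 → ℝ) (x : Fin 3) :
    crossProduct a b x = a (x + 1) * b (x + 2) - a (x + 2) * b (x + 1) := by
  fin_cases x <;> simp [cross_apply]

namespace QuaternionicKahler

variable {H : Type*} [Fintype H] [DecidableEq H] (Q : QuaternionicKahler H) {q : HyperSpace H}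

/-- The reality condition eliminates the dotted components; U^{1I} and U^{2I} remain as independent
complex coordinates on the tangent space. -/
theorem U_one_inr (hq : q ∈ Q.dom) (I : H) (v : HyperSpace H) :
    Q.U 1 (Sum.inr I) q v = conj (Q.U 0 (Sum.inl I) q v) := by
  simp [Q.reality q hq, Fin.sum_univ_two, epsSU2, sympC, Matrix.one_apply]

theorem U_zero_inr (hq : q ∈ Q.dom) (I : H) (v : HyperSpace H) :
    Q.U 0 (Sum.inr I) q v = -conj (Q.U 1 (Sum.inl I) q v) := by
  simp [Q.reality q hq, Fin.sum_univ_two, epsSU2, sympC, Matrix.one_apply]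

theorem h_eq (hq : q ∈ Q.dom) (v w : HyperSpace H) : Q.h q v w = ∑ I,
    (Q.U 0 (Sum.inl I) q v * conj (Q.U 0 (Sum.inl I) q w)
      + conj (Q.U 0 (Sum.inl I) q v) * Q.U 0 (Sum.inl I) q w
      + (Q.U 1 (Sum.inl I) q v * conj (Q.U 1 (Sum.inl I) q w)
      + conj (Q.U 1 (Sum.inl I) q v) * Q.U 1 (Sum.inl I) q w)) := by
  simp only [h, Fin.sum_univ_two, Fintype.sum_sum_type, sympC, epsSU2, Q.U_one_inr hq,
    Q.U_zero_inr hq]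
  simp [Matrix.one_apply, Finset.sum_add_distrib]
  ring

theorem sum_sympC_mul (g : H ⊕ H → H ⊕ H → ℂ) : ∑ α, ∑ β, sympC H α β * g α β
    = ∑ I, (g (Sum.inl I) (Sum.inr I) - g (Sum.inr I) (Sum.inl I)) := by
  simp [Fintype.sum_sum_type, sympC, Matrix.one_apply, Finset.sum_add_distrib, sub_eq_add_neg,
    add_comm]

theorem hyperForm_eq (x : Fin 3) (q v w : HyperSpace H) : hyperForm Q.U x q v w
    = ∑ I, ∑ A, ∑ B, -Complex.I * pauliLow x A B *
      ((Q.U A (Sum.inl I) q v * Q.U B (Sum.inr I) q w - Q.U A (Sum.inl I) q w * Q.U B (Sum.inr I) q v)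
      - (Q.U A (Sum.inr I) q v * Q.U B (Sum.inl I) q w
        - Q.U A (Sum.inr I) q w * Q.U B (Sum.inl I) q v)) := by
  simp only [hyperForm, mul_assoc, sum_sympC_mul]
  simp only [← mul_sub, ← Finset.mul_sum, Fin.sum_univ_two, Finset.sum_add_distrib]
  ring

theorem ofReal_Ω (hq : q ∈ Q.dom) (x : Fin 3) (v w : HyperSpace H) :
    (Q.Ω x q v w : ℂ) = hyperForm Q.U x q v w := Q.curvature q hq x v w

theorem Ω_two (hq : q ∈ Q.dom) (v w : HyperSpace H) : (Q.Ω 2 q v w : ℂ) = 2 * Complex.I * ∑ I,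
    (Q.U 0 (Sum.inl I) q v * conj (Q.U 0 (Sum.inl I) q w)
      - conj (Q.U 0 (Sum.inl I) q v) * Q.U 0 (Sum.inl I) q w
      + (conj (Q.U 1 (Sum.inl I) q v) * Q.U 1 (Sum.inl I) q w
      - Q.U 1 (Sum.inl I) q v * conj (Q.U 1 (Sum.inl I) q w))) := by
  rw [Q.ofReal_Ω hq]
  rw [hyperForm_eq, Finset.mul_sum]
  refine Finset.sum_congr rfl fun I _ => ?_
  simp [Fin.sum_univ_two, pauliLow, pauli, epsSU2, Matrix.mul_apply, Q.U_one_inr hq,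
    Q.U_zero_inr hq]
  ring

/-- The combination that drives the derivative of P¹ - i P². It pairs U² with the conjugate of U¹,
that is, normal with tangent directions of M^KH. -/
theorem Ω_zero_sub (hq : q ∈ Q.dom) (v w : HyperSpace H) :
    (Q.Ω 0 q v w : ℂ) - Complex.I * Q.Ω 1 q v w = 4 * Complex.I * ∑ I,
    (Q.U 1 (Sum.inl I) q v * conj (Q.U 0 (Sum.inl I) q w)
      - conj (Q.U 0 (Sum.inl I) q v) * Q.U 1 (Sum.inl I) q w) := by
  rw [Q.ofReal_Ω hq, Q.ofReal_Ω hq]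
  rw [hyperForm_eq, hyperForm_eq, Finset.mul_sum, Finset.mul_sum, ← Finset.sum_sub_distrib]
  refine Finset.sum_congr rfl fun I _ => ?_
  simp [Fin.sum_univ_two, pauliLow, pauli, epsSU2, Matrix.mul_apply, Q.U_one_inr hq,
    Q.U_zero_inr hq]
  ring

/-- The independent components of the vielbein take arbitrary values. -/
theorem exists_U_eq (hq : q ∈ Q.dom) (φ : Fin 2 → H → ℂ) :
    ∃ v, ∀ A I, Q.U A (Sum.inl I) q v = φ A I := by
  let Φ : HyperSpace H →ₗ[ℝ] (Fin 2 → H → ℂ) :=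
    LinearMap.pi fun A => LinearMap.pi fun I => (Q.U A (Sum.inl I) q : HyperSpace H →ₗ[ℝ] ℂ)
  have hΦ : ∀ v A I, Φ v A I = Q.U A (Sum.inl I) q v := fun _ _ _ => rfl
  have hinj : Function.Injective Φ := by
    refine (injective_iff_map_eq_zero Φ).2 fun v hv => Q.nondegenerate q hq v ?_
    have h0 : ∀ A I, Q.U A (Sum.inl I) q v = 0 := fun A I => by rw [← hΦ, hv]; rfl
    rintro A (I | I)
    · exact h0 A I
    · fin_cases A
      · simp [Q.U_zero_inr hq, h0]
      · simp [Q.U_one_inr hq, h0]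
  -- Both sides have real dimension 4 n_H, so injectivity gives surjectivity.
  have hrank : Module.finrank ℝ (HyperSpace H) = Module.finrank ℝ (Fin 2 → H → ℂ) := by
    simp [Module.finrank_pi_fintype, Complex.finrank_real_complex]
    ring
  obtain ⟨v, hv⟩ := (LinearMap.injective_iff_surjective_of_finrank_eq_finrank hrank).1 hinj φ
  exact ⟨v, fun A I => by rw [← hΦ, hv]⟩

/-- The `SU(2)` curvature spans `su(2)`. -/
theorem eq_zero_of_crossProduct_Ω [Nonempty H] (hq : q ∈ Q.dom) {E : Fin 3 → ℝ}
    (hE : ∀ v w x, crossProduct (fun y => Q.Ω y q v w) E x = 0) : E = 0 := by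
  obtain ⟨I₀⟩ := ‹Nonempty H›
  -- With a along U² and b along U¹, Ω(a, b) lies in the plane of the first two components. Taking t
  -- = 1 and t = i gives two independent curvature vectors; a vector parallel to both is zero.
  obtain ⟨a, ha⟩ := Q.exists_U_eq hq ![0, Pi.single I₀ 1]
  have key : ∀ t : ℂ, ∃ b, (Q.Ω 0 q a b : ℂ) - Complex.I * Q.Ω 1 q a b = 4 * Complex.I * conj t
      ∧ Q.Ω 2 q a b = 0 := by
    intro t
    obtain ⟨b, hb⟩ := Q.exists_U_eq hq ![Pi.single I₀ t, 0]
    refine ⟨b, ?_, ?_⟩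
    · rw [Q.Ω_zero_sub hq]
      simp [ha, hb, Pi.single_apply, apply_ite conj]
    · have := Q.Ω_two hq a b
      simpa [ha, hb] using this
  obtain ⟨b, hb, hb2⟩ := key 1
  obtain ⟨b', hb', hb2'⟩ := key Complex.I
  have e0 : Q.Ω 0 q a b = 0 := by simpa using congrArg Complex.re hb
  have e1 : Q.Ω 1 q a b = -4 := by
    have := congrArg Complex.im hb
    simp at this
    linarith
  have e0' : Q.Ω 0 q a b' = 4 := by simpa using congrArg Complex.re hb'
  have e1' : Q.Ω 1 q a b' = 0 := by simpa using congrArg Complex.im hb'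
  have r0 := hE a b 2
  have r1 := hE a b' 1
  have r2 := hE a b' 2
  simp [cross_apply, e0, e1, hb2] at r0
  simp [cross_apply, e0', hb2'] at r1
  simp [cross_apply, e0', e1'] at r2
  ext x
  fin_cases x
  · exact r0
  · exact r2
  · exact r1

end QuaternionicKahler


/-! ### SU(2) curvature: Bianchi identity and square of the covariant derivative -/

namespace QuaternionicKahler

open Filter
open scoped Topology

variable {H : Type*} [Fintype H] [DecidableEq H] (Q : QuaternionicKahler H) {q : HyperSpace H}

theorem contDiffAt_om (hq : q ∈ Q.dom) (x : Fin 3) : ContDiffAt ℝ ∞ (Q.om x) q :=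
  (Q.smooth_om x).contDiffAt (Q.isOpen_dom.mem_nhds hq)

theorem differentiableAt_om (hq : q ∈ Q.dom) (x : Fin 3) : DifferentiableAt ℝ (Q.om x) q :=
  (Q.contDiffAt_om hq x).differentiableAt (by simp)

theorem Ω_apply (x : Fin 3) (q v w : HyperSpace H) : Q.Ω x q v w
    = fderiv ℝ (Q.om x) q v w - fderiv ℝ (Q.om x) q w v
      + (Q.om (x + 1) q v * Q.om (x + 2) q w - Q.om (x + 2) q v * Q.om (x + 1) q w) := by
  rw [Ω, dOneForm, crossProduct_apply_add]

theorem Ω_swap (x : Fin 3) (q v w : HyperSpace H) : Q.Ω x q v w = -Q.Ω x q w v := by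
  rw [Ω_apply, Ω_apply]; ring

/-- The derivative of the components of `Ω^x` in the direction `u`. -/
def dΩ (x : Fin 3) (q u v w : HyperSpace H) : ℝ :=
  fderiv ℝ (fderiv ℝ (Q.om x)) q u v w - fderiv ℝ (fderiv ℝ (Q.om x)) q u w v
    + (fderiv ℝ (Q.om (x + 1)) q u v * Q.om (x + 2) q w
      + Q.om (x + 1) q v * fderiv ℝ (Q.om (x + 2)) q u w
      - fderiv ℝ (Q.om (x + 2)) q u v * Q.om (x + 1) q w
      - Q.om (x + 2) q v * fderiv ℝ (Q.om (x + 1)) q u w)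

theorem contDiffAt_Ω (hq : q ∈ Q.dom) (x : Fin 3) {k l : HyperSpace H → HyperSpace H}
    (hk : ContDiffAt ℝ ∞ k q) (hl : ContDiffAt ℝ ∞ l q) :
    ContDiffAt ℝ ∞ (fun q => Q.Ω x q (k q) (l q)) q := by
  simp only [Ω_apply]
  have hd : ContDiffAt ℝ ∞ (fderiv ℝ (Q.om x)) q :=
    (Q.contDiffAt_om hq x).fderiv_right (by simp)
  have ho := fun x => Q.contDiffAt_om hq x
  exact (((hd.clm_apply hk).clm_apply hl).sub ((hd.clm_apply hl).clm_apply hk)).add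
    ((((ho _).clm_apply hk).mul ((ho _).clm_apply hl)).sub
      (((ho _).clm_apply hk).mul ((ho _).clm_apply hl)))

theorem fderiv_Ω (hq : q ∈ Q.dom) (x : Fin 3) {k l : HyperSpace H → HyperSpace H}
    (hk : DifferentiableAt ℝ k q) (hl : DifferentiableAt ℝ l q) (u : HyperSpace H) :
    fderiv ℝ (fun q => Q.Ω x q (k q) (l q)) q u = Q.dΩ x q u (k q) (l q)
      + Q.Ω x q (fderiv ℝ k q u) (l q) + Q.Ω x q (k q) (fderiv ℝ l q u) := by
  have hd : DifferentiableAt ℝ (fderiv ℝ (Q.om x)) q :=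
    (((Q.contDiffAt_om hq x).of_le (by norm_cast : (2 : ℕ∞ω) ≤ ∞)).fderiv_right (m := 1)
      (by norm_num)).differentiableAt one_ne_zero
  have ho := fun x => (Q.differentiableAt_om hq x).hasFDerivAt
  have hk' := hk.hasFDerivAt
  have hl' := hl.hasFDerivAt
  have h := (((hd.hasFDerivAt.clm_apply hk').clm_apply hl').fun_sub
    ((hd.hasFDerivAt.clm_apply hl').clm_apply hk')).fun_add
    ((((ho (x + 1)).clm_apply hk').fun_mul ((ho (x + 2)).clm_apply hl')).fun_sub
      (((ho (x + 2)).clm_apply hk').fun_mul ((ho (x + 1)).clm_apply hl')))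
  simp only [Ω_apply]
  rw [h.fderiv, dΩ]
  simp only [add_apply, sub_apply, smul_apply, ContinuousLinearMap.comp_apply,
    ContinuousLinearMap.flip_apply, smul_eq_mul]
  ring

/-- The second derivatives of ω cancel by symmetry, and the terms quadratic and cubic in ω cancel in
the cyclic sum. -/
theorem bianchi (hq : q ∈ Q.dom) (x : Fin 3) (a b c : HyperSpace H) :
    (Q.dΩ x q a b c + crossProduct (fun y => Q.om y q a) (fun y => Q.Ω y q b c) x)
    + (Q.dΩ x q b c a + crossProduct (fun y => Q.om y q b) (fun y => Q.Ω y q c a) x)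
    + (Q.dΩ x q c a b + crossProduct (fun y => Q.om y q c) (fun y => Q.Ω y q a b) x) = 0 := by
  have hs : ∀ u v w, fderiv ℝ (fderiv ℝ (Q.om x)) q u v w = fderiv ℝ (fderiv ℝ (Q.om x)) q v u w :=
    fun u v w => by
      rw [((Q.contDiffAt_om hq x).isSymmSndFDerivAt (by simp; norm_cast)).eq u v]
  simp only [crossProduct_apply_add, dΩ, Ω_apply]
  -- Component indices are taken modulo 3, so one computation covers all three values of x.
  have e1 : x + 1 + 1 = x + 2 := by fin_cases x <;> rfl
  have e2 : x + 1 + 2 = x := by fin_cases x <;> rfl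
  have e3 : x + 2 + 1 = x := by fin_cases x <;> rfl
  have e4 : x + 2 + 2 = x + 1 := by fin_cases x <;> rfl
  rw [e1, e2, e3, e4, hs a b c, hs a c b, hs b c a]
  ring

/-- The square of the covariant exterior derivative is the curvature: if `D F = α`, then
`D α = Ω × F`. -/
theorem covariant_derivative_sq (hq : q ∈ Q.dom) {F : Fin 3 → HyperSpace H → ℝ}
    {α : Fin 3 → HyperSpace H → HyperSpace H → ℝ} (hF : ∀ x, ContDiffAt ℝ 2 (F x) q)
    (hα : ∀ p ∈ Q.dom, ∀ x v,
      fderiv ℝ (F x) p v + crossProduct (fun y => Q.om y p v) (fun y => F y p) x = α x p v)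
    (x : Fin 3) (v w : HyperSpace H) :
    (fderiv ℝ (fun p => α x p w) q v + crossProduct (fun y => Q.om y q v) (fun y => α y q w) x)
    - (fderiv ℝ (fun p => α x p v) q w + crossProduct (fun y => Q.om y q w) (fun y => α y q v) x)
      = crossProduct (fun y => Q.Ω y q v w) (fun y => F y q) x := by
  have hFd : ∀ x, HasFDerivAt (F x) (fderiv ℝ (F x) q) q := fun x =>
    ((hF x).differentiableAt two_ne_zero).hasFDerivAt
  have ho := fun x => (Q.differentiableAt_om hq x).hasFDerivAt
  have hd : ∀ v w, fderiv ℝ (fun p => α x p w) q v = fderiv ℝ (fderiv ℝ (F x)) q v w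
      + (fderiv ℝ (Q.om (x + 1)) q v w * F (x + 2) q + Q.om (x + 1) q w * fderiv ℝ (F (x + 2)) q v
      - (fderiv ℝ (Q.om (x + 2)) q v w * F (x + 1) q
        + Q.om (x + 2) q w * fderiv ℝ (F (x + 1)) q v)) := by
    intro v w
    have heq : (fun p => α x p w) =ᶠ[𝓝 q] fun p => fderiv ℝ (F x) p w
        + (Q.om (x + 1) p w * F (x + 2) p - Q.om (x + 2) p w * F (x + 1) p) := by
      filter_upwards [Q.isOpen_dom.mem_nhds hq] with p hp
      rw [← hα p hp, crossProduct_apply_add]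
    have h := ((hF x).fderiv_apply_const w).fun_add
      ((((ho (x + 1)).clm_apply (hasFDerivAt_const w q)).fun_mul (hFd (x + 2))).fun_sub
      (((ho (x + 2)).clm_apply (hasFDerivAt_const w q)).fun_mul (hFd (x + 1))))
    rw [heq.fderiv_eq, h.fderiv]
    simp only [add_apply, sub_apply, smul_apply, ContinuousLinearMap.comp_apply,
      ContinuousLinearMap.flip_apply, zero_apply, map_zero, smul_eq_mul]
    ring
  have hs : fderiv ℝ (fderiv ℝ (F x)) q v w = fderiv ℝ (fderiv ℝ (F x)) q w v :=
    (hF x).isSymmSndFDerivAt (by simp) v w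
  rw [hd v w, hd w v, hs]
  simp only [← hα q hq, crossProduct_apply_add, Ω_apply]
  have e1 : x + 1 + 1 = x + 2 := by fin_cases x <;> rfl
  have e2 : x + 1 + 2 = x := by fin_cases x <;> rfl
  have e3 : x + 2 + 1 = x := by fin_cases x <;> rfl
  have e4 : x + 2 + 2 = x + 1 := by fin_cases x <;> rfl
  rw [e1, e2, e3, e4]
  ring

end QuaternionicKahler

/-! ### Equivariance of the quaternionic prepotentials -/

namespace HyperGauging

open Filter
open scoped Topology

variable {H G : Type*} [Fintype H] [DecidableEq H] [Fintype G] {Q : QuaternionicKahler H}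
  {𝔤 : StructureConstants G} (Y : HyperGauging Q 𝔤) {q : HyperSpace H}

theorem contDiffAt_k (hq : q ∈ Q.dom) (Λ : G) : ContDiffAt ℝ ∞ (Y.k Λ) q :=
  (Y.smooth_k Λ).contDiffAt (Q.isOpen_dom.mem_nhds hq)

theorem contDiffAt_P (hq : q ∈ Q.dom) (Λ : G) (x : Fin 3) : ContDiffAt ℝ ∞ (Y.P Λ x) q :=
  (Y.smooth_P Λ x).contDiffAt (Q.isOpen_dom.mem_nhds hq)

theorem differentiableAt_k (hq : q ∈ Q.dom) (Λ : G) : DifferentiableAt ℝ (Y.k Λ) q :=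
  (Y.contDiffAt_k hq Λ).differentiableAt (by simp)

theorem differentiableAt_P (hq : q ∈ Q.dom) (Λ : G) (x : Fin 3) :
    DifferentiableAt ℝ (Y.P Λ x) q :=
  (Y.contDiffAt_P hq Λ x).differentiableAt (by simp)

/-- The covariant Lie derivative of `Ω` along `k_Λ` is the rotation by `P_Λ`. -/
theorem lie_Ω (hq : q ∈ Q.dom) (Λ : G) (x : Fin 3) (a b : HyperSpace H) :
    (Q.dΩ x q (Y.k Λ q) a b + crossProduct (fun y => Q.om y q (Y.k Λ q)) (fun y => Q.Ω y q a b) x)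
      + Q.Ω x q (fderiv ℝ (Y.k Λ) q a) b + Q.Ω x q a (fderiv ℝ (Y.k Λ) q b)
      = crossProduct (fun y => Q.Ω y q a b) (fun y => Y.P Λ y q) x := by
  -- Applying D to D P = Ω(k, ·) gives D(ι_k Ω) = Ω × P; by the Bianchi identity D(ι_k Ω) is the
  -- covariant Lie derivative of Ω.
  have h := Q.covariant_derivative_sq hq (F := Y.P Λ) (α := fun x p v => Q.Ω x p (Y.k Λ p) v)
    (fun x => (Y.contDiffAt_P hq Λ x).of_le (by norm_cast)) (fun p hp x v => Y.moment p hp Λ x v)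
    x a b
  rw [Q.fderiv_Ω hq x (Y.differentiableAt_k hq Λ) (differentiableAt_const b),
    Q.fderiv_Ω hq x (Y.differentiableAt_k hq Λ) (differentiableAt_const a)] at h
  have hB := Q.bianchi hq x (Y.k Λ q) a b
  have h0 : ∀ v, Q.Ω x q v 0 = 0 := fun v => by simp [QuaternionicKahler.Ω_apply]
  simp only [fderiv_fun_const, Pi.zero_apply, zero_apply, h0] at h
  have hdΩ : ∀ u v w, Q.dΩ x q u v w = -Q.dΩ x q u w v := fun u v w => by
    simp only [QuaternionicKahler.dΩ]; ring
  rw [← h, hdΩ a (Y.k Λ q) b, Q.Ω_swap x q a]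
  simp only [crossProduct_apply_add] at hB ⊢
  rw [Q.Ω_swap (x + 1) q (Y.k Λ q) b, Q.Ω_swap (x + 2) q (Y.k Λ q) b]
  linear_combination hB

/-- The failure of the prepotentials to be equivariant. -/
def obstruction (Λ Ξ : G) (x : Fin 3) (q : HyperSpace H) : ℝ :=
  ∑ Γ, 𝔤.c Λ Ξ Γ * Y.P Γ x q + Q.Ω x q (Y.k Λ q) (Y.k Ξ q)
    - crossProduct (fun y => Y.P Λ y q) (fun y => Y.P Ξ y q) x

theorem contDiffAt_obstruction (hq : q ∈ Q.dom) (Λ Ξ : G) (x : Fin 3) :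
    ContDiffAt ℝ ∞ (Y.obstruction Λ Ξ x) q := by
  have h : ContDiffAt ℝ ∞ (fun q => ∑ Γ, 𝔤.c Λ Ξ Γ * Y.P Γ x q + Q.Ω x q (Y.k Λ q) (Y.k Ξ q)
      - (Y.P Λ (x + 1) q * Y.P Ξ (x + 2) q - Y.P Λ (x + 2) q * Y.P Ξ (x + 1) q)) q :=
    ((ContDiffAt.sum fun Γ _ => contDiffAt_const.mul (Y.contDiffAt_P hq Γ x)).add
      (Q.contDiffAt_Ω hq x (Y.contDiffAt_k hq Λ) (Y.contDiffAt_k hq Ξ))).sub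
      (((Y.contDiffAt_P hq _ _).mul (Y.contDiffAt_P hq _ _)).sub
        ((Y.contDiffAt_P hq _ _).mul (Y.contDiffAt_P hq _ _)))
  refine h.congr_of_eventuallyEq (Eventually.of_forall fun p => ?_)
  rw [obstruction, crossProduct_apply_add]

/-- The moment map equation removes dP, and the bracket relation replaces the structure constants by
derivatives of the fields k. What remains is the sum of two cases of `lie_Ω` and one Bianchi
identity. -/
theorem fderiv_obstruction (hq : q ∈ Q.dom) (Λ Ξ : G) (x : Fin 3) (v : HyperSpace H) :
    fderiv ℝ (Y.obstruction Λ Ξ x) q v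
      + crossProduct (fun y => Q.om y q v) (fun y => Y.obstruction Λ Ξ y q) x = 0 := by
  have hk := Y.differentiableAt_k hq
  have hP := fun Γ x => (Y.differentiableAt_P hq Γ x).hasFDerivAt
  have hΩ : DifferentiableAt ℝ (fun q => Q.Ω x q (Y.k Λ q) (Y.k Ξ q)) q :=
    (Q.contDiffAt_Ω hq x (Y.contDiffAt_k hq Λ) (Y.contDiffAt_k hq Ξ)).differentiableAt (by simp)
  have hd : fderiv ℝ (Y.obstruction Λ Ξ x) q v
      = ∑ Γ, 𝔤.c Λ Ξ Γ * fderiv ℝ (Y.P Γ x) q v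
        + (Q.dΩ x q v (Y.k Λ q) (Y.k Ξ q) + Q.Ω x q (fderiv ℝ (Y.k Λ) q v) (Y.k Ξ q)
          + Q.Ω x q (Y.k Λ q) (fderiv ℝ (Y.k Ξ) q v))
        - (Y.P Λ (x + 1) q * fderiv ℝ (Y.P Ξ (x + 2)) q v
            + fderiv ℝ (Y.P Λ (x + 1)) q v * Y.P Ξ (x + 2) q
          - (Y.P Λ (x + 2) q * fderiv ℝ (Y.P Ξ (x + 1)) q v
            + fderiv ℝ (Y.P Λ (x + 2)) q v * Y.P Ξ (x + 1) q)) := by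
    have h := (((HasFDerivAt.fun_sum fun Γ (_ : Γ ∈ Finset.univ) =>
      (hP Γ x).const_mul (𝔤.c Λ Ξ Γ)).fun_add hΩ.hasFDerivAt).fun_sub
        (((hP Λ (x + 1)).fun_mul (hP Ξ (x + 2))).fun_sub
          ((hP Λ (x + 2)).fun_mul (hP Ξ (x + 1)))))
    have heq : Y.obstruction Λ Ξ x = fun q => ∑ Γ, 𝔤.c Λ Ξ Γ * Y.P Γ x q
        + Q.Ω x q (Y.k Λ q) (Y.k Ξ q)
        - (Y.P Λ (x + 1) q * Y.P Ξ (x + 2) q - Y.P Λ (x + 2) q * Y.P Ξ (x + 1) q) := by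
      ext p; rw [obstruction, crossProduct_apply_add]
    rw [heq, h.fderiv, ← Q.fderiv_Ω hq x (hk Λ) (hk Ξ)]
    simp only [add_apply, sub_apply, smul_apply, sum_apply, smul_eq_mul]
    ring
  have hm : ∀ Γ x, fderiv ℝ (Y.P Γ x) q v = Q.Ω x q (Y.k Γ q) v
      - (Q.om (x + 1) q v * Y.P Γ (x + 2) q - Q.om (x + 2) q v * Y.P Γ (x + 1) q) := fun Γ x => by
    rw [← Y.moment q hq Γ x v, crossProduct_apply_add]; ring
  have hlie : ∑ Γ, 𝔤.c Λ Ξ Γ * Q.Ω x q (Y.k Γ q) v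
      = Q.Ω x q (fderiv ℝ (Y.k Ξ) q (Y.k Λ q)) v - Q.Ω x q (fderiv ℝ (Y.k Λ) q (Y.k Ξ q)) v := by
    have hb := Y.lie q hq Λ Ξ
    rw [VectorField.lieBracket] at hb
    have h1 : ∀ a b, Q.Ω x q (a - b) v = Q.Ω x q a v - Q.Ω x q b v := fun a b => by
      simp only [QuaternionicKahler.Ω_apply, map_sub, sub_apply]; ring
    have h2 : ∀ φ : G → HyperSpace H, ∀ c : G → ℝ,
        Q.Ω x q (∑ Γ, c Γ • φ Γ) v = ∑ Γ, c Γ * Q.Ω x q (φ Γ) v := fun φ c => by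
      simp only [QuaternionicKahler.Ω_apply, map_sum, map_smul, sum_apply, smul_apply, smul_eq_mul,
        mul_add, mul_sub, Finset.sum_add_distrib, Finset.sum_sub_distrib, Finset.sum_mul]
      simp only [mul_assoc]
    rw [← h1, hb, h2]
  have hL := Y.lie_Ω hq Λ x v (Y.k Ξ q)
  have hR := Y.lie_Ω hq Ξ x (Y.k Λ q) v
  have hB := Q.bianchi hq x v (Y.k Λ q) (Y.k Ξ q)
  have hdΩ : ∀ u v w, Q.dΩ x q u v w = -Q.dΩ x q u w v := fun u v w => by
    simp only [QuaternionicKahler.dΩ]; ring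
  have hs1 : ∑ Γ, 𝔤.c Λ Ξ Γ * fderiv ℝ (Y.P Γ x) q v = ∑ Γ, 𝔤.c Λ Ξ Γ * Q.Ω x q (Y.k Γ q) v
      - (Q.om (x + 1) q v * ∑ Γ, 𝔤.c Λ Ξ Γ * Y.P Γ (x + 2) q
        - Q.om (x + 2) q v * ∑ Γ, 𝔤.c Λ Ξ Γ * Y.P Γ (x + 1) q) := by
    simp only [Finset.mul_sum, ← Finset.sum_sub_distrib]
    exact Finset.sum_congr rfl fun Γ _ => by rw [hm]; ring
  rw [hd, hs1, hlie]
  simp only [hm]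
  simp only [crossProduct_apply_add, obstruction] at hL hR hB ⊢
  have e1 : x + 1 + 1 = x + 2 := by fin_cases x <;> rfl
  have e2 : x + 1 + 2 = x := by fin_cases x <;> rfl
  have e3 : x + 2 + 1 = x := by fin_cases x <;> rfl
  have e4 : x + 2 + 2 = x + 1 := by fin_cases x <;> rfl
  rw [hdΩ (Y.k Ξ q) v] at hB
  rw [hdΩ (Y.k Λ q) (Y.k Ξ q)] at hB
  simp only [e1, e2, e3, e4, fun y => Q.Ω_swap y q v] at hL hR hB ⊢
  linear_combination hL + hR + hB

/-- Equivariance of the prepotentials,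
`ε^{xyz} P^y_Λ P^z_Σ = f_{ΛΣ}{}^Γ P^x_Γ + Ω^x(k_Λ, k_Σ)`. -/
theorem equivariance (hq : q ∈ Q.dom) (Λ Ξ : G) (x : Fin 3) :
    crossProduct (fun y => Y.P Λ y q) (fun y => Y.P Ξ y q) x
      = ∑ Γ, 𝔤.c Λ Ξ Γ * Y.P Γ x q + Q.Ω x q (Y.k Λ q) (Y.k Ξ q) := by
  -- Without hypermultiplets the coordinate space is a point and the curvature cannot detect the
  -- defect, so the Fayet-Iliopoulos constraint is used.
  rcases isEmpty_or_nonempty H with hH | hH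
  · have h0 : Y.k Λ q = 0 := Subsingleton.elim _ _
    rw [Y.fayetIliopoulos hH q hq, h0]
    simp [QuaternionicKahler.Ω_apply]
  -- A covariantly constant triplet E satisfies Ω × E = 0, and the curvature spans su(2).
  · have h := fun v w x => Q.covariant_derivative_sq hq (F := Y.obstruction Λ Ξ)
      (α := fun _ _ _ => 0)
      (fun x => (Y.contDiffAt_obstruction hq Λ Ξ x).of_le (by norm_cast))
      (fun p hp x v => Y.fderiv_obstruction hp Λ Ξ x v) x v w
    have hE : (fun y => Y.obstruction Λ Ξ y q) = 0 := by
      refine Q.eq_zero_of_crossProduct_Ω hq fun v w x => ?_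
      rw [← h v w x]
      simp [crossProduct_apply_add]
    have := congrFun hE x
    simp only [obstruction, Pi.zero_apply] at this
    linarith

end HyperGauging


/-! ### Geometry of M^KH: normal fields, charges and the connection ω³ -/

namespace Truncation

open Filter
open scoped Topology

variable {C V H : Type*} [Fintype C] [DecidableEq C] [Fintype V] [DecidableEq V]
  [Fintype H] [DecidableEq H]
  {S : SpecialKahler (C ⊕ V)} {Q : QuaternionicKahler H}
  {𝔤 : StructureConstants (Option (C ⊕ V))} {VG : VectorGauging S 𝔤} {HG : HyperGauging Q 𝔤}
  (T : Truncation S Q VG HG) {w : H → ℂ}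

theorem mem_hyper_dom (hw : w ∈ T.W) : T.j w ∈ Q.dom := T.mapsTo_j hw

theorem contDiffAt_j (hw : w ∈ T.W) : ContDiffAt ℝ ∞ T.j w :=
  T.smooth_j.contDiffAt (T.isOpen_W.mem_nhds hw)

theorem differentiableAt_j (hw : w ∈ T.W) : DifferentiableAt ℝ T.j w :=
  (T.contDiffAt_j hw).differentiableAt (by simp)

/-- The matrix `U^{1I}_s̄` of the vielbein of `M^KH`. -/
def vielbein (w : H → ℂ) : Matrix H H ℂ :=
  Matrix.of fun I s => Q.U 0 (Sum.inl I) (T.j w) (T.tang w s 1)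

theorem U_zero_tang_I (hw : w ∈ T.W) (I s : H) :
    Q.U 0 (Sum.inl I) (T.j w) (T.tang w s Complex.I) = -Complex.I * T.vielbein w I s := by
  rw [tang, single_I, T.U_one w hw]
  rfl

theorem U_zero_fderiv_j (hw : w ∈ T.W) (I : H) (t : H → ℂ) :
    Q.U 0 (Sum.inl I) (T.j w) (fderiv ℝ T.j w t) = ∑ s, T.vielbein w I s * conj (t s) := by
  have h := clm_apply_eq_sum ((Q.U 0 (Sum.inl I) (T.j w)).comp (fderiv ℝ T.j w)) t
  simp only [ContinuousLinearMap.comp_apply] at h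
  rw [h]
  refine Finset.sum_congr rfl fun s _ => ?_
  have h1 : Q.U 0 (Sum.inl I) (T.j w) (fderiv ℝ T.j w (Pi.single s Complex.I)) = _ :=
    T.U_zero_tang_I hw I s
  have h2 : Q.U 0 (Sum.inl I) (T.j w) (fderiv ℝ T.j w (Pi.single s 1)) = T.vielbein w I s := rfl
  rw [h1, h2]
  linear_combination (1 / 2 * T.vielbein w I s * (t s - conj (t s))) * Complex.I_mul_I

/-- A kernel vector yields a tangent vector on which every vielbein component vanishes;
nondegeneracy and the immersion property make it zero. The conjugate enters because U^{1I} is of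
type (0,1). -/
theorem isUnit_vielbein (hw : w ∈ T.W) : IsUnit (T.vielbein w) := by
  refine Matrix.mulVec_injective_iff_isUnit.1
    ((injective_iff_map_eq_zero (T.vielbein w).mulVecLin).2 fun x hx => ?_)
  have hx' : ∀ I, ∑ s, T.vielbein w I s * x s = 0 := fun I => congrFun hx I
  have h0 : ∀ A I, Q.U A (Sum.inl I) (T.j w) (fderiv ℝ T.j w fun s => conj (x s)) = 0 := by
    intro A I
    fin_cases A
    · simpa [T.U_zero_fderiv_j hw] using hx' I
    · exact T.U_two w hw I _
  have h1 : fderiv ℝ T.j w (fun s => conj (x s)) = 0 := by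
    refine Q.nondegenerate _ (T.mem_hyper_dom hw) _ ?_
    rintro A (I | I)
    · exact h0 A I
    · fin_cases A
      · simp [Q.U_zero_inr (T.mem_hyper_dom hw), h0]
      · simp [Q.U_one_inr (T.mem_hyper_dom hw), h0]
  have h2 := T.immersion_j w hw (h1.trans (map_zero _).symm)
  ext s
  simpa using congrFun h2 s

theorem gKH_eq (hw : w ∈ T.W) : T.gKH w = (2 : ℂ) • ((T.vielbein w)ᴴ * T.vielbein w) := by
  ext s t
  have h0 : ∀ I s u, Q.U 1 (Sum.inl I) (T.j w) (T.tang w s u) = 0 := fun I s u =>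
    T.U_two w hw I _
  have h1 : ∀ I s, Q.U 0 (Sum.inl I) (T.j w) (T.tang w s 1) = T.vielbein w I s := fun I s => rfl
  simp only [gKH, Matrix.of_apply, Q.h_eq (T.mem_hyper_dom hw), h0, h1, T.U_zero_tang_I hw,
    Matrix.smul_apply, Matrix.mul_apply, Matrix.conjTranspose_apply, smul_eq_mul,
    ← Finset.sum_add_distrib, ← Finset.sum_sub_distrib, Finset.mul_sum, Finset.sum_div]
  refine Finset.sum_congr rfl fun I _ => ?_
  simp only [map_mul, map_neg, Complex.conj_I, map_zero, RCLike.star_def]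
  ring_nf
  simp only [Complex.I_sq]
  ring

theorem gKH_posDef (hw : w ∈ T.W) : (T.gKH w).PosDef := by
  rw [T.gKH_eq hw]
  exact (Matrix.PosDef.conjTranspose_mul_self _
    (Matrix.mulVec_injective_iff_isUnit.2 (T.isUnit_vielbein hw))).smul (by norm_num)

/-- The vector fields `k_X` are normal to `M^KH`. -/
theorem U_zero_k (hw : w ∈ T.W) (x : Option C) (I : H) :
    Q.U 0 (Sum.inl I) (T.j w) (HG.k (ixX x) (T.j w)) = 0 := by
  -- A tangent vector with the same U^{1I} components as k_X. Since U^{2I} vanishes on it, its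
  -- product with k_X is 2 Σ |U^{1I}(k_X)|², and orthogonality makes this zero.
  obtain ⟨y, hy⟩ := Matrix.mulVec_surjective_iff_isUnit.2 (T.isUnit_vielbein hw)
    fun I => Q.U 0 (Sum.inl I) (T.j w) (HG.k (ixX x) (T.j w))
  have hy' : ∀ I, Q.U 0 (Sum.inl I) (T.j w) (fderiv ℝ T.j w fun s => conj (y s))
      = Q.U 0 (Sum.inl I) (T.j w) (HG.k (ixX x) (T.j w)) := fun I => by
    rw [← congrFun hy I, T.U_zero_fderiv_j hw]
    simp [Matrix.mulVec, dotProduct]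
  have h := T.k_X_hyper w hw x fun s => conj (y s)
  rw [Q.h_eq (T.mem_hyper_dom hw)] at h
  simp only [hy', T.U_two w hw, map_zero, mul_zero, add_zero, Complex.mul_conj,
    ← Complex.normSq_eq_conj_mul_self] at h
  have h2 : ∑ I, (Complex.normSq (Q.U 0 (Sum.inl I) (T.j w) (HG.k (ixX x) (T.j w)))
      + Complex.normSq (Q.U 0 (Sum.inl I) (T.j w) (HG.k (ixX x) (T.j w)))) = 0 := by
    exact_mod_cast h
  have h3 := (Finset.sum_eq_zero_iff_of_nonneg fun I _ =>
    add_nonneg (Complex.normSq_nonneg _) (Complex.normSq_nonneg _)).1 h2 I (Finset.mem_univ I)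
  rw [← Complex.normSq_eq_zero]
  linarith

/-- The normal components `U^{2I}(k_X)`. -/
def normal (w : H → ℂ) (x : Option C) (I : H) : ℂ :=
  Q.U 1 (Sum.inl I) (T.j w) (HG.k (ixX x) (T.j w))

theorem h_k_k (hw : w ∈ T.W) (x y : Option C) :
    Q.h (T.j w) (HG.k (ixX x) (T.j w)) (HG.k (ixX y) (T.j w))
      = ∑ I, (T.normal w x I * conj (T.normal w y I) + conj (T.normal w x I) * T.normal w y I) := by
  rw [Q.h_eq (T.mem_hyper_dom hw)]
  refine Finset.sum_congr rfl fun I _ => ?_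
  rw [T.U_zero_k hw, T.U_zero_k hw]
  simp [normal]

theorem Ω_two_k_k (hw : w ∈ T.W) (x y : Option C) :
    (Q.Ω 2 (T.j w) (HG.k (ixX x) (T.j w)) (HG.k (ixX y) (T.j w)) : ℂ) = 2 * Complex.I *
      ∑ I, (conj (T.normal w x I) * T.normal w y I - T.normal w x I * conj (T.normal w y I)) := by
  rw [Q.Ω_two (T.mem_hyper_dom hw)]
  congr 1
  refine Finset.sum_congr rfl fun I _ => ?_
  rw [T.U_zero_k hw, T.U_zero_k hw]
  simp [normal]

/-- `P^1_X - i P^2_X` on `M^KH`. -/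
def charge (x : Option C) (w : H → ℂ) : ℂ :=
  HG.P (ixX x) 0 (T.j w) - Complex.I * HG.P (ixX x) 1 (T.j w)

theorem hasFDerivAt_P (hw : w ∈ T.W) (Λ : Option (C ⊕ V)) (x : Fin 3) :
    HasFDerivAt (fun y => (HG.P Λ x (T.j y) : ℂ))
      (Complex.ofRealCLM.comp ((fderiv ℝ (HG.P Λ x) (T.j w)).comp (fderiv ℝ T.j w))) w :=
  Complex.ofRealCLM.hasFDerivAt.comp w
    ((HG.differentiableAt_P (T.mem_hyper_dom hw) Λ x).hasFDerivAt.comp w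
      (T.differentiableAt_j hw).hasFDerivAt)

theorem differentiableAt_charge (hw : w ∈ T.W) (x : Option C) :
    DifferentiableAt ℝ (T.charge x) w :=
  ((T.hasFDerivAt_P hw _ 0).differentiableAt).fun_sub
    ((T.hasFDerivAt_P hw _ 1).differentiableAt.const_mul _)

/-- Since ω¹ = ω² = 0 along M^KH, the connection acts on P¹ - i P² by the phase ω³. The source Ω¹ -
iΩ² pairs the normal k_X with the conjugate of a (0,1) form, so it is complex linear in t: the
charge is covariantly holomorphic. -/
theorem fderiv_charge (hw : w ∈ T.W) (x : Option C) (t : H → ℂ) :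
    fderiv ℝ (T.charge x) w t
      = 4 * Complex.I * ∑ s, (∑ I, T.normal w x I * conj (T.vielbein w I s)) * t s
        + Complex.I * Q.om 2 (T.j w) (fderiv ℝ T.j w t) * T.charge x w := by
  have hq := T.mem_hyper_dom hw
  have h1 : HasFDerivAt (T.charge x) _ w :=
    (T.hasFDerivAt_P hw (ixX x) 0).fun_sub ((T.hasFDerivAt_P hw (ixX x) 1).const_mul Complex.I)
  have m0 := HG.moment _ hq (ixX x) 0 (fderiv ℝ T.j w t)
  have m1 := HG.moment _ hq (ixX x) 1 (fderiv ℝ T.j w t)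
  simp only [crossProduct_apply_add, Fin.isValue, zero_add, T.om_one w hw,
    T.om_two w hw, show (1 : Fin 3) + 1 = 2 from rfl, show (1 : Fin 3) + 2 = 0 from rfl] at m0 m1
  have hΩ := Q.Ω_zero_sub hq (HG.k (ixX x) (T.j w)) (fderiv ℝ T.j w t)
  rw [← m0, ← m1] at hΩ
  have h2 : ∑ I, (Q.U 1 (Sum.inl I) (T.j w) (HG.k (ixX x) (T.j w))
        * conj (Q.U 0 (Sum.inl I) (T.j w) (fderiv ℝ T.j w t))
      - conj (Q.U 0 (Sum.inl I) (T.j w) (HG.k (ixX x) (T.j w)))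
        * Q.U 1 (Sum.inl I) (T.j w) (fderiv ℝ T.j w t))
      = ∑ s, (∑ I, T.normal w x I * conj (T.vielbein w I s)) * t s := by
    simp only [T.U_two w hw, mul_zero, sub_zero, T.U_zero_fderiv_j hw, map_sum, map_mul,
      Complex.conj_conj, Finset.mul_sum, Finset.sum_mul]
    rw [Finset.sum_comm]
    exact Finset.sum_congr rfl fun I _ => Finset.sum_congr rfl fun s _ => by rw [normal]; ring
  rw [h2] at hΩ
  rw [h1.fderiv, charge, ← hΩ]
  simp only [sub_apply, smul_apply, ContinuousLinearMap.comp_apply, Complex.ofRealCLM_apply,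
    smul_eq_mul]
  push_cast
  linear_combination (HG.P (ixX x) 1 (T.j w) * Q.om 2 (T.j w) (fderiv ℝ T.j w t) : ℂ)
    * Complex.I_mul_I

theorem om_tang (w : H → ℂ) (s : H) (u : ℂ) :
    Q.om 2 (T.j w) (fderiv ℝ T.j w (Pi.single s u)) = Q.om 2 (T.j w) (T.tang w s u) := rfl

theorem sum_mul_single (φ : H → ℂ) (s : H) (u : ℂ) :
    ∑ r, φ r * (Pi.single s u : H → ℂ) r = φ s * u := by
  simp [Pi.single_apply]

theorem wd_charge (hw : w ∈ T.W) (x : Option C) (s : H) : wd s (T.charge x) w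
    = 4 * Complex.I * ∑ I, T.normal w x I * conj (T.vielbein w I s)
      + Complex.I * T.om3 w s * T.charge x w := by
  rw [wd, T.fderiv_charge hw, T.fderiv_charge hw, sum_mul_single, sum_mul_single, T.om_tang,
    T.om_tang, om3]
  linear_combination (-2 * Complex.I * ∑ I, T.normal w x I * conj (T.vielbein w I s))
    * Complex.I_mul_I

theorem wdBar_charge (hw : w ∈ T.W) (x : Option C) (s : H) : wdBar s (T.charge x) w
    = Complex.I * conj (T.om3 w s) * T.charge x w := by
  rw [wdBar, T.fderiv_charge hw, T.fderiv_charge hw, sum_mul_single, sum_mul_single, T.om_tang,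
    T.om_tang, om3]
  simp only [map_div₀, map_sub, map_mul, Complex.conj_ofReal, Complex.conj_I, Complex.conj_ofNat]
  linear_combination (2 * Complex.I * ∑ I, T.normal w x I * conj (T.vielbein w I s))
    * Complex.I_mul_I

/-- The restriction of `ω^3` to `M^KH`. -/
def om3R (t : H → ℂ) (w : H → ℂ) : ℝ := Q.om 2 (T.j w) (fderiv ℝ T.j w t)

theorem hasFDerivAt_om3R (hw : w ∈ T.W) (t : H → ℂ) : ∃ L : (H → ℂ) →L[ℝ] ℝ,
    HasFDerivAt (T.om3R t) L w ∧ ∀ s, L s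
      = fderiv ℝ (Q.om 2) (T.j w) (fderiv ℝ T.j w s) (fderiv ℝ T.j w t)
        + Q.om 2 (T.j w) (fderiv ℝ (fderiv ℝ T.j) w s t) := by
  have h1 := (Q.differentiableAt_om (T.mem_hyper_dom hw) 2).hasFDerivAt.comp w
    (T.differentiableAt_j hw).hasFDerivAt
  have h2 := ((T.contDiffAt_j hw).of_le (by norm_cast : (2 : ℕ∞ω) ≤ ∞)).fderiv_apply_const t
  exact ⟨_, h1.clm_apply h2, fun s => by simp [add_comm]⟩

theorem differentiableAt_om3R (hw : w ∈ T.W) (t : H → ℂ) : DifferentiableAt ℝ (T.om3R t) w :=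
  let ⟨_, h, _⟩ := T.hasFDerivAt_om3R hw t
  h.differentiableAt

/-- The quadratic part of the curvature involves only ω¹ and ω², which vanish on M^KH; the second
derivative of j is symmetric. -/
theorem fderiv_om3R_sub (hw : w ∈ T.W) (s t : H → ℂ) :
    fderiv ℝ (T.om3R t) w s - fderiv ℝ (T.om3R s) w t
      = Q.Ω 2 (T.j w) (fderiv ℝ T.j w s) (fderiv ℝ T.j w t) := by
  obtain ⟨L, hL, hL'⟩ := T.hasFDerivAt_om3R hw t
  obtain ⟨L₂, hL₂, hL₂'⟩ := T.hasFDerivAt_om3R hw s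
  have hs : fderiv ℝ (fderiv ℝ T.j) w s t = fderiv ℝ (fderiv ℝ T.j) w t s :=
    ((T.contDiffAt_j hw).isSymmSndFDerivAt (by simp; norm_cast)).eq s t
  rw [hL.fderiv, hL₂.fderiv, hL', hL₂', hs, Q.Ω_apply]
  simp [T.om_one w hw, T.om_two w hw, show (2 : Fin 3) + 1 = 0 from rfl,
    show (2 : Fin 3) + 2 = 1 from rfl]

theorem Ω_two_fderiv_j (hw : w ∈ T.W) (s t : H → ℂ) :
    (Q.Ω 2 (T.j w) (fderiv ℝ T.j w s) (fderiv ℝ T.j w t) : ℂ) = 2 * Complex.I * ∑ I,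
      (Q.U 0 (Sum.inl I) (T.j w) (fderiv ℝ T.j w s)
        * conj (Q.U 0 (Sum.inl I) (T.j w) (fderiv ℝ T.j w t))
      - conj (Q.U 0 (Sum.inl I) (T.j w) (fderiv ℝ T.j w s))
        * Q.U 0 (Sum.inl I) (T.j w) (fderiv ℝ T.j w t)) := by
  rw [Q.Ω_two (T.mem_hyper_dom hw)]
  simp [T.U_two w hw]

theorem hasFDerivAt_om3 (hw : w ∈ T.W) (s : H) : HasFDerivAt (fun w => T.om3 w s)
    ((2⁻¹ : ℂ) • (Complex.ofRealCLM.comp (fderiv ℝ (T.om3R (Pi.single s 1)) w)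
      - Complex.I • Complex.ofRealCLM.comp (fderiv ℝ (T.om3R (Pi.single s Complex.I)) w))) w := by
  have h : ∀ u, HasFDerivAt (fun w => (T.om3R u w : ℂ))
      (Complex.ofRealCLM.comp (fderiv ℝ (T.om3R u) w)) w := fun u =>
    Complex.ofRealCLM.hasFDerivAt.comp w (T.differentiableAt_om3R hw u).hasFDerivAt
  refine (((h _).fun_sub ((h _).fun_const_smul Complex.I)).fun_const_smul
    (2⁻¹ : ℂ)).congr_of_eventuallyEq (Eventually.of_forall fun y => ?_)
  simp [om3, om3R, tang, div_eq_inv_mul]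

/-- With u and v in {1, i} this holds all real components of dω³. Its (2,0) and (1,1) parts are
extracted in the next two lemmas. -/
theorem om3R_curvature (hw : w ∈ T.W) (s t : H) (u v : ℂ) :
    (fderiv ℝ (T.om3R (Pi.single t v)) w (Pi.single s u) : ℂ)
      = fderiv ℝ (T.om3R (Pi.single s u)) w (Pi.single t v) + 2 * Complex.I *
        (conj u * v * ∑ I, T.vielbein w I s * conj (T.vielbein w I t)
          - u * conj v * ∑ I, conj (T.vielbein w I s) * T.vielbein w I t) := by
  have h := congrArg (Complex.ofReal) (T.fderiv_om3R_sub hw (Pi.single s u) (Pi.single t v))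
  rw [T.Ω_two_fderiv_j hw] at h
  have h1 : ∀ I s (u : ℂ), Q.U 0 (Sum.inl I) (T.j w) (fderiv ℝ T.j w (Pi.single s u))
      = T.vielbein w I s * conj u := fun I s u => by
    rw [T.U_zero_fderiv_j hw]
    simp [Pi.single_apply, apply_ite conj]
  have h2 : ∑ I, (T.vielbein w I s * conj u * conj (T.vielbein w I t * conj v)
      - conj (T.vielbein w I s * conj u) * (T.vielbein w I t * conj v))
      = conj u * v * ∑ I, T.vielbein w I s * conj (T.vielbein w I t)
          - u * conj v * ∑ I, conj (T.vielbein w I s) * T.vielbein w I t := by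
    rw [Finset.mul_sum, Finset.mul_sum, ← Finset.sum_sub_distrib]
    refine Finset.sum_congr rfl fun I _ => ?_
    simp only [map_mul, Complex.conj_conj]
    ring
  simp only [h1, h2, Complex.ofReal_sub] at h
  linear_combination h

theorem wd_om3_comm (hw : w ∈ T.W) (s t : H) :
    wd s (fun w => T.om3 w t) w = wd t (fun w => T.om3 w s) w := by
  rw [(T.hasFDerivAt_om3 hw t).wd_eq, (T.hasFDerivAt_om3 hw s).wd_eq]
  simp only [smul_apply, sub_apply, ContinuousLinearMap.comp_apply, Complex.ofRealCLM_apply,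
    smul_eq_mul, T.om3R_curvature hw s t, map_one, Complex.conj_I]
  have hI : Complex.I ^ 5 = Complex.I := by rw [pow_succ, Complex.I_pow_four, one_mul]
  ring_nf
  simp only [Complex.I_sq, hI]
  ring

theorem wdBar_om3_sub (hw : w ∈ T.W) (s t : H) :
    -Complex.I * (conj (wdBar s (fun w => T.om3 w t) w) - wdBar t (fun w => T.om3 w s) w)
      = -T.gKH w s t := by
  rw [(T.hasFDerivAt_om3 hw t).wdBar_eq, (T.hasFDerivAt_om3 hw s).wdBar_eq, T.gKH_eq hw]
  simp only [smul_apply, sub_apply, ContinuousLinearMap.comp_apply, Complex.ofRealCLM_apply,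
    smul_eq_mul, map_div₀, map_add, map_sub, map_mul, Complex.conj_ofReal, map_inv₀,
    Complex.conj_ofNat, Complex.conj_I, T.om3R_curvature hw s t, map_one, Matrix.smul_apply,
    Matrix.mul_apply, Matrix.conjTranspose_apply, RCLike.star_def]
  simp only [map_sum, map_mul, map_neg, Complex.conj_conj, Complex.conj_I]
  have hI : Complex.I ^ 6 = -1 := by
    rw [show 6 = 4 + 2 from rfl, pow_add, Complex.I_pow_four, one_mul, Complex.I_sq]
  ring_nf
  simp only [Complex.I_sq, Complex.I_pow_four, hI]
  ring

end Truncation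


/-! ### Wirtinger derivatives of functions pulled back from one factor -/

section Reindex

variable {m n : Type*} [Fintype m] [DecidableEq m] [Fintype n] [DecidableEq n]
  {φ : (m → ℂ) → ℂ} {e : m → n} {p : n → ℂ}

/-- Precomposition with `e` as a linear map on coordinate vectors. -/
abbrev reindexCLM (e : m → n) : (n → ℂ) →L[ℂ] m → ℂ :=
  ContinuousLinearMap.pi fun a => ContinuousLinearMap.proj (e a)

theorem differentiableAt_reindex : DifferentiableAt ℂ (fun p : n → ℂ => p ∘ e) p :=
  (reindexCLM e).differentiableAt

theorem fderiv_reindex (v : n → ℂ) : fderiv ℂ (fun p : n → ℂ => p ∘ e) p v = v ∘ e :=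
  congrArg (fun A : (n → ℂ) →L[ℂ] m → ℂ => A v) (reindexCLM e).fderiv

theorem DifferentiableAt.reindex (hφ : DifferentiableAt ℝ φ (p ∘ e)) :
    DifferentiableAt ℝ (fun p => φ (p ∘ e)) p :=
  hφ.comp p (differentiableAt_reindex.restrictScalars ℝ)

theorem wd_reindex (hφ : DifferentiableAt ℝ φ (p ∘ e)) (i : n) :
    wd i (fun p => φ (p ∘ e)) p = ∑ a, if e a = i then wd a φ (p ∘ e) else 0 := by
  rw [wd_comp_holomorphic (ι := fun p => p ∘ e) hφ differentiableAt_reindex]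
  simp [fderiv_reindex, Pi.single_apply]

theorem wdBar_reindex (hφ : DifferentiableAt ℝ φ (p ∘ e)) (i : n) :
    wdBar i (fun p => φ (p ∘ e)) p = ∑ a, if e a = i then wdBar a φ (p ∘ e) else 0 := by
  rw [wdBar_comp_holomorphic (ι := fun p => p ∘ e) hφ differentiableAt_reindex]
  simp [fderiv_reindex, Pi.single_apply, apply_ite conj]

end Reindex

/-! ### Restriction of K and L to M_R -/

namespace Truncation

open Filter
open scoped Topology

variable {C V H : Type*} [Fintype C] [DecidableEq C] [Fintype V] [DecidableEq V]
  [Fintype H] [DecidableEq H]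
  {S : SpecialKahler (C ⊕ V)} {Q : QuaternionicKahler H}
  {𝔤 : StructureConstants (Option (C ⊕ V))} {VG : VectorGauging S 𝔤} {HG : HyperGauging Q 𝔤}
  (T : Truncation S Q VG HG) {z : C → ℂ}

theorem holomorphic_ι_apply (a : C ⊕ V) : DifferentiableOn ℂ (fun y => T.ι y a) T.Z :=
  fun z hz => differentiableWithinAt_pi.1 (T.holomorphic_ι z hz) a

theorem contDiffAt_K_ι (hz : z ∈ T.Z) : ContDiffAt ℝ ∞ (fun y => S.K (T.ι y)) z :=
  (S.contDiffAt_K (T.mem_dom hz)).comp z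
    (contDiffAt_pi.2 fun a => contDiffAt_of_holomorphic T.isOpen_Z (T.holomorphic_ι_apply a) hz)

theorem differentiableAt_K_ι (hz : z ∈ T.Z) : DifferentiableAt ℝ (fun y => S.K (T.ι y)) z :=
  (T.contDiffAt_K_ι hz).differentiableAt (by simp)

theorem contDiffAt_ofReal_K_ι (hz : z ∈ T.Z) : ContDiffAt ℝ 2 (fun y => (S.K (T.ι y) : ℂ)) z :=
  (Complex.ofRealCLM.contDiff.contDiffAt.comp z (T.contDiffAt_K_ι hz)).of_le
    (by norm_cast : (2 : ℕ∞ω) ≤ ∞)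

/-- `∂_c K` on `M_R`. -/
abbrev dKR (c : C) (z : C → ℂ) : ℂ := wd c (fun y => (S.K (T.ι y) : ℂ)) z

theorem differentiableAt_dKR (hz : z ∈ T.Z) (c : C) : DifferentiableAt ℝ (T.dKR c) z :=
  (T.contDiffAt_ofReal_K_ι hz).differentiableAt_wd c

theorem dKR_eq (hz : z ∈ T.Z) (c : C) :
    T.dKR c z = ∑ a, T.tangent z c a * S.dK a (T.ι z) := by
  rw [dKR, wd_comp_holomorphic (φ := fun y => (S.K y : ℂ))
    (Complex.ofRealCLM.differentiableAt.comp _ (S.differentiableAt_K (T.mem_dom hz)))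
    (T.differentiableAt_ι hz)]
  exact Finset.sum_congr rfl fun a _ => mul_comm _ _

theorem hasDerivAt_exp_half (t : ℝ) :
    HasDerivAt (fun t : ℝ => Real.exp (t / 2)) (Real.exp (t / 2) * (1 / 2)) t :=
  ((hasDerivAt_id t).div_const 2).exp

theorem differentiableAt_exp_half_K (hz : z ∈ T.Z) :
    DifferentiableAt ℝ (fun y => ((Real.exp (S.K (T.ι y) / 2) : ℝ) : ℂ)) z :=
  Complex.ofRealCLM.differentiableAt.comp z
    ((hasDerivAt_exp_half _).differentiableAt.comp z (T.differentiableAt_K_ι hz))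

theorem differentiableAt_X_ι (hz : z ∈ T.Z) (Λ : Option (C ⊕ V)) :
    DifferentiableAt ℂ (fun y => S.X Λ (T.ι y)) z :=
  (S.differentiableAt_X (T.mem_dom hz) Λ).comp z (T.differentiableAt_ι hz)

theorem differentiableAt_L_ι (hz : z ∈ T.Z) (Λ : Option (C ⊕ V)) :
    DifferentiableAt ℝ (fun y => S.L Λ (T.ι y)) z :=
  (T.differentiableAt_exp_half_K hz).fun_mul ((T.differentiableAt_X_ι hz Λ).restrictScalars ℝ)

/-- By the chain rule ∂_c of the restricted K is the tangential part of ∂K, so the covariant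
derivative along M_R is the tangential combination of the f_I. -/
theorem wd_L_ι (hz : z ∈ T.Z) (c : C) (Λ : Option (C ⊕ V)) :
    wd c (fun y => S.L Λ (T.ι y)) z = T.fR z c Λ - T.dKR c z / 2 * S.L Λ (T.ι z) := by
  have h : wd c (fun y => S.L Λ (T.ι y)) z = _ := wd_mul (T.differentiableAt_exp_half_K hz)
    ((T.differentiableAt_X_ι hz Λ).restrictScalars ℝ) c
  rw [h, wd_real_comp (hasDerivAt_exp_half _) (T.differentiableAt_K_ι hz),
    ← T.sum_tangent_wd hz (S.differentiableAt_X (T.mem_dom hz) Λ), fR]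
  have h2 : ∑ a, T.tangent z c a * S.f a Λ (T.ι z) = Real.exp (S.K (T.ι z) / 2)
      * (∑ a, T.tangent z c a * wd a (S.X Λ) (T.ι z) + T.dKR c z * S.X Λ (T.ι z)) := by
    rw [T.dKR_eq hz, Finset.sum_mul, ← Finset.sum_add_distrib, Finset.mul_sum]
    refine Finset.sum_congr rfl fun a _ => ?_
    rw [S.f_eq (T.mem_dom hz)]
    ring
  rw [h2, SpecialKahler.L]
  push_cast
  ring

theorem wdBar_L_ι (hz : z ∈ T.Z) (c : C) (Λ : Option (C ⊕ V)) :
    wdBar c (fun y => S.L Λ (T.ι y)) z = conj (T.dKR c z) / 2 * S.L Λ (T.ι z) := by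
  have h : wdBar c (fun y => S.L Λ (T.ι y)) z = _ := wdBar_mul (T.differentiableAt_exp_half_K hz)
    ((T.differentiableAt_X_ι hz Λ).restrictScalars ℝ) c
  rw [h, wdBar_eq_zero_of_holomorphic (T.differentiableAt_X_ι hz Λ),
    wdBar_ofReal (fun y => Real.exp (S.K (T.ι y) / 2))
      ((hasDerivAt_exp_half _).differentiableAt.comp z (T.differentiableAt_K_ι hz)),
    wd_real_comp (hasDerivAt_exp_half _) (T.differentiableAt_K_ι hz), SpecialKahler.L]
  simp only [map_mul, Complex.conj_ofReal]
  push_cast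
  ring

theorem differentiableAt_tangent (hz : z ∈ T.Z) (c : C) (a : C ⊕ V) :
    DifferentiableAt ℂ (fun y => T.tangent y c a) z := by
  refine (((differentiableOn_fderiv_apply_of_isOpen T.isOpen_Z (T.holomorphic_ι_apply a)
    (Pi.single c 1)) z hz).differentiableAt (T.isOpen_Z.mem_nhds hz)).congr_of_eventuallyEq ?_
  filter_upwards [T.isOpen_Z.mem_nhds hz] with y hy
  rw [tangent, fderiv_apply (T.differentiableAt_ι hy)]
  rfl

/-- The induced metric is the Kähler metric of the restricted Kähler potential. -/
theorem wd_wdBar_K_ι (hz : z ∈ T.Z) (c d : C) :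
    wd c (wdBar d fun y => (S.K (T.ι y) : ℂ)) z = T.gR z c d := by
  have h : wdBar d (fun y => (S.K (T.ι y) : ℂ)) =ᶠ[𝓝 z]
      fun y => ∑ b, wdBar b (fun y => (S.K y : ℂ)) (T.ι y) * conj (T.tangent y d b) := by
    filter_upwards [T.isOpen_Z.mem_nhds hz] with y hy
    exact wdBar_comp_holomorphic (φ := fun y => (S.K y : ℂ))
      (Complex.ofRealCLM.differentiableAt.comp _ (S.differentiableAt_K (T.mem_dom hy)))
      (T.differentiableAt_ι hy) d
  have hK : ContDiffAt ℝ 2 (fun y => (S.K y : ℂ)) (T.ι z) :=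
    (S.contDiffAt_ofReal_K (T.mem_dom hz)).of_le (by norm_cast : (2 : ℕ∞ω) ≤ ∞)
  have h1 : ∀ b, DifferentiableAt ℝ (fun y => wdBar b (fun y => (S.K y : ℂ)) (T.ι y)) z :=
    fun b => (hK.differentiableAt_wdBar b).comp z ((T.differentiableAt_ι hz).restrictScalars ℝ)
  have h2 : ∀ b, DifferentiableAt ℝ (fun y => T.tangent y d b) z := fun b =>
    (T.differentiableAt_tangent hz d b).restrictScalars ℝ
  rw [wd_congr h, wd_sum _ fun b _ => (h1 b).fun_mul (h2 b).conj_fun, gR, Matrix.of_apply,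
    Finset.sum_comm]
  refine Finset.sum_congr rfl fun b _ => ?_
  rw [wd_mul (h1 b) (h2 b).conj_fun, wd_conj (h2 b),
    wdBar_eq_zero_of_holomorphic (T.differentiableAt_tangent hz d b), map_zero, mul_zero, zero_add,
    wd_comp_holomorphic (hK.differentiableAt_wdBar b) (T.differentiableAt_ι hz), Finset.sum_mul]
  rfl

end Truncation


/-! ### The reduced data satisfy the N = 1 requirements -/

theorem Matrix.PosDef.fromBlocks_zero {m n : Type*} [Fintype m] [DecidableEq m] [Fintype n]
    [DecidableEq n] {A : Matrix m m ℂ} {B : Matrix n n ℂ} (hA : A.PosDef) (hB : B.PosDef) :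
    (Matrix.fromBlocks A 0 0 B).PosDef := by
  have := hA.isUnit.invertible
  -- With zero off-diagonal blocks the Schur complement is B itself; invertibility upgrades
  -- semidefinite to definite.
  have h : (Matrix.fromBlocks A 0 0 B).PosSemidef := by
    simpa [hB.posSemidef] using Matrix.PosDef.fromBlocks₁₁ 0 B hA
  refine h.posDef_iff_isUnit.2 ((Matrix.isUnit_iff_isUnit_det _).2 ?_)
  rw [Matrix.det_fromBlocks_zero₂₁]
  exact ((Matrix.isUnit_iff_isUnit_det _).1 hA.isUnit).mul
    ((Matrix.isUnit_iff_isUnit_det _).1 hB.isUnit)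

namespace Truncation

open Filter
open scoped Topology

variable {C V H : Type*} [Fintype C] [DecidableEq C] [Fintype V] [DecidableEq V]
  [Fintype H] [DecidableEq H]
  {S : SpecialKahler (C ⊕ V)} {Q : QuaternionicKahler H}
  {𝔤 : StructureConstants (Option (C ⊕ V))} {VG : VectorGauging S 𝔤} {HG : HyperGauging Q 𝔤}
  (T : Truncation S Q VG HG) {p : C ⊕ H → ℂ}

/-- The section `L^X` pulled back to `M_R × M^KH`. -/
def pullL (x : Option C) (p : C ⊕ H → ℂ) : ℂ := S.L (ixX x) (T.ι (p ∘ Sum.inl))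

/-- The charge `P^1_X - i P^2_X` pulled back to `M_R × M^KH`. -/
def pullCharge (x : Option C) (p : C ⊕ H → ℂ) : ℂ := T.charge x (p ∘ Sum.inr)

theorem reduced_L : T.reduced.L
    = fun p => Complex.I / 2 * ∑ x, T.pullL x p * T.pullCharge x p := rfl

theorem reduced_L_apply (p : C ⊕ H → ℂ) :
    T.reduced.L p = Complex.I / 2 * ∑ x, T.pullL x p * T.pullCharge x p := rfl

theorem differentiableAt_pullL (hp : p ∈ T.reduced.dom) (x : Option C) :
    DifferentiableAt ℝ (T.pullL x) p :=
  (T.differentiableAt_L_ι hp.1 (ixX x)).reindex (φ := fun y => S.L (ixX x) (T.ι y))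

theorem differentiableAt_pullCharge (hp : p ∈ T.reduced.dom) (x : Option C) :
    DifferentiableAt ℝ (T.pullCharge x) p :=
  (T.differentiableAt_charge hp.2 x).reindex

theorem differentiableAt_sum_pull (hp : p ∈ T.reduced.dom) (x : Option C) :
    DifferentiableAt ℝ (fun p => T.pullL x p * T.pullCharge x p) p :=
  (T.differentiableAt_pullL hp x).fun_mul (T.differentiableAt_pullCharge hp x)

theorem wd_pullL (hp : p ∈ T.reduced.dom) (x : Option C) (l : C ⊕ H) : wd l (T.pullL x) p
    = l.elim (fun c => T.fR (p ∘ Sum.inl) c (ixX x)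
      - T.dKR c (p ∘ Sum.inl) / 2 * T.pullL x p) fun _ => 0 := by
  have h := wd_reindex (φ := fun y => S.L (ixX x) (T.ι y)) (T.differentiableAt_L_ι hp.1 (ixX x)) l
  refine h.trans ?_
  rcases l with c | s <;> simp [T.wd_L_ι hp.1, pullL]

theorem wdBar_pullL (hp : p ∈ T.reduced.dom) (x : Option C) (l : C ⊕ H) : wdBar l (T.pullL x) p
    = l.elim (fun c => conj (T.dKR c (p ∘ Sum.inl)) / 2 * T.pullL x p) fun _ => 0 := by
  have h := wdBar_reindex (φ := fun y => S.L (ixX x) (T.ι y))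
    (T.differentiableAt_L_ι hp.1 (ixX x)) l
  refine h.trans ?_
  rcases l with c | s <;> simp [T.wdBar_L_ι hp.1, pullL]

theorem wd_pullCharge (hp : p ∈ T.reduced.dom) (x : Option C) (l : C ⊕ H) :
    wd l (T.pullCharge x) p = l.elim (fun _ => 0) fun s =>
      4 * Complex.I * ∑ I, T.normal (p ∘ Sum.inr) x I * conj (T.vielbein (p ∘ Sum.inr) I s)
      + Complex.I * T.om3 (p ∘ Sum.inr) s * T.pullCharge x p := by
  refine (wd_reindex (T.differentiableAt_charge hp.2 x) l).trans ?_
  rcases l with c | s <;> simp [T.wd_charge hp.2, pullCharge]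

theorem wdBar_pullCharge (hp : p ∈ T.reduced.dom) (x : Option C) (l : C ⊕ H) :
    wdBar l (T.pullCharge x) p = l.elim (fun _ => 0) fun s =>
      Complex.I * conj (T.om3 (p ∘ Sum.inr) s) * T.pullCharge x p := by
  refine (wdBar_reindex (T.differentiableAt_charge hp.2 x) l).trans ?_
  rcases l with c | s <;> simp [T.wdBar_charge hp.2, pullCharge]

theorem wd_reduced_L (hp : p ∈ T.reduced.dom) (l : C ⊕ H) : wd l T.reduced.L p = Complex.I / 2 *
    ∑ x, (T.pullL x p * wd l (T.pullCharge x) p + wd l (T.pullL x) p * T.pullCharge x p) := by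
  rw [reduced_L,
    wd_const_mul _ (DifferentiableAt.fun_sum fun x _ => T.differentiableAt_sum_pull hp x),
    wd_sum _ fun x _ => T.differentiableAt_sum_pull hp x]
  simp only [wd_mul (T.differentiableAt_pullL hp _) (T.differentiableAt_pullCharge hp _)]

theorem wdBar_reduced_L (hp : p ∈ T.reduced.dom) (l : C ⊕ H) :
    wdBar l T.reduced.L p = Complex.I / 2 * ∑ x,
      (T.pullL x p * wdBar l (T.pullCharge x) p + wdBar l (T.pullL x) p * T.pullCharge x p) := by
  rw [reduced_L,
    wdBar_const_mul _ (DifferentiableAt.fun_sum fun x _ => T.differentiableAt_sum_pull hp x),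
    wdBar_sum _ fun x _ => T.differentiableAt_sum_pull hp x]
  simp only [wdBar_mul (T.differentiableAt_pullL hp _) (T.differentiableAt_pullCharge hp _)]

/-- The connection ½ ∂_c K cancels the inhomogeneous term in the derivative of L^X; likewise -iω³
cancels the phase rotation of the charge in `covL_inr`. -/
theorem covL_inl (hp : p ∈ T.reduced.dom) (c : C) : T.reduced.covL (Sum.inl c) p
    = Complex.I / 2 * ∑ x, T.fR (p ∘ Sum.inl) c (ixX x) * T.pullCharge x p := by
  have ha : T.reduced.a p (Sum.inl c) = T.dKR c (p ∘ Sum.inl) / 2 := rfl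
  rw [N1Data.covL, T.wd_reduced_L hp, ha, reduced_L_apply]
  simp only [T.wd_pullL hp, T.wd_pullCharge hp, Sum.elim_inl, Finset.mul_sum,
    ← Finset.sum_add_distrib]
  exact Finset.sum_congr rfl fun x _ => by ring

theorem covL_inr (hp : p ∈ T.reduced.dom) (s : H) : T.reduced.covL (Sum.inr s) p
    = -2 * ∑ I, (∑ x, T.pullL x p * T.normal (p ∘ Sum.inr) x I)
      * conj (T.vielbein (p ∘ Sum.inr) I s) := by
  have ha : T.reduced.a p (Sum.inr s) = -Complex.I * T.om3 (p ∘ Sum.inr) s := rfl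
  have h : ∑ I, (∑ x, T.pullL x p * T.normal (p ∘ Sum.inr) x I)
      * conj (T.vielbein (p ∘ Sum.inr) I s) = ∑ x, T.pullL x p
        * ∑ I, T.normal (p ∘ Sum.inr) x I * conj (T.vielbein (p ∘ Sum.inr) I s) := by
    simp only [Finset.sum_mul, Finset.mul_sum]
    rw [Finset.sum_comm]
    exact Finset.sum_congr rfl fun x _ => Finset.sum_congr rfl fun I _ => by ring
  rw [N1Data.covL, T.wd_reduced_L hp, ha, reduced_L_apply, h, Finset.mul_sum, Finset.mul_sum,
    Finset.mul_sum, Finset.mul_sum, ← Finset.sum_add_distrib]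
  refine Finset.sum_congr rfl fun x _ => ?_
  rw [T.wd_pullL hp, T.wd_pullCharge hp]
  simp only [Sum.elim_inr]
  linear_combination (2 * T.pullL x p
    * ∑ I, T.normal (p ∘ Sum.inr) x I * conj (T.vielbein (p ∘ Sum.inr) I s)) * Complex.I_mul_I

/-- L^X and the charges each have an antiholomorphic derivative proportional to themselves, with
exactly the coefficient subtracted by the conjugate connection. -/
theorem covBarL_eq_zero (hp : p ∈ T.reduced.dom) (l : C ⊕ H) : T.reduced.covBarL l p = 0 := by
  rw [N1Data.covBarL, T.wdBar_reduced_L hp, reduced_L_apply]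
  simp only [T.wdBar_pullL hp, T.wdBar_pullCharge hp, Finset.mul_sum, ← Finset.sum_sub_distrib]
  refine Finset.sum_eq_zero fun x _ => ?_
  rcases l with c | s
  · have ha : T.reduced.a p (Sum.inl c) = T.dKR c (p ∘ Sum.inl) / 2 := rfl
    simp only [ha, Sum.elim_inl, map_div₀, Complex.conj_ofNat]
    ring
  · have ha : T.reduced.a p (Sum.inr s) = -Complex.I * T.om3 (p ∘ Sum.inr) s := rfl
    simp only [ha, Sum.elim_inr, map_mul, map_neg, Complex.conj_I]
    ring

theorem differentiableAt_om3 {w : H → ℂ} (hw : w ∈ T.W) (s : H) :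
    DifferentiableAt ℝ (fun w => T.om3 w s) w := (T.hasFDerivAt_om3 hw s).differentiableAt

theorem differentiableAt_a_inl (hp : p ∈ T.reduced.dom) (c : C) :
    DifferentiableAt ℝ (fun y : C ⊕ H → ℂ => T.dKR c (y ∘ Sum.inl)) p :=
  (T.differentiableAt_dKR hp.1 c).reindex

theorem differentiableAt_a_inr (hp : p ∈ T.reduced.dom) (s : H) :
    DifferentiableAt ℝ (fun y : C ⊕ H → ℂ => T.om3 (y ∘ Sum.inr) s) p :=
  (T.differentiableAt_om3 hp.2 s).reindex (φ := fun w => T.om3 w s)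

theorem a_inl (c : C) : (fun y => T.reduced.a y (Sum.inl c))
    = fun y => 2⁻¹ * T.dKR c (y ∘ Sum.inl) :=
  funext fun _ => div_eq_inv_mul _ _

theorem a_inr (s : H) : (fun y => T.reduced.a y (Sum.inr s))
    = fun y => -Complex.I * T.om3 (y ∘ Sum.inr) s := rfl

theorem differentiableAt_a (hp : p ∈ T.reduced.dom) (l : C ⊕ H) :
    DifferentiableAt ℝ (fun y => T.reduced.a y l) p := by
  rcases l with c | s
  · rw [a_inl]
    exact (T.differentiableAt_a_inl hp c).const_mul _
  · rw [a_inr]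
    exact (T.differentiableAt_a_inr hp s).const_mul _

theorem wd_a (hp : p ∈ T.reduced.dom) (l m : C ⊕ H) : wd l (fun y => T.reduced.a y m) p
    = m.elim (fun c => l.elim (fun d => 2⁻¹ * wd d (T.dKR c) (p ∘ Sum.inl)) fun _ => 0)
      fun s => l.elim (fun _ => 0) fun t =>
        -Complex.I * wd t (fun w => T.om3 w s) (p ∘ Sum.inr) := by
  rcases m with c | s
  · rw [a_inl, wd_const_mul _ (T.differentiableAt_a_inl hp c),
      wd_reindex (T.differentiableAt_dKR hp.1 c)]
    rcases l with d | t <;> simp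
  · rw [a_inr, wd_const_mul _ (T.differentiableAt_a_inr hp s),
      wd_reindex (φ := fun w => T.om3 w s) (T.differentiableAt_om3 hp.2 s)]
    rcases l with d | t <;> simp

theorem wdBar_a (hp : p ∈ T.reduced.dom) (l m : C ⊕ H) : wdBar l (fun y => T.reduced.a y m) p
    = m.elim (fun c => l.elim (fun d => 2⁻¹ * wdBar d (T.dKR c) (p ∘ Sum.inl)) fun _ => 0)
      fun s => l.elim (fun _ => 0) fun t =>
        -Complex.I * wdBar t (fun w => T.om3 w s) (p ∘ Sum.inr) := by
  rcases m with c | s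
  · rw [a_inl, wdBar_const_mul _ (T.differentiableAt_a_inl hp c),
      wdBar_reindex (T.differentiableAt_dKR hp.1 c)]
    rcases l with d | t <;> simp
  · rw [a_inr, wdBar_const_mul _ (T.differentiableAt_a_inr hp s),
      wdBar_reindex (φ := fun w => T.om3 w s) (T.differentiableAt_om3 hp.2 s)]
    rcases l with d | t <;> simp

theorem wdBar_dKR {z : C → ℂ} (hz : z ∈ T.Z) (c d : C) : wdBar d (T.dKR c) z = T.gR z c d := by
  rw [← wd_wdBar_comm (T.contDiffAt_ofReal_K_ι hz), T.wd_wdBar_K_ι hz]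

/-- On M_R the two halves of ∂∂̄K add up to the induced metric; on M^KH the curvature is the (1,1)
part of dω³. Mixed components vanish because each connection depends only on its own factor. -/
theorem reduced_hodge (hp : p ∈ T.reduced.dom) (l m : C ⊕ H) :
    wd l (fun y => -conj (T.reduced.a y m)) p - wdBar m (fun y => T.reduced.a y l) p
      = -T.reduced.g p l m := by
  rw [wd_neg, wd_conj (T.differentiableAt_a hp m), T.wdBar_a hp, T.wdBar_a hp]
  rcases l with c | s <;> rcases m with d | t
  · have hg : T.reduced.g p (Sum.inl c) (Sum.inl d) = T.gR (p ∘ Sum.inl) c d := rfl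
    have hh := (T.gR_posDef hp.1).1.apply c d
    simp only [RCLike.star_def] at hh
    simp only [Sum.elim_inl, T.wdBar_dKR hp.1, hg, map_mul, map_inv₀, Complex.conj_ofNat, hh]
    ring
  · have hg : T.reduced.g p (Sum.inl c) (Sum.inr t) = 0 := rfl
    simp [hg]
  · have hg : T.reduced.g p (Sum.inr s) (Sum.inl d) = 0 := rfl
    simp [hg]
  · have hg : T.reduced.g p (Sum.inr s) (Sum.inr t) = T.gKH (p ∘ Sum.inr) s t := rfl
    simp only [Sum.elim_inr, hg, ← T.wdBar_om3_sub hp.2 s t, map_mul, map_neg, Complex.conj_I]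
    ring

theorem reduced_hodge_two_zero (hp : p ∈ T.reduced.dom) (l m : C ⊕ H) :
    wd l (fun y => T.reduced.a y m) p - wd m (fun y => T.reduced.a y l) p = 0 := by
  rw [T.wd_a hp, T.wd_a hp]
  rcases l with c | s <;> rcases m with d | t
  · simp [wd_wd_comm (T.contDiffAt_ofReal_K_ι hp.1) c d]
  · simp
  · simp
  · simp [T.wd_om3_comm hp.2 s t]

theorem Imf_eq : ∀ p, T.reduced.Imf p = (-2 : ℝ) • T.ImNΛ (p ∘ Sum.inl) := by
  intro p
  ext v w
  simp [N1Data.Imf, reduced, ImNΛ, SpecialKahler.ImN]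

theorem reduced_isN1 : T.reduced.IsN1 where
  metric_posDef p hp := (T.gR_posDef hp.1).fromBlocks_zero (T.gKH_posDef hp.2)
  differentiable_a l p hp := (T.differentiableAt_a hp l).differentiableWithinAt
  hodge p hp := T.reduced_hodge hp
  hodge_two_zero p hp := T.reduced_hodge_two_zero hp
  differentiable_L p hp := ((DifferentiableAt.fun_sum fun x _ =>
    T.differentiableAt_sum_pull hp x).const_mul _).differentiableWithinAt
  covariantly_holomorphic p hp := T.covBarL_eq_zero hp
  f_holomorphic v w p hp := ((DifferentiableAt.comp (f := fun p : C ⊕ H → ℂ => p ∘ Sum.inl) p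
    (T.differentiableAt_conjN hp.1 v w) differentiableAt_reindex).const_mul
      2).differentiableWithinAt
  f_symm p hp := by
    ext v w
    simp [reduced, (S.N_isSymm (T.mem_dom hp.1)).apply]
  Imf_posDef p hp := by
    rw [Imf_eq]
    exact T.neg_two_ImNΛ_posDef hp.1

end Truncation


/-! ### Comparison of the two potentials -/

theorem Matrix.sum_inv_conjTranspose_mul_self {n : Type*} [Fintype n] [DecidableEq n]
    {a : Matrix n n ℂ} (ha : IsUnit a) (k : n → ℂ) :
    ∑ s, ∑ t, (aᴴ * a)⁻¹ t s * (∑ I, k I * conj (a I s)) * conj (∑ I, k I * conj (a I t))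
      = ∑ I, k I * conj (k I) := by
  have ha' := (Matrix.isUnit_iff_isUnit_det _).1 ha
  have hv : (fun s => ∑ I, k I * conj (a I s)) = aᴴ *ᵥ k := by
    ext s
    simp [Matrix.mulVec, dotProduct, mul_comm]
  have h1 : ∀ v : n → ℂ, ∑ s, ∑ t, (aᴴ * a)⁻¹ t s * v s * conj (v t)
      = star v ⬝ᵥ ((aᴴ * a)⁻¹ *ᵥ v) := fun v => by
    rw [Finset.sum_comm]
    simp only [dotProduct, Matrix.mulVec, Finset.mul_sum, Pi.star_apply, RCLike.star_def]
    exact Finset.sum_congr rfl fun t _ => Finset.sum_congr rfl fun s _ => by ring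
  have h2 : IsUnit (aᴴ).det := by rw [Matrix.det_conjTranspose]; exact ha'.star
  -- The identity a (aᴴ a)⁻¹ aᴴ = 1 for invertible square a: the metric norm of aᴴ k is the norm of
  -- k.
  rw [h1 fun s => ∑ I, k I * conj (a I s), hv, Matrix.star_mulVec,
    Matrix.conjTranspose_conjTranspose, Matrix.mulVec_mulVec,
    ← Matrix.dotProduct_mulVec, Matrix.mulVec_mulVec, Matrix.mul_inv_rev, Matrix.mul_assoc,
    Matrix.nonsing_inv_mul _ h2, Matrix.mul_one, Matrix.mul_nonsing_inv _ ha', Matrix.one_mulVec]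
  simp [dotProduct, mul_comm]

/-- The value `Im f_{ΛΣ} D^Λ D^Σ = 4 (Im f)^{-1 ΛΣ} P_Λ P_Σ`. -/
theorem N1Data.sum_Imf_Dterm {ℓ v : Type*} [Fintype ℓ] [DecidableEq ℓ] [Fintype v] [DecidableEq v]
    (D : N1Data ℓ v) {p : ℓ → ℂ} (h : IsUnit (D.Imf p)) :
    ∑ Λ, ∑ Ξ, (D.Imf p Λ Ξ : ℂ) * D.Dterm p Λ * D.Dterm p Ξ
      = 4 * ∑ Λ, ∑ Ξ, (((D.Imf p)⁻¹ Λ Ξ : ℝ) : ℂ) * D.P p Λ * D.P p Ξ := by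
  have hd : D.Dterm p = (-2 : ℝ) • ((D.Imf p)⁻¹ *ᵥ D.P p) := by
    ext Λ
    simp [Dterm, Matrix.mulVec, dotProduct]
  have h1 : ∑ Λ, ∑ Ξ, D.Imf p Λ Ξ * D.Dterm p Λ * D.Dterm p Ξ
      = D.Dterm p ⬝ᵥ (D.Imf p *ᵥ D.Dterm p) := by
    simp only [dotProduct, Matrix.mulVec, Finset.mul_sum]
    exact Finset.sum_congr rfl fun _ _ => Finset.sum_congr rfl fun _ _ => by ring
  have h2 : ∑ Λ, ∑ Ξ, (D.Imf p)⁻¹ Λ Ξ * D.P p Λ * D.P p Ξ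
      = ((D.Imf p)⁻¹ *ᵥ D.P p) ⬝ᵥ D.P p := by
    rw [dotProduct_comm]
    simp only [dotProduct, Matrix.mulVec, Finset.mul_sum]
    exact Finset.sum_congr rfl fun _ _ => Finset.sum_congr rfl fun _ _ => by ring
  have h3 : ∑ Λ, ∑ Ξ, D.Imf p Λ Ξ * D.Dterm p Λ * D.Dterm p Ξ
      = 4 * ∑ Λ, ∑ Ξ, (D.Imf p)⁻¹ Λ Ξ * D.P p Λ * D.P p Ξ := by
    rw [h1, h2, hd, Matrix.mulVec_smul, Matrix.mulVec_mulVec,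
      Matrix.mul_nonsing_inv _ ((Matrix.isUnit_iff_isUnit_det _).1 h), Matrix.one_mulVec,
      smul_dotProduct, dotProduct_smul, smul_smul]
    norm_num
  exact_mod_cast congrArg Complex.ofReal h3

namespace Truncation

variable {C V H : Type*} [Fintype C] [DecidableEq C] [Fintype V] [DecidableEq V]
  [Fintype H] [DecidableEq H]
  {S : SpecialKahler (C ⊕ V)} {Q : QuaternionicKahler H}
  {𝔤 : StructureConstants (Option (C ⊕ V))} {VG : VectorGauging S 𝔤} {HG : HyperGauging Q 𝔤}
  (T : Truncation S Q VG HG) {z : C → ℂ} {w : H → ℂ}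

/-- `L^X P^i_X` on `M_R × M^KH`. -/
def sumLP (z : C → ℂ) (w : H → ℂ) (i : Fin 3) : ℂ :=
  ∑ x, S.L (ixX x) (T.ι z) * HG.P (ixX x) i (T.j w)

/-- `L^X U^{2I}(k_X)` on `M_R × M^KH`. -/
def sumLk (z : C → ℂ) (w : H → ℂ) (I : H) : ℂ := ∑ x, S.L (ixX x) (T.ι z) * T.normal w x I

/-- `L̄^X U^{2I}(k_X)` on `M_R × M^KH`. -/
def sumConjLk (z : C → ℂ) (w : H → ℂ) (I : H) : ℂ :=
  ∑ x, conj (S.L (ixX x) (T.ι z)) * T.normal w x I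

/-- `(Im 𝒩)^{-1 XY} P^i_X P^i_Y` on `M_R × M^KH`. -/
def quadX (z : C → ℂ) (w : H → ℂ) (i : Fin 3) : ℂ :=
  ∑ x, ∑ y, (((T.ImNX z)⁻¹ x y : ℝ) : ℂ) * HG.P (ixX x) i (T.j w) * HG.P (ixX y) i (T.j w)

theorem mem_reduced_dom (hz : z ∈ T.Z) (hw : w ∈ T.W) : Sum.elim z w ∈ T.reduced.dom := ⟨hz, hw⟩

theorem ImNX_inv_symm (hz : z ∈ T.Z) (x y : Option C) : (T.ImNX z)⁻¹ x y = (T.ImNX z)⁻¹ y x := by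
  have h : (T.ImNX z)ᵀ = T.ImNX z := by
    ext x y
    simp [ImNX, SpecialKahler.ImN, (S.N_isSymm (T.mem_dom hz)).apply (ixX x)]
  conv_lhs => rw [← h, ← Matrix.transpose_nonsing_inv, Matrix.transpose_apply]

theorem ImNΛ_inv_symm (hz : z ∈ T.Z) (v v' : V) : (T.ImNΛ z)⁻¹ v v' = (T.ImNΛ z)⁻¹ v' v := by
  have h : (T.ImNΛ z)ᵀ = T.ImNΛ z := by
    ext x y
    simp [ImNΛ, SpecialKahler.ImN, (S.N_isSymm (T.mem_dom hz)).apply (ixΛ x)]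
  conv_lhs => rw [← h, ← Matrix.transpose_nonsing_inv, Matrix.transpose_apply]

theorem sum_charge (z : C → ℂ) (w : H → ℂ) : ∑ x, S.L (ixX x) (T.ι z) * T.charge x w
    = T.sumLP z w 0 - Complex.I * T.sumLP z w 1 := by
  rw [sumLP, sumLP, Finset.mul_sum, ← Finset.sum_sub_distrib]
  exact Finset.sum_congr rfl fun x _ => by rw [charge]; ring

theorem sum_conj_charge (z : C → ℂ) (w : H → ℂ) : ∑ x, S.L (ixX x) (T.ι z) * conj (T.charge x w)
    = T.sumLP z w 0 + Complex.I * T.sumLP z w 1 := by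
  rw [sumLP, sumLP, Finset.mul_sum, ← Finset.sum_add_distrib]
  refine Finset.sum_congr rfl fun x _ => ?_
  simp only [charge, map_sub, map_mul, Complex.conj_ofReal, Complex.conj_I]
  ring

theorem sum_ImNX_inv_charge (hz : z ∈ T.Z) (w : H → ℂ) :
    ∑ x, ∑ y, (((T.ImNX z)⁻¹ x y : ℝ) : ℂ) * conj (T.charge x w) * T.charge y w
      = T.quadX z w 0 + T.quadX z w 1 := by
  have h : ∑ x, ∑ y, (((T.ImNX z)⁻¹ x y : ℝ) : ℂ) * HG.P (ixX x) 1 (T.j w) * HG.P (ixX y) 0 (T.j w)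
      = ∑ x, ∑ y, (((T.ImNX z)⁻¹ x y : ℝ) : ℂ) * HG.P (ixX x) 0 (T.j w)
        * HG.P (ixX y) 1 (T.j w) := by
    rw [Finset.sum_comm]
    exact Finset.sum_congr rfl fun x _ => Finset.sum_congr rfl fun y _ => by
      rw [T.ImNX_inv_symm hz y x]; ring
  have h' := congrArg (Complex.I * ·) (sub_eq_zero.2 h)
  simp only [mul_zero] at h'
  rw [quadX, quadX, ← add_zero (_ + _), ← h']
  simp only [Finset.mul_sum, ← Finset.sum_add_distrib, ← Finset.sum_sub_distrib]
  refine Finset.sum_congr rfl fun x _ => Finset.sum_congr rfl fun y _ => ?_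
  simp only [charge, map_sub, map_mul, Complex.conj_ofReal, Complex.conj_I]
  linear_combination (-(((T.ImNX z)⁻¹ x y : ℝ) : ℂ) * HG.P (ixX x) 1 (T.j w)
    * HG.P (ixX y) 1 (T.j w)) * Complex.I_mul_I

/-- `4 |∇_c L|^2` along `M_R`. -/
theorem gradient_special (hz : z ∈ T.Z) (hw : w ∈ T.W) :
    4 * ∑ c, ∑ d, (T.gR z)⁻¹ d c * T.reduced.covL (Sum.inl c) (Sum.elim z w)
        * conj (T.reduced.covL (Sum.inl d) (Sum.elim z w))
      = -(1 / 2) * (T.quadX z w 0 + T.quadX z w 1)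
        - (T.sumLP z w 0 + Complex.I * T.sumLP z w 1)
          * conj (T.sumLP z w 0 + Complex.I * T.sumLP z w 1) := by
  have hcov : ∀ c, T.reduced.covL (Sum.inl c) (Sum.elim z w)
      = Complex.I / 2 * ∑ x, T.fR z c (ixX x) * T.charge x w := fun c =>
    T.covL_inl (T.mem_reduced_dom hz hw) c
  have h1 : (T.sumLP z w 0 + Complex.I * T.sumLP z w 1)
      * conj (T.sumLP z w 0 + Complex.I * T.sumLP z w 1)
      = ∑ x, ∑ y, S.L (ixX x) (T.ι z) * conj (S.L (ixX y) (T.ι z))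
        * conj (T.charge x w) * T.charge y w := by
    rw [← T.sum_conj_charge, map_sum, Finset.sum_mul_sum]
    refine Finset.sum_congr rfl fun x _ => Finset.sum_congr rfl fun y _ => ?_
    rw [map_mul, Complex.conj_conj]
    ring
  have h2 : 4 * ∑ c, ∑ d, (T.gR z)⁻¹ d c * T.reduced.covL (Sum.inl c) (Sum.elim z w)
        * conj (T.reduced.covL (Sum.inl d) (Sum.elim z w))
      = ∑ x, ∑ y, (∑ d, (∑ c, conj (T.fR z c (ixX x)) * (T.gR z)⁻¹ c d) * T.fR z d (ixX y))
        * conj (T.charge x w) * T.charge y w := by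
    have h3 : ∀ c d, (T.gR z)⁻¹ d c * T.reduced.covL (Sum.inl c) (Sum.elim z w)
        * conj (T.reduced.covL (Sum.inl d) (Sum.elim z w)) = 1 / 4 * ∑ x, ∑ y,
          conj (T.fR z d (ixX x)) * (T.gR z)⁻¹ d c * T.fR z c (ixX y)
          * conj (T.charge x w) * T.charge y w := fun c d => by
      simp only [hcov, map_mul, map_div₀, Complex.conj_I, Complex.conj_ofNat, map_sum]
      have h4 : (∑ x, conj (T.fR z d (ixX x)) * conj (T.charge x w))
          * (∑ y, T.fR z c (ixX y) * T.charge y w) * (T.gR z)⁻¹ d c = ∑ x, ∑ y,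
          conj (T.fR z d (ixX x)) * (T.gR z)⁻¹ d c * T.fR z c (ixX y)
          * conj (T.charge x w) * T.charge y w := by
        rw [Finset.sum_mul_sum, Finset.sum_mul]
        refine Finset.sum_congr rfl fun x _ => ?_
        rw [Finset.sum_mul]
        exact Finset.sum_congr rfl fun y _ => by ring
      rw [← h4]
      linear_combination (-(1 / 4) * (∑ x, conj (T.fR z d (ixX x)) * conj (T.charge x w))
          * (∑ y, T.fR z c (ixX y) * T.charge y w) * (T.gR z)⁻¹ d c) * Complex.I_mul_I
    simp only [h3, ← Finset.mul_sum]
    rw [← mul_assoc, show (4 : ℂ) * (1 / 4) = 1 by norm_num, one_mul]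
    simp only [Finset.sum_mul]
    calc _ = ∑ c, ∑ x, ∑ y, ∑ d, conj (T.fR z d (ixX x)) * (T.gR z)⁻¹ d c * T.fR z c (ixX y)
          * conj (T.charge x w) * T.charge y w := Finset.sum_congr rfl fun c _ => by
            rw [Finset.sum_comm]
            exact Finset.sum_congr rfl fun x _ => Finset.sum_comm
      _ = _ := by
        rw [Finset.sum_comm]
        exact Finset.sum_congr rfl fun x _ => Finset.sum_comm
  rw [h1, h2, ← T.sum_ImNX_inv_charge hz, Finset.mul_sum, ← Finset.sum_sub_distrib]
  refine Finset.sum_congr rfl fun x _ => ?_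
  rw [Finset.mul_sum, ← Finset.sum_sub_distrib]
  refine Finset.sum_congr rfl fun y _ => ?_
  -- Completeness of the frame on M_R: f̄ g⁻¹ f = -½ (Im 𝒩)⁻¹ - L L̄. The second term produces the
  -- square |a + ib|², where a = L^X P¹_X and b = L^X P²_X.
  rw [T.ImNX_inv hz]
  ring

/-- `|∇_s L|^2` along `M^KH`. -/
theorem gradient_hyper (hz : z ∈ T.Z) (hw : w ∈ T.W) :
    ∑ s, ∑ t, (T.gKH w)⁻¹ t s * T.reduced.covL (Sum.inr s) (Sum.elim z w)
        * conj (T.reduced.covL (Sum.inr t) (Sum.elim z w))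
      = 2 * ∑ I, T.sumLk z w I * conj (T.sumLk z w I) := by
  have hcov : ∀ s, T.reduced.covL (Sum.inr s) (Sum.elim z w)
      = -2 * ∑ I, T.sumLk z w I * conj (T.vielbein w I s) := fun s =>
    T.covL_inr (T.mem_reduced_dom hz hw) s
  have hu := T.isUnit_vielbein hw
  have hinv : (T.gKH w)⁻¹ = (1 / 2 : ℂ) • ((T.vielbein w)ᴴ * T.vielbein w)⁻¹ := by
    refine Matrix.inv_eq_right_inv ?_
    rw [T.gKH_eq hw, Matrix.smul_mul, Matrix.mul_smul, smul_smul, Matrix.mul_nonsing_inv _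
      ((Matrix.isUnit_iff_isUnit_det _).1 (((Matrix.isUnit_conjTranspose _).2 hu).mul hu))]
    norm_num
  rw [← Matrix.sum_inv_conjTranspose_mul_self hu, Finset.mul_sum]
  refine Finset.sum_congr rfl fun s _ => ?_
  rw [Finset.mul_sum]
  refine Finset.sum_congr rfl fun t _ => ?_
  rw [hinv, hcov, hcov, Matrix.smul_apply, smul_eq_mul, map_mul, map_neg, Complex.conj_ofNat]
  ring

/-- Substituting D = -2 (Im f)⁻¹ P gives 4 (Im f)⁻¹ P P, and Im f = -2 Im 𝒩_{ΛΣ} turns the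
coefficient into -2. -/
theorem sum_Dterm (hz : z ∈ T.Z) (w : H → ℂ) :
    ∑ Λ, ∑ Ξ, (T.reduced.Imf (Sum.elim z w) Λ Ξ : ℂ) * T.reduced.Dterm (Sum.elim z w) Λ
        * T.reduced.Dterm (Sum.elim z w) Ξ
      = -2 * ∑ v, ∑ v', (((T.ImNΛ z)⁻¹ v v' : ℝ) : ℂ)
        * (VG.P0 (ixΛ v) (T.ι z) + HG.P (ixΛ v) 2 (T.j w))
        * (VG.P0 (ixΛ v') (T.ι z) + HG.P (ixΛ v') 2 (T.j w)) := by
  have hI : T.reduced.Imf (Sum.elim z w) = (-2 : ℝ) • T.ImNΛ z := T.Imf_eq _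
  have hu := (T.neg_two_ImNΛ_posDef hz).isUnit
  have hu' := (Matrix.isUnit_iff_isUnit_det _).1 (isUnit_of_smul hu)
  have hinv : (T.reduced.Imf (Sum.elim z w))⁻¹ = (-(1 / 2) : ℝ) • (T.ImNΛ z)⁻¹ := by
    refine Matrix.inv_eq_right_inv ?_
    rw [hI, Matrix.smul_mul, Matrix.mul_smul, smul_smul, Matrix.mul_nonsing_inv _ hu']
    norm_num
  have hP : ∀ v, T.reduced.P (Sum.elim z w) v
      = VG.P0 (ixΛ v) (T.ι z) + HG.P (ixΛ v) 2 (T.j w) := fun v => rfl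
  rw [T.reduced.sum_Imf_Dterm (hI ▸ hu), hinv, Finset.mul_sum, Finset.mul_sum]
  refine Finset.sum_congr rfl fun v _ => ?_
  rw [Finset.mul_sum, Finset.mul_sum]
  refine Finset.sum_congr rfl fun v' _ => ?_
  simp only [hP, Matrix.smul_apply, smul_eq_mul]
  push_cast
  ring

/-- The equivariance of the prepotentials, contracted with `L̄^X L^Y`. -/
theorem tri_eq_sumLP (hz : z ∈ T.Z) (hw : w ∈ T.W) :
    𝔤.tri (fun Λ => conj (S.L Λ (T.ι z))) (fun Λ => S.L Λ (T.ι z))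
        (fun Λ => (HG.P Λ 2 (T.j w) : ℂ))
      = conj (T.sumLP z w 0) * T.sumLP z w 1 - conj (T.sumLP z w 1) * T.sumLP z w 0
        - 2 * Complex.I * (∑ I, T.sumLk z w I * conj (T.sumLk z w I)
          - ∑ I, T.sumConjLk z w I * conj (T.sumConjLk z w I)) := by
  -- The third component of equivariance, solved for the structure constants; Ω³ on the normal
  -- fields involves only U^{2I}(k_X).
  have h0 : ∀ x y : Option C, ∑ Γ, (𝔤.c (ixX x) (ixX y) Γ : ℂ) * HG.P Γ 2 (T.j w)
      = (HG.P (ixX x) 0 (T.j w) * HG.P (ixX y) 1 (T.j w)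
        - HG.P (ixX x) 1 (T.j w) * HG.P (ixX y) 0 (T.j w)) - 2 * Complex.I *
        ∑ I, (conj (T.normal w x I) * T.normal w y I
          - T.normal w x I * conj (T.normal w y I)) := fun x y => by
    have h := congrArg Complex.ofReal
      (HG.equivariance (T.mem_hyper_dom hw) (ixX x) (ixX y) 2)
    simp only [crossProduct_apply_add, show (2 : Fin 3) + 1 = 0 from rfl,
      show (2 : Fin 3) + 2 = 1 from rfl, Complex.ofReal_add, T.Ω_two_k_k hw] at h
    push_cast at h
    linear_combination -h
  have h1 : 𝔤.tri (fun Λ => conj (S.L Λ (T.ι z))) (fun Λ => S.L Λ (T.ι z))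
        (fun Λ => (HG.P Λ 2 (T.j w) : ℂ))
      = ∑ x : Option C, ∑ y : Option C, conj (S.L (ixX x) (T.ι z)) * S.L (ixX y) (T.ι z)
        * ∑ Γ, (𝔤.c (ixX x) (ixX y) Γ : ℂ) * HG.P Γ 2 (T.j w) := by
    rw [StructureConstants.tri, sum_ixX_add_sum_ixΛ]
    simp only [T.L_Λ z hz, map_zero, zero_mul, Finset.sum_const_zero, add_zero]
    refine Finset.sum_congr rfl fun x _ => ?_
    rw [sum_ixX_add_sum_ixΛ]
    simp only [T.L_Λ z hz, mul_zero, zero_mul, Finset.sum_const_zero, add_zero, Finset.mul_sum]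
    exact Finset.sum_congr rfl fun y _ => Finset.sum_congr rfl fun Γ _ => by ring
  have h2 : ∀ I, T.sumLk z w I * conj (T.sumLk z w I) = ∑ x, ∑ y,
      conj (S.L (ixX x) (T.ι z)) * S.L (ixX y) (T.ι z)
        * (conj (T.normal w x I) * T.normal w y I) := fun I => by
    rw [mul_comm, sumLk, map_sum, Finset.sum_mul_sum]
    refine Finset.sum_congr rfl fun x _ => Finset.sum_congr rfl fun y _ => ?_
    rw [map_mul]
    ring
  have h3 : ∀ I, T.sumConjLk z w I * conj (T.sumConjLk z w I) = ∑ x, ∑ y,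
      conj (S.L (ixX x) (T.ι z)) * S.L (ixX y) (T.ι z)
        * (T.normal w x I * conj (T.normal w y I)) := fun I => by
    rw [sumConjLk, map_sum, Finset.sum_mul_sum]
    refine Finset.sum_congr rfl fun x _ => Finset.sum_congr rfl fun y _ => ?_
    rw [map_mul, Complex.conj_conj]
    ring
  have h4 : ∑ I, T.sumLk z w I * conj (T.sumLk z w I)
      - ∑ I, T.sumConjLk z w I * conj (T.sumConjLk z w I)
      = ∑ x, ∑ y, conj (S.L (ixX x) (T.ι z)) * S.L (ixX y) (T.ι z)
        * ∑ I, (conj (T.normal w x I) * T.normal w y I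
          - T.normal w x I * conj (T.normal w y I)) := by
    simp only [h2, h3, ← Finset.sum_sub_distrib, ← mul_sub, Finset.mul_sum]
    rw [Finset.sum_comm]
    exact Finset.sum_congr rfl fun x _ => Finset.sum_comm
  have h5 : ∀ i k, conj (T.sumLP z w i) * T.sumLP z w k = ∑ x, ∑ y,
      conj (S.L (ixX x) (T.ι z)) * S.L (ixX y) (T.ι z)
        * (HG.P (ixX x) i (T.j w) * HG.P (ixX y) k (T.j w)) := fun i k => by
    rw [sumLP, map_sum, sumLP, Finset.sum_mul_sum]
    refine Finset.sum_congr rfl fun x _ => Finset.sum_congr rfl fun y _ => ?_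
    rw [map_mul, Complex.conj_ofReal]
    ring
  rw [h1, h4, h5, h5, Finset.mul_sum, ← Finset.sum_sub_distrib, ← Finset.sum_sub_distrib]
  refine Finset.sum_congr rfl fun x _ => ?_
  rw [Finset.mul_sum, ← Finset.sum_sub_distrib, ← Finset.sum_sub_distrib]
  refine Finset.sum_congr rfl fun y _ => ?_
  rw [h0]
  ring

/-- The metric is a Hermitian product plus its conjugate, so both the L- and the L̄-contraction of
the normal components appear. Only the first occurs in the gradient of the superpotential. -/
theorem sum_h_k_k (hz : z ∈ T.Z) (hw : w ∈ T.W) :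
    ∑ Λ, ∑ Ξ, Q.h (T.j w) (HG.k Λ (T.j w)) (HG.k Ξ (T.j w))
        * (conj (S.L Λ (T.ι z)) * S.L Ξ (T.ι z))
      = ∑ I, T.sumLk z w I * conj (T.sumLk z w I)
        + ∑ I, T.sumConjLk z w I * conj (T.sumConjLk z w I) := by
  have h1 : ∀ φ : Option (C ⊕ V) → Option (C ⊕ V) → ℂ,
      ∑ Λ, ∑ Ξ, φ Λ Ξ * (conj (S.L Λ (T.ι z)) * S.L Ξ (T.ι z))
        = ∑ x : Option C, ∑ y : Option C, φ (ixX x) (ixX y)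
          * (conj (S.L (ixX x) (T.ι z)) * S.L (ixX y) (T.ι z)) := fun φ => by
    simp [-Fintype.sum_option, -Fintype.sum_sum_type, sum_ixX_add_sum_ixΛ, T.L_Λ z hz]
  have h2 : ∀ x y I, (T.normal w x I * conj (T.normal w y I)
      + conj (T.normal w x I) * T.normal w y I)
        * (conj (S.L (ixX x) (T.ι z)) * S.L (ixX y) (T.ι z))
      = conj (S.L (ixX x) (T.ι z) * T.normal w x I) * (S.L (ixX y) (T.ι z) * T.normal w y I)
        + conj (S.L (ixX x) (T.ι z)) * T.normal w x I
          * conj (conj (S.L (ixX y) (T.ι z)) * T.normal w y I) := fun x y I => by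
    simp only [map_mul, Complex.conj_conj]
    ring
  rw [h1]
  simp only [T.h_k_k hw, Finset.sum_mul, h2]
  rw [← Finset.sum_add_distrib]
  calc _ = ∑ x, ∑ I, ∑ y, _ := Finset.sum_congr rfl fun x _ => Finset.sum_comm
    _ = ∑ I, ∑ x, ∑ y, _ := Finset.sum_comm
    _ = _ := Finset.sum_congr rfl fun I _ => by
      simp only [Finset.sum_add_distrib, ← Finset.mul_sum, ← Finset.sum_mul, ← map_sum]
      rw [sumLk, sumConjLk, mul_comm (conj _)]

theorem sum_conj_L_P (hz : z ∈ T.Z) (w : H → ℂ) (i : Fin 3) :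
    ∑ Λ, ∑ Ξ, conj (S.L Λ (T.ι z)) * S.L Ξ (T.ι z)
        * (HG.P Λ i (T.j w) * HG.P Ξ i (T.j w) : ℂ)
      = T.sumLP z w i * conj (T.sumLP z w i) := by
  have h : ∑ Λ, S.L Λ (T.ι z) * HG.P Λ i (T.j w) = T.sumLP z w i := by
    rw [sum_ixX_add_sum_ixΛ, sumLP]
    simp [T.L_Λ z hz]
  rw [← h, map_sum, mul_comm, Finset.sum_mul_sum]
  refine Finset.sum_congr rfl fun Λ _ => Finset.sum_congr rfl fun Ξ _ => ?_
  rw [map_mul, Complex.conj_ofReal]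
  ring

/-- `(Im 𝒩)^{-1 ΛΣ} α_Λ β_Σ` over the retained vectors. -/
def quadΛ (z : C → ℂ) (α β : V → ℂ) : ℂ :=
  ∑ v, ∑ v', (((T.ImNΛ z)⁻¹ v v' : ℝ) : ℂ) * α v * β v'

theorem quadΛ_comm (hz : z ∈ T.Z) (α β : V → ℂ) : T.quadΛ z α β = T.quadΛ z β α := by
  rw [quadΛ, Finset.sum_comm]
  refine Finset.sum_congr rfl fun v _ => Finset.sum_congr rfl fun v' _ => ?_
  rw [T.ImNΛ_inv_symm hz]
  ring

theorem quadΛ_add_self (hz : z ∈ T.Z) (α β : V → ℂ) :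
    T.quadΛ z (fun v => α v + β v) (fun v => α v + β v)
      = T.quadΛ z α α + T.quadΛ z β β + 2 * T.quadΛ z α β := by
  rw [two_mul]
  nth_rewrite 4 [T.quadΛ_comm hz]
  simp only [quadΛ, ← Finset.sum_add_distrib]
  exact Finset.sum_congr rfl fun v _ => Finset.sum_congr rfl fun v' _ => by ring

/-- `P^0_Λ` on `M_R`. -/
def P0Λ (z : C → ℂ) (v : V) : ℂ := VG.P0 (ixΛ v) (T.ι z)

/-- `P^3_Λ` on `M^KH`. -/
def P3Λ (w : H → ℂ) (v : V) : ℂ := HG.P (ixΛ v) 2 (T.j w)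

/-- The block form of (Im 𝒩)⁻¹ and the vanishing of P⁰_X, P³_X, P¹_Λ, P²_Λ and L^Λ leave no terms
mixing P⁰ with P³; the Kähler Killing term becomes the square of P⁰ by `sum_g_k_k`. -/
theorem potentialN2_eq (hz : z ∈ T.Z) (hw : w ∈ T.W) :
    potentialN2 S Q VG HG (T.ι z) (T.j w)
      = -(1 / 2) * (T.quadΛ z (T.P0Λ z) (T.P0Λ z) + T.quadΛ z (T.P3Λ w) (T.P3Λ w)
          + T.quadX z w 0 + T.quadX z w 1)
        - 4 * (T.sumLP z w 0 * conj (T.sumLP z w 0) + T.sumLP z w 1 * conj (T.sumLP z w 1))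
        + 4 * (∑ I, T.sumLk z w I * conj (T.sumLk z w I)
          + ∑ I, T.sumConjLk z w I * conj (T.sumConjLk z w I)) := by
  have hg := VG.sum_g_k_k (T.mem_dom hz)
  rw [T.sum_ImN_inv_split hz (fun Λ => (VG.P0 Λ (T.ι z) : ℂ)) fun Λ => (VG.P0 Λ (T.ι z) : ℂ)] at hg
  simp only [T.P0_ixX hz, Complex.ofReal_zero, mul_zero, Finset.sum_const_zero, zero_add] at hg
  have hP : ∀ i, ∑ Λ, ∑ Ξ, (((S.ImN (T.ι z))⁻¹ Λ Ξ : ℝ) : ℂ) * HG.P Λ i (T.j w)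
      * HG.P Ξ i (T.j w) = T.quadX z w i + ∑ v, ∑ v', (((T.ImNΛ z)⁻¹ v v' : ℝ) : ℂ)
        * HG.P (ixΛ v) i (T.j w) * HG.P (ixΛ v') i (T.j w) := fun i =>
    T.sum_ImN_inv_split hz (fun Λ => (HG.P Λ i (T.j w) : ℂ)) fun Λ => (HG.P Λ i (T.j w) : ℂ)
  have hP0 := hP 0
  have hP1 := hP 1
  have hP2 := hP 2
  simp only [T.P_one_Λ w hw, T.P_two_Λ w hw, quadX, T.P_three_X w hw, Complex.ofReal_zero,
    mul_zero, Finset.sum_const_zero, zero_add, add_zero] at hP0 hP1 hP2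
  have hL2 : T.sumLP z w 2 = 0 := by simp [sumLP, T.P_three_X w hw]
  have hL := T.sum_conj_L_P hz w 2
  rw [hL2, zero_mul] at hL
  have h : potentialN2 S Q VG HG (T.ι z) (T.j w)
      = ∑ Λ, ∑ Ξ, (∑ i, ∑ j, S.g (T.ι z) i j * VG.k Λ i (T.ι z) * conj (VG.k Ξ j (T.ι z)))
          * (conj (S.L Λ (T.ι z)) * S.L Ξ (T.ι z))
        + 4 * ∑ Λ, ∑ Ξ, Q.h (T.j w) (HG.k Λ (T.j w)) (HG.k Ξ (T.j w))
          * (conj (S.L Λ (T.ι z)) * S.L Ξ (T.ι z))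
        + ∑ i, (-(1 / 2) * ∑ Λ, ∑ Ξ, (((S.ImN (T.ι z))⁻¹ Λ Ξ : ℝ) : ℂ) * HG.P Λ i (T.j w)
            * HG.P Ξ i (T.j w)
          - 4 * ∑ Λ, ∑ Ξ, conj (S.L Λ (T.ι z)) * S.L Ξ (T.ι z)
            * (HG.P Λ i (T.j w) * HG.P Ξ i (T.j w) : ℂ)) := by
    rw [potentialN2, Fin.sum_univ_three]
    simp only [Finset.mul_sum (Finset.univ : Finset (Option (C ⊕ V))), ← Finset.sum_add_distrib,
      ← Finset.sum_sub_distrib]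
    refine Finset.sum_congr rfl fun Λ _ => Finset.sum_congr rfl fun Ξ _ => ?_
    rw [Fin.sum_univ_three]
    ring
  rw [h, hg, T.sum_h_k_k hz hw, Fin.sum_univ_three, hP0, hP1, hP2, T.sum_conj_L_P hz,
    T.sum_conj_L_P hz, hL]
  simp only [quadΛ, P0Λ, P3Λ, quadX]
  ring

/-- The cross term of the D-term, the one place where the two geometries interact: special geometry
reduces it to f_{XY}^Γ L̄^X L^Y P³_Γ, and equivariance replaces f P³ by quadratic terms in P¹, P²
and by Ω³(k, k). -/
theorem quadΛ_P0_P3 (hz : z ∈ T.Z) (hw : w ∈ T.W) :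
    T.quadΛ z (T.P0Λ z) (T.P3Λ w) = 2 * Complex.I * (conj (T.sumLP z w 0) * T.sumLP z w 1
        - conj (T.sumLP z w 1) * T.sumLP z w 0)
      + 4 * (∑ I, T.sumLk z w I * conj (T.sumLk z w I)
        - ∑ I, T.sumConjLk z w I * conj (T.sumConjLk z w I)) := by
  have h := VG.sum_ImN_inv_P0_mul (T.mem_dom hz) fun Λ => (HG.P Λ 2 (T.j w) : ℂ)
  rw [T.sum_ImN_inv_split hz (fun Λ => (VG.P0 Λ (T.ι z) : ℂ)), T.tri_eq_sumLP hz hw] at h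
  simp only [T.P0_ixX hz, Complex.ofReal_zero, mul_zero, zero_mul, Finset.sum_const_zero,
    zero_add] at h
  rw [quadΛ]
  simp only [P0Λ, P3Λ]
  rw [h]
  linear_combination (-4 * (∑ I, T.sumLk z w I * conj (T.sumLk z w I)
        - ∑ I, T.sumConjLk z w I * conj (T.sumConjLk z w I))) * Complex.I_mul_I

theorem potentialN2_eq_sum (hz : z ∈ T.Z) (hw : w ∈ T.W) :
    potentialN2 S Q VG HG (T.ι z) (T.j w) =
      4 * (-3 * (T.reduced.L (Sum.elim z w) * conj (T.reduced.L (Sum.elim z w)))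
        + (∑ c, ∑ d, (T.gR z)⁻¹ d c * T.reduced.covL (Sum.inl c) (Sum.elim z w)
            * conj (T.reduced.covL (Sum.inl d) (Sum.elim z w)))
        + (∑ s, ∑ t, (T.gKH w)⁻¹ t s * T.reduced.covL (Sum.inr s) (Sum.elim z w)
            * conj (T.reduced.covL (Sum.inr t) (Sum.elim z w)))
        + 1 / 16 * ∑ Λ, ∑ Ξ, (T.reduced.Imf (Sum.elim z w) Λ Ξ : ℂ)
            * T.reduced.Dterm (Sum.elim z w) Λ * T.reduced.Dterm (Sum.elim z w) Ξ) := by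
  have hC := T.gradient_special hz hw
  have hH := T.gradient_hyper hz hw
  have hD := T.sum_Dterm hz w
  have hD' : ∑ v, ∑ v', (((T.ImNΛ z)⁻¹ v v' : ℝ) : ℂ)
        * (VG.P0 (ixΛ v) (T.ι z) + HG.P (ixΛ v) 2 (T.j w))
        * (VG.P0 (ixΛ v') (T.ι z) + HG.P (ixΛ v') 2 (T.j w)) = _ :=
    T.quadΛ_add_self hz (T.P0Λ z) (T.P3Λ w)
  rw [hD', T.quadΛ_P0_P3 hz hw] at hD
  have hL : T.reduced.L (Sum.elim z w)
      = Complex.I / 2 * (T.sumLP z w 0 - Complex.I * T.sumLP z w 1) := by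
    rw [← T.sum_charge]
    rfl
  have hLL : T.reduced.L (Sum.elim z w) * conj (T.reduced.L (Sum.elim z w))
      = 1 / 4 * ((T.sumLP z w 0 - Complex.I * T.sumLP z w 1)
        * conj (T.sumLP z w 0 - Complex.I * T.sumLP z w 1)) := by
    rw [hL]
    simp only [map_mul, map_div₀, Complex.conj_I, Complex.conj_ofNat]
    linear_combination (-(1 / 4) * ((T.sumLP z w 0 - Complex.I * T.sumLP z w 1)
        * conj (T.sumLP z w 0 - Complex.I * T.sumLP z w 1))) * Complex.I_mul_I
  rw [T.potentialN2_eq hz hw, hLL, hH, hD]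
  simp only [map_add, map_sub, map_mul, Complex.conj_I] at hC ⊢
  -- With a = L^X P¹_X and b = L^X P²_X, -3|a - ib|² - |a + ib|² = -4(|a|² + |b|²) + 2i(āb - b̄a),
  -- and the last term cancels against the cross term of the D-term.
  linear_combination -hC - (4 * T.sumLP z w 1 * conj (T.sumLP z w 1)) * Complex.I_mul_I

/-- The kinetic term of the reduced data splits along `M_R × M^KH`. -/
theorem sum_reduced_g_inv (hz : z ∈ T.Z) (hw : w ∈ T.W) (φ : C ⊕ H → ℂ) :
    ∑ l, ∑ m, (T.reduced.g (Sum.elim z w))⁻¹ m l * φ l * conj (φ m)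
      = ∑ c, ∑ d, (T.gR z)⁻¹ d c * φ (Sum.inl c) * conj (φ (Sum.inl d))
        + ∑ s, ∑ t, (T.gKH w)⁻¹ t s * φ (Sum.inr s) * conj (φ (Sum.inr t)) := by
  have h : T.reduced.g (Sum.elim z w) = Matrix.fromBlocks (T.gR z) 0 0 (T.gKH w) := rfl
  have h1 := (T.gR_posDef hz).isUnit
  have h2 := (T.gKH_posDef hw).isUnit
  rw [h, Matrix.inv_fromBlocks_zero₂₁_of_isUnit_iff _ _ _ ⟨fun _ => h2, fun _ => h1⟩]
  simp [Fintype.sum_sum_type]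

theorem potentialN2_eq_potential (hz : z ∈ T.Z) (hw : w ∈ T.W) :
    potentialN2 S Q VG HG (T.ι z) (T.j w) = T.reduced.potential (Sum.elim z w) := by
  rw [T.potentialN2_eq_sum hz hw, N1Data.potential,
    T.sum_reduced_g_inv hz hw fun l => T.reduced.covL l (Sum.elim z w)]
  ring

end Truncation

end

theorem mainTheorem4 {C V H : Type*} [Fintype C] [DecidableEq C] [Fintype V] [DecidableEq V]
    [Fintype H] [DecidableEq H]
    (S : SpecialKahler (C ⊕ V)) (Q : QuaternionicKahler H)
    (𝔤 : StructureConstants (Option (C ⊕ V)))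
    (VG : VectorGauging S 𝔤) (HG : HyperGauging Q 𝔤) (T : Truncation S Q VG HG) :
    T.reduced.IsN1 ∧
    ∀ z ∈ T.Z, ∀ w ∈ T.W,
      potentialN2 S Q VG HG (T.ι z) (T.j w) = T.reduced.potential (Sum.elim z w) ∧
      potentialN2 S Q VG HG (T.ι z) (T.j w) =
        4 * (-3 * (T.reduced.L (Sum.elim z w) * (starRingEnd ℂ) (T.reduced.L (Sum.elim z w)))
          + (∑ c : C, ∑ d : C, (T.gR z)⁻¹ d c * T.reduced.covL (Sum.inl c) (Sum.elim z w)
              * (starRingEnd ℂ) (T.reduced.covL (Sum.inl d) (Sum.elim z w)))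
          + (∑ s : H, ∑ t : H, (T.gKH w)⁻¹ t s * T.reduced.covL (Sum.inr s) (Sum.elim z w)
              * (starRingEnd ℂ) (T.reduced.covL (Sum.inr t) (Sum.elim z w)))
          + 1 / 16 * ∑ Λ : V, ∑ Ξ : V, (T.reduced.Imf (Sum.elim z w) Λ Ξ : ℂ)
              * T.reduced.Dterm (Sum.elim z w) Λ * T.reduced.Dterm (Sum.elim z w) Ξ) :=
  ⟨T.reduced_isN1, fun _ hz _ hw =>
    ⟨T.potentialN2_eq_potential hz hw, T.potentialN2_eq_sum hz hw⟩⟩
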